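/- **Portal with portals, long falls and no terminal velocity, with or without Emancipation Grills, can be solved in pseudopolynomial time.** Precisely, consider the following decision problem. *Levels.* All positions, velocities and directions are fixed-point numbers; in units of the last place they are integer vectors in $\mathbb Z^3$ (third axis upwards), and time runs in discrete ticks. An instance consists of: a number $B$, the range of the fixed-point format (representable numbers are those of absolute value at most $B$); finitely many surfaces, i.e. convex polygons in $\mathbb R^3$ with representable integer corners, each with a front side and marked portalable or not (polygons that are not convex are given by convex pieces; the terrain is otherwise arbitrary, so it may contain long falls: drops that the avatar survives but cannot jump up); finitely many Emancipation Grills, i.e. further such polygons; a start and an end location; and the nonnegative integer physical constants (half-width $r\ge 1$, standing and crouching height $h\ge h_c\ge 2$ and the corresponding eye heights $<h$, $<h_c$, gravity, jump speed, walking speed, air-control speed, step height $<h_c$, portal radius). There is no terminal velocity. *States and inputs.* A state consists of the avatar's position, velocity, orientation and stance and of at most one blue and at most one orange portal (each on a portalable surface). Initially the avatar stands still at the start location and there are no portals. In each tick the user chooses the movement, jump and crouch keys, possibly fires the Portal Gun in one color, and chooses the cursor, a nonzero representable direction which becomes the avatar's orientation. *A tick.* (1) The avatar crouches, or stands up if there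 is room. Her body is an open axis-parallel box of side $2r$ and height $h$ or $h_c$ above her position; a place is obstructed if the body there meets a surface. (2) If the Portal Gun is fired, consider the ray from the eye in the cursor direction. If it hits the front of a portalable surface, no other surface is hit earlier, and every grill that is hit is hit strictly later, then a portal of that color is placed at the hit point (rounded) and replaces the previous portal of this color. Otherwise nothing changes. (3) If the avatar is on the ground, her velocity becomes the walking velocity requested by the keys relative to the orientation, plus the jump speed upwards if the jump key is pressed, and this is the displacement. In the air, gravity is subtracted from the vertical velocity, without any bound on the resulting speed, and the displacement is the velocity plus the air-control velocity requested by the keys. (4) The displacement is carried out in small substeps. In each of them: if both portals exist and the avatar moves into the front of one of them, meeting its opening (the part within the portal radius of the portalable surface carrying it), she is transported to the nearest unobstructed place entirely in front of the other portal, if there is one, and velocity and remaining displacement are rotated (with rounding) by the rotation taking the inward normal of the first portal to the outward normal of the second and upright to upright; else she moves if the target is not obstructed, or, when walking, climbs a step up to the step height; else she loses the components of velocity and displacement along those axes on which a unit step is obstructed (all components, if there is no such axis). Whenever her body meets a grill, both portals vanish. *Question.* Is there a finite sequence of user inputs, with all resulting states representable in the format, that leads from the initial state to a state in which the end location lies in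 the closed body of the avatar? **Claim.** There are one program of a random access machine with logarithmic cost (operations on integers cost one unit plus the bit lengths of operands and addresses) and one polynomial $p$ such that on every instance, given as the list $z_1,\dots,z_m$ of all its integers, the program halts with the correct answer after time at most $p\bigl(\sum_{j=1}^m(|z_j|+1)\bigr)$. The same holds for the problem restricted to levels without Emancipation Grills. -/

import Mathlib

open scoped Matrix

/-! ## A random access machine with logarithmic cost

Structured programs over integer registers and an integer-addressed integer memory.  Every
operation costs one unit plus the bit lengths of the numbers (and addresses) it handles. -/

namespace Ram

/-- Contents of the registers and of the memory. -/
structure Store where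
  reg : ℕ → ℤ
  mem : ℤ → ℤ

/-- Arithmetic expressions; `mem e` reads the memory cell whose address is the value of `e`. -/
inductive Expr where
  | lit (z : ℤ)
  | reg (r : ℕ)
  | mem (e : Expr)
  | add (e f : Expr)
  | sub (e f : Expr)
  | mul (e f : Expr)
  | div (e f : Expr)

/-- Programs; tests succeed when the value of the tested expression is positive. -/
inductive Prog where
  | assign (r : ℕ) (e : Expr)
  | store (addr e : Expr)
  | seq (p q : Prog)
  | ite (e : Expr) (p q : Prog)
  | loop (e : Expr) (p : Prog)

/-- Bit length of an integer. -/
def bitLength (z : ℤ) : ℕ := z.natAbs.size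

/-- The value of an expression (`div` is integer division). -/
def Expr.value (σ : Store) : Expr → ℤ
  | .lit z => z
  | .reg r => σ.reg r
  | .mem e => σ.mem (e.value σ)
  | .add e f => e.value σ + f.value σ
  | .sub e f => e.value σ - f.value σ
  | .mul e f => e.value σ * f.value σ
  | .div e f => e.value σ / f.value σ

/-- The cost of evaluating an expression. -/
def Expr.cost (σ : Store) : Expr → ℕ
  | .lit z => 1 + bitLength z
  | .reg r => 1 + bitLength (σ.reg r)
  | .mem e => e.cost σ + 1 + bitLength (e.value σ) + bitLength (σ.mem (e.value σ))
  | .add e f => e.cost σ + f.cost σ + 1 + bitLength (e.value σ) + bitLength (f.value σ)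
  | .sub e f => e.cost σ + f.cost σ + 1 + bitLength (e.value σ) + bitLength (f.value σ)
  | .mul e f => e.cost σ + f.cost σ + 1 + bitLength (e.value σ) + bitLength (f.value σ)
  | .div e f => e.cost σ + f.cost σ + 1 + bitLength (e.value σ) + bitLength (f.value σ)

def Store.setReg (σ : Store) (r : ℕ) (z : ℤ) : Store :=
  { σ with reg := Function.update σ.reg r z }

def Store.setMem (σ : Store) (a z : ℤ) : Store :=
  { σ with mem := Function.update σ.mem a z }

/-- `Exec p σ σ' t`: started in `σ`, the program `p` halts in `σ'` after time `t`. -/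
inductive Exec : Prog → Store → Store → ℕ → Prop where
  | assign (r : ℕ) (e : Expr) (σ : Store) :
      Exec (.assign r e) σ (σ.setReg r (e.value σ)) (e.cost σ + 1 + bitLength (e.value σ))
  | store (a e : Expr) (σ : Store) :
      Exec (.store a e) σ (σ.setMem (a.value σ) (e.value σ))
        (a.cost σ + e.cost σ + 1 + bitLength (a.value σ) + bitLength (e.value σ))
  | seq {p q : Prog} {σ₁ σ₂ σ₃ : Store} {t u : ℕ} :
      Exec p σ₁ σ₂ t → Exec q σ₂ σ₃ u → Exec (.seq p q) σ₁ σ₃ (t + u)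
  | ite_pos {e : Expr} {p q : Prog} {σ σ' : Store} {t : ℕ} :
      0 < e.value σ → Exec p σ σ' t → Exec (.ite e p q) σ σ' (e.cost σ + 1 + t)
  | ite_neg {e : Expr} {p q : Prog} {σ σ' : Store} {t : ℕ} :
      ¬ 0 < e.value σ → Exec q σ σ' t → Exec (.ite e p q) σ σ' (e.cost σ + 1 + t)
  | loop_stop {e : Expr} {p : Prog} {σ : Store} :
      ¬ 0 < e.value σ → Exec (.loop e p) σ σ (e.cost σ + 1)
  | loop_step {e : Expr} {p : Prog} {σ₁ σ₂ σ₃ : Store} {t u : ℕ} :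
      0 < e.value σ₁ → Exec p σ₁ σ₂ t → Exec (.loop e p) σ₂ σ₃ u →
        Exec (.loop e p) σ₁ σ₃ (e.cost σ₁ + 1 + t + u)

/-- Initially the input list is in memory cells `0, 1, …`, its length is in register `0`, and
everything else is zero. -/
def initial (input : List ℤ) : Store where
  reg r := if r = 0 then (input.length : ℤ) else 0
  mem a := if 0 ≤ a then input.getD a.toNat 0 else 0

/-- The length of a list of integers when all its entries are written in unary. -/
def unarySize (input : List ℤ) : ℕ := (input.map fun z => z.natAbs + 1).sum

/-- The decision problem with set of instances `Inst`, instance encoding `enc` and yes-instances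
`Yes` is solvable in pseudopolynomial time: one program answers every instance, in register `0`,
within time polynomial in the number and the absolute values of the integers in the input. -/
def SolvableInPseudopolynomialTime {α : Type} (Inst : α → Prop) (enc : α → List ℤ)
    (Yes : α → Prop) : Prop :=
  ∃ (prog : Prog) (bound : Polynomial ℕ), ∀ x : α, Inst x →
    ∃ (σ : Store) (t : ℕ), Exec prog (initial (enc x)) σ t ∧
      t ≤ bound.eval (unarySize (enc x)) ∧
      (Yes x → σ.reg 0 = 1) ∧ (¬ Yes x → σ.reg 0 = 0)

end Ram

/-! ## The game

All positions, velocities and directions are fixed-point numbers; the unit is the last place of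
the format, so that they are integer vectors.  The third axis points upwards.  Time runs in
ticks. -/

noncomputable section

namespace PortalGame

open scoped Classical

abbrev Vec := Fin 3 → ℤ

abbrev Point := Fin 3 → ℝ

/-- An integer vector as a point of real three-space. -/
def toPoint (v : Vec) : Point := fun i => (v i : ℝ)

/-- The unit vector pointing upwards. -/
def up : Vec := ![0, 0, 1]

/-- `k / √N`, rounded towards zero. -/
def divSqrt (k : ℤ) (N : ℕ) : ℤ := k.sign * (Nat.sqrt (k.natAbs ^ 2 / N) : ℤ)

/-! ### Levels -/

/-- A convex polygon, given by three of its corners and the list of the others.  Polygons that are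
not convex are represented by their convex pieces. -/
structure Polygon where
  a : Vec
  b : Vec
  c : Vec
  others : List Vec

namespace Polygon

def corners (P : Polygon) : List Vec := P.a :: P.b :: P.c :: P.others

/-- The normal vector; it points to the side from which `a, b, c` appear counterclockwise, the
front. -/
def normal (P : Polygon) : Vec := (P.b - P.a) ⨯₃ (P.c - P.a)

/-- The set of points of the polygon. -/
def region (P : Polygon) : Set Point := convexHull ℝ {x | ∃ v ∈ P.corners, x = toPoint v}

/-- The three chosen corners are not collinear and all corners lie in one plane. -/
def Valid (P : Polygon) : Prop :=
  P.normal ≠ 0 ∧ ∀ v ∈ P.corners, P.normal ⬝ᵥ (v - P.a) = 0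

/-- Two polygons lie in the same plane and face the same side. -/
def Coplanar (P Q : Polygon) : Prop :=
  P.normal ⨯₃ Q.normal = 0 ∧ 0 < P.normal ⬝ᵥ Q.normal ∧ P.normal ⬝ᵥ (Q.a - P.a) = 0

end Polygon

/-- A piece of the level geometry, which may or may not admit portals. -/
structure Surface where
  shape : Polygon
  portalable : Bool

/-- The physical constants of the game, in fixed-point units (and ticks).  There is no terminal
velocity among them. -/
structure Physics where
  radius : ℕ
  height : ℕ
  crouchHeight : ℕ
  eyeHeight : ℕ
  crouchEyeHeight : ℕ
  gravity : ℕ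
  jumpSpeed : ℕ
  walkSpeed : ℕ
  airSpeed : ℕ
  stepHeight : ℕ
  portalRadius : ℕ

/-- An instance: the level geometry, its Emancipation Grills, a start and an end location,
the physical constants, and the largest absolute value `range` of the fixed-point format. -/
structure Level where
  range : ℕ
  physics : Physics
  start : Vec
  goal : Vec
  surfaces : List Surface
  grills : List Polygon

/-- The vector is representable in the fixed-point format of the level. -/
def Level.Fits (L : Level) (v : Vec) : Prop := ∀ i, |v i| ≤ (L.range : ℤ)

def Level.polygons (L : Level) : List Polygon := L.surfaces.map Surface.shape ++ L.grills

def Level.WellFormed (L : Level) : Prop :=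
  (∀ P ∈ L.polygons, P.Valid ∧ ∀ v ∈ P.corners, L.Fits v) ∧ L.Fits L.start ∧ L.Fits L.goal ∧
  1 ≤ L.physics.radius ∧ 2 ≤ L.physics.crouchHeight ∧ L.physics.crouchHeight ≤ L.physics.height ∧
  L.physics.eyeHeight < L.physics.height ∧ L.physics.crouchEyeHeight < L.physics.crouchHeight ∧
  L.physics.stepHeight < L.physics.crouchHeight

/-! ### States and inputs -/

inductive Color where
  | blue
  | orange
deriving DecidableEq

def Color.other : Color → Color
  | .blue => .orange
  | .orange => .blue

/-- A portal: the surface on which it lies and its position. -/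
structure Placed where
  surface : Surface
  center : Vec

/-- At most one portal of each color exists. -/
abbrev Portals := Color → Option Placed

/-- The state of the game; `pos` is the centre of the bottom of the avatar's body. -/
structure State where
  pos : Vec
  vel : Vec
  look : Vec
  crouched : Bool
  portals : Portals

/-- The user input in one tick: the movement keys, the jump and crouch keys, the trigger of the
Portal Gun, and the cursor, given by a direction in space. -/
structure Input where
  forward : SignType
  strafe : SignType
  jump : Bool
  crouch : Bool
  fire : Option Color
  cursor : Vec

def State.Fits (L : Level) (s : State) : Prop :=
  L.Fits s.pos ∧ L.Fits s.vel ∧ L.Fits s.look ∧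
    ∀ c : Color, ∀ P : Placed, s.portals c = some P → L.Fits P.center

def Input.Legal (L : Level) (i : Input) : Prop := i.cursor ≠ 0 ∧ L.Fits i.cursor

def Level.startState (L : Level) : State where
  pos := L.start
  vel := 0
  look := ![1, 0, 0]
  crouched := false
  portals := fun _ => none

/-! ### Contact between the avatar and the level -/

def Physics.bodyHeight (F : Physics) (crouched : Bool) : ℕ :=
  if crouched then F.crouchHeight else F.height

/-- The avatar's body at `p`: an open axis-parallel box. -/
def Physics.body (F : Physics) (crouched : Bool) (p : Vec) : Set Point :=
  {x | |x 0 - p 0| < F.radius ∧ |x 1 - p 1| < F.radius ∧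
    (p 2 : ℝ) < x 2 ∧ x 2 < (p 2 : ℝ) + F.bodyHeight crouched}

/-- At `p` the avatar's body would intersect the level geometry. -/
def Level.Obstructed (L : Level) (crouched : Bool) (p : Vec) : Prop :=
  ∃ s ∈ L.surfaces, (L.physics.body crouched p ∩ s.shape.region).Nonempty

/-- At `p` the avatar's body is inside an Emancipation Grill. -/
def Level.InGrill (L : Level) (crouched : Bool) (p : Vec) : Prop :=
  ∃ P ∈ L.grills, (L.physics.body crouched p ∩ P.region).Nonempty

/-- The opening of a portal: the part near its position of the portalable surface on which it
lies. -/
def Level.opening (L : Level) (P : Placed) : Set Point :=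
  {x | (∃ s ∈ L.surfaces, s.portalable = true ∧ P.surface.shape.Coplanar s.shape ∧
      x ∈ s.shape.region) ∧ ∀ i, |x i - P.center i| < L.physics.portalRadius}

/-! ### The Portal Gun -/

def Level.eye (L : Level) (crouched : Bool) (p : Vec) : Vec :=
  p + ((if crouched then L.physics.crouchEyeHeight else L.physics.eyeHeight : ℕ) : ℤ) • up

/-- The parameter at which the ray from `e` in direction `d` meets the plane of a polygon. -/
def rayParam (e d : Vec) (P : Polygon) : ℝ :=
  ((P.normal ⬝ᵥ (P.a - e) : ℤ) : ℝ) / ((P.normal ⬝ᵥ d : ℤ) : ℝ)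

def rayPoint (e d : Vec) (P : Polygon) : Point := toPoint e + rayParam e d P • toPoint d

/-- The ray from `e` in direction `d` hits a polygon (which is infinitely thin, so that a ray
parallel to it does not). -/
def Hits (e d : Vec) (P : Polygon) : Prop :=
  P.normal ⬝ᵥ d ≠ 0 ∧ 0 ≤ rayParam e d P ∧ rayPoint e d P ∈ P.region

/-- A shot from `e` in direction `d` makes a portal on `s`: it hits the front of `s`, which is
portalable, no other surface is hit earlier, and no Emancipation Grill intervenes. -/
def Level.ShotLandsOn (L : Level) (e d : Vec) (s : Surface) : Prop :=
  s.portalable = true ∧ s.shape.normal ⬝ᵥ d < 0 ∧ Hits e d s.shape ∧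
  (∀ s' ∈ L.surfaces, Hits e d s'.shape → rayParam e d s.shape ≤ rayParam e d s'.shape) ∧
  (∀ P ∈ L.grills, Hits e d P → rayParam e d s.shape < rayParam e d P)

/-- The portals after a shot of the given color; the portal is placed at the fixed-point vector
nearest to the point that is hit, and replaces the previous portal of its color. -/
def Level.shoot (L : Level) (e d : Vec) (c : Color) (ports : Portals) : Portals :=
  match L.surfaces.find? fun s => decide (L.ShotLandsOn e d s) with
  | none => ports
  | some s => fun c' =>
      if c' = c then some ⟨s, fun i => round (rayPoint e d s.shape i)⟩ else ports c'

/-! ### Passing through portals -/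

/-- The direction of a portal that is "up" for those who pass it: the upward direction in the
plane of the portal, or the second axis if that plane is horizontal. -/
def upright (n : Vec) : Vec :=
  let e : Vec := if n 0 = 0 ∧ n 1 = 0 then ![0, 1, 0] else up
  (n ⬝ᵥ n) • e - (n ⬝ᵥ e) • n

/-- Change of a vector by passing from a portal with normal `n` to one with normal `m`: the
rotation that takes the inward normal of the first to the outward normal of the second and upright
to upright, rounded. -/
def turn (n m v : Vec) : Vec :=
  let u := upright n
  let w := n ⨯₃ u
  let u' := upright m
  let w' := m ⨯₃ u'
  fun j =>
    divSqrt (-(v ⬝ᵥ n) * m j) ((n ⬝ᵥ n) * (m ⬝ᵥ m)).toNat +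
    divSqrt ((v ⬝ᵥ u) * u' j) ((u ⬝ᵥ u) * (u' ⬝ᵥ u')).toNat +
    divSqrt (-(v ⬝ᵥ w) * w' j) ((w ⬝ᵥ w) * (w' ⬝ᵥ w')).toNat

/-- The place `k` units in front of a portal. -/
def inFront (P : Placed) (k : ℕ) : Vec :=
  P.center + fun j => divSqrt ((k : ℤ) * P.surface.shape.normal j)
    (P.surface.shape.normal ⬝ᵥ P.surface.shape.normal).toNat

/-- At `q` the whole body of the avatar is on the front side of the plane of a portal. -/
def Level.Before (L : Level) (crouched : Bool) (P : Placed) (q : Vec) : Prop :=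
  ∀ x ∈ L.physics.body crouched q,
    0 < toPoint P.surface.shape.normal ⬝ᵥ (x - toPoint P.surface.shape.a)

/-- Where the avatar appears when she comes out of a portal: the nearest unobstructed place that
is entirely in front of it. -/
def Level.exit (L : Level) (crouched : Bool) (P : Placed) : Option Vec :=
  ((List.range (2 * L.physics.radius + L.physics.height + 4)).map (inFront P)).find?
    fun q => decide (L.Before crouched P q ∧ ¬ L.Obstructed crouched q)

/-- Passing through the portal of color `c` by a move to `q` in direction `d`: both portals exist,
the move is into the front of this one, and the body at `q` meets its opening.  The value is the
place of arrival and the effect of the passage on vectors. -/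
def Level.passVia (L : Level) (ports : Portals) (crouched : Bool) (q d : Vec) (c : Color) :
    Option (Vec × (Vec → Vec)) :=
  match ports c, ports c.other with
  | some P, some Q =>
      if P.surface.shape.normal ⬝ᵥ d < 0 ∧ (L.physics.body crouched q ∩ L.opening P).Nonempty then
        (L.exit crouched Q).map fun p => (p, turn P.surface.shape.normal Q.surface.shape.normal)
      else none
  | _, _ => none

def Level.pass (L : Level) (ports : Portals) (crouched : Bool) (q d : Vec) :
    Option (Vec × (Vec → Vec)) :=
  (L.passVia ports crouched q d .blue).or (L.passVia ports crouched q d .orange)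

/-! ### Motion during one tick -/

/-- The avatar in the middle of a tick.  The tick is divided into substeps; after the `k`-th
substep since the last change of course, at `base`, the avatar is due at `base` plus the `k`-th
fraction of the displacement `disp`. -/
structure Motion where
  base : Vec
  disp : Vec
  k : ℕ
  pos : Vec
  vel : Vec
  portals : Portals

/-- The axes along which a motion is stopped by a collision: those along which even a single unit
step is obstructed, or all of them if there is no such axis. -/
def Level.Stopped (L : Level) (crouched : Bool) (m : Motion) (j : Fin 3) : Prop :=
  L.Obstructed crouched (m.pos + Pi.single j (m.disp j).sign) ∨
    ∀ i, ¬ L.Obstructed crouched (m.pos + Pi.single i (m.disp i).sign)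

/-- One of `n` substeps, apart from the effect of the Emancipation Grills.  The avatar passes a
portal, or moves freely, or (when walking) climbs a small step, or collides and loses the
components of the motion that are stopped. -/
def Level.advance (L : Level) (crouched walking : Bool) (n : ℕ) (m : Motion) : Motion :=
  let q : Vec := m.base + fun j => (((m.k : ℤ) + 1) * m.disp j).tdiv n
  match L.pass m.portals crouched q m.disp with
  | some (p, f) =>
      { m with base := p, disp := f m.disp, k := 0, pos := p, vel := f m.vel }
  | none =>
    match (List.range (if walking then L.physics.stepHeight + 1 else 1)).find?
        fun h => decide (¬ L.Obstructed crouched (q + (h : ℤ) • up)) with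
    | some h =>
        { m with base := m.base + (h : ℤ) • up, k := m.k + 1, pos := q + (h : ℤ) • up }
    | none =>
        { m with
          base := m.pos
          disp := fun j => if L.Stopped crouched m j then 0 else m.disp j
          k := 0
          vel := fun j => if L.Stopped crouched m j then 0 else m.vel j }

/-- One of `n` substeps; inside an Emancipation Grill both portals vanish. -/
def Level.substep (L : Level) (crouched walking : Bool) (n : ℕ) (m : Motion) : Motion :=
  let m' := L.advance crouched walking n m
  if L.InGrill crouched m'.pos then { m' with portals := fun _ => none } else m'

/-- The horizontal velocity of the given magnitude in the direction requested by the movement keys,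
relative to the orientation. -/
def Input.wish (i : Input) (speed : ℕ) : Vec :=
  let f : ℤ := (i.forward : ℤ)
  let s : ℤ := (i.strafe : ℤ)
  let w : Vec := ![f * i.cursor 0 + s * i.cursor 1, f * i.cursor 1 - s * i.cursor 0, 0]
  fun j => divSqrt ((speed : ℤ) * w j) (w ⬝ᵥ w).toNat

/-- The avatar stands on the ground (and not on an open portal). -/
def Level.Grounded (L : Level) (ports : Portals) (crouched : Bool) (p v : Vec) : Prop :=
  v 2 ≤ 0 ∧ L.Obstructed crouched (p - up) ∧ L.pass ports crouched (p - up) (-up) = none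

/-- One tick of the game.  The avatar turns, crouches or stands up if there is room, shoots, and
moves: on the ground by walking or jumping; in the air the velocity changes by the acceleration of
gravity without any bound, and the movement keys only shift the avatar slightly. -/
def Level.tick (L : Level) (s : State) (i : Input) : State :=
  let cr : Bool :=
    if i.crouch then true else if L.Obstructed false s.pos then s.crouched else false
  let ports : Portals :=
    match i.fire with
    | none => s.portals
    | some c => L.shoot (L.eye cr s.pos) i.cursor c s.portals
  let grounded : Bool := decide (L.Grounded ports cr s.pos s.vel)
  let vel : Vec :=
    if grounded then
      i.wish L.physics.walkSpeed + (if i.jump then (L.physics.jumpSpeed : ℤ) • up else 0)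
    else s.vel - (L.physics.gravity : ℤ) • up
  let disp : Vec := if grounded then vel else vel + i.wish L.physics.airSpeed
  let n : ℕ := (disp 0).natAbs + (disp 1).natAbs + (disp 2).natAbs + 2
  let m : Motion :=
    (L.substep cr (grounded && !i.jump) n)^[n]
      { base := s.pos, disp := disp, k := 0, pos := s.pos, vel := vel, portals := ports }
  { pos := m.pos, vel := m.vel, look := i.cursor, crouched := cr, portals := m.portals }

/-! ### The decision problem -/

/-- One transition of the state graph: a tick under some user input, with a result that the
fixed-point format can represent. -/
def Level.Step (L : Level) (s s' : State) : Prop :=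
  ∃ i : Input, i.Legal L ∧ s' = L.tick s i ∧ s'.Fits L

/-- The avatar is at the end location. -/
def Level.Won (L : Level) (s : State) : Prop :=
  |L.goal 0 - s.pos 0| ≤ L.physics.radius ∧ |L.goal 1 - s.pos 1| ≤ L.physics.radius ∧
    s.pos 2 ≤ L.goal 2 ∧ L.goal 2 ≤ s.pos 2 + L.physics.bodyHeight s.crouched

/-- The player can get from the start location to the end location. -/
def Level.Traversable (L : Level) : Prop :=
  ∃ s : State, Relation.ReflTransGen L.Step L.startState s ∧ L.Won s

/-! ### Encoding of the instances -/

def encodeVec (v : Vec) : List ℤ := [v 0, v 1, v 2]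

def Polygon.encode (P : Polygon) : List ℤ :=
  (P.corners.length : ℤ) :: P.corners.flatMap encodeVec

def Surface.encode (s : Surface) : List ℤ :=
  (if s.portalable then 1 else 0) :: s.shape.encode

def Physics.encode (F : Physics) : List ℤ :=
  [(F.radius : ℤ), (F.height : ℤ), (F.crouchHeight : ℤ), (F.eyeHeight : ℤ),
    (F.crouchEyeHeight : ℤ), (F.gravity : ℤ), (F.jumpSpeed : ℤ), (F.walkSpeed : ℤ),
    (F.airSpeed : ℤ), (F.stepHeight : ℤ), (F.portalRadius : ℤ)]

/-- The instance as the list of all its numbers. -/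
def Level.encode (L : Level) : List ℤ :=
  [(L.range : ℤ)] ++ L.physics.encode ++ encodeVec L.start ++ encodeVec L.goal ++
    [(L.surfaces.length : ℤ)] ++ L.surfaces.flatMap Surface.encode ++
    [(L.grills.length : ℤ)] ++ L.grills.flatMap Polygon.encode

end PortalGame

end

/-! ## Terms with bounded loops and their compilation -/

/-! Let `R` be the unary size of the instance. Between two ticks a representable state is described
by a fixed number of integers of size polynomial in `R`: position, velocity, stance and, for each
color, the number of a surface and a place. The orientation has no influence on the next tick, and
the cursor is representable as well. Hence there are only polynomially many vertices and inputs, and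
reachability can be decided by marking codes of vertices until nothing new appears. Three points
need an argument.

Bounds inside a tick. The number of substeps of a tick is not fixed, so the configurations after
each substep are made vertices too, and representability is required only between ticks. Without a
terminal velocity one must exclude growth within a tick. Representability bounds the speed at its
beginning and thereby the number of substeps. Passing a portal is a rotation up to rounding, so it
adds at most a constant to the Euclidean norm (`eucl_turn_le`), and a collision does not increase
the norm (`eucl_erase_le`). An additive constant for each of polynomially many substeps is harmless,
whereas a constant factor would not be. This gives `CReach.bounded` and `exists_small`.

Exact geometry. Contact of the open body with a polygon speaks of real points. By Carathéodory four
corners suffice, and their weights solve a strict homogeneous linear system with small integer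
coefficients. Fourier–Motzkin elimination (`exists_int_solution`) turns a real solution into an
integer one of polynomial size, so that contact becomes a bounded search (`exists_meets_iff`).
Whether the rational point hit by a ray lies in a polygon reduces to contact with a tiny box,
because a point outside is separated by a functional with small integer coefficients
(`exists_mem_region_iff`).

The machine. Terms with clamped folds of polynomially many rounds compile to programs of polynomial
cost (`Tm.exists_feasible`). The functions and predicates given by such terms are closed under
arithmetic, bounded search and bounded quantifiers, and the classes `Dfn` and `DfnP` derive from
this that the transition relation on codes is computed by a term. The program sweeps over all codes
and marks those that follow a marked one (`solvable_of_table`). Every sweep that starts from a set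
not yet closed adds a code, so polynomially many sweeps suffice (`exists_closed`). -/

namespace Ram

/-- The environment of a term: a size parameter, a memory and the values of variables. -/
structure Env where
  size : ℕ
  mem : ℤ → ℤ
  var : ℕ → ℤ

def Env.bind (ρ : Env) (x : ℕ) (z : ℤ) : Env := { ρ with var := Function.update ρ.var x z }

/-- Terms.  `fold k x y init body` iterates `body`, in which `x` is the accumulator and `y` the
number of the round, for `size ^ k` rounds; the accumulator is clamped to `± size ^ k`. -/
inductive Tm where
  | lit (z : ℤ)
  | size
  | var (x : ℕ)
  | mem (t : Tm)
  | add (t u : Tm)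
  | sub (t u : Tm)
  | mul (t u : Tm)
  | div (t u : Tm)
  | ite (c t u : Tm)
  | fold (k x y : ℕ) (init body : Tm)

/-- Clamping keeps the accumulator of a fold polynomially short; iterated squaring would otherwise
make its bit length exponential. The tests have the form `0 < _`, as in programs, so that
`clampProg` follows the definition branch by branch. -/
def clamp (b z : ℤ) : ℤ := if 0 < z - b then b else if 0 < 0 - b - z then 0 - b else z

/-- The accumulator of a fold after `i` rounds. -/
def foldAcc (b init : ℤ) (f : ℤ → ℕ → ℤ) : ℕ → ℤ
  | 0 => clamp b init
  | i + 1 => clamp b (f (foldAcc b init f i) i)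

def Tm.value : Tm → Env → ℤ
  | .lit z, _ => z
  | .size, ρ => ρ.size
  | .var x, ρ => ρ.var x
  | .mem t, ρ => ρ.mem (t.value ρ)
  | .add t u, ρ => t.value ρ + u.value ρ
  | .sub t u, ρ => t.value ρ - u.value ρ
  | .mul t u, ρ => t.value ρ * u.value ρ
  | .div t u, ρ => t.value ρ / u.value ρ
  | .ite c t u, ρ => if 0 < c.value ρ then t.value ρ else u.value ρ
  | .fold k x y init body, ρ =>
      foldAcc ((ρ.size : ℤ) ^ k) (init.value ρ)
        (fun a i => body.value ((ρ.bind x a).bind y (i : ℤ))) (ρ.size ^ k)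

theorem clamp_of_abs_le {b z : ℤ} (h : |z| ≤ b) : clamp b z = z := by
  rw [abs_le] at h
  unfold clamp
  split_ifs <;> omega

theorem abs_clamp_le {b : ℤ} (hb : 0 ≤ b) (z : ℤ) : |clamp b z| ≤ b := by
  rw [abs_le]
  unfold clamp
  split_ifs <;> omega

theorem abs_foldAcc_le {b : ℤ} (hb : 0 ≤ b) (init : ℤ) (f : ℤ → ℕ → ℤ) (i : ℕ) :
    |foldAcc b init f i| ≤ b := by
  cases i <;> exact abs_clamp_le hb _

/-! ### Bit lengths -/

theorem bitLength_le_iff {z : ℤ} {n : ℕ} : bitLength z ≤ n ↔ z.natAbs < 2 ^ n := Nat.size_le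

theorem natAbs_lt_bitLength (z : ℤ) : z.natAbs < 2 ^ bitLength z := Nat.lt_size_self _

theorem bitLength_le_natAbs (z : ℤ) : bitLength z ≤ z.natAbs :=
  bitLength_le_iff.2 Nat.lt_two_pow_self

theorem bitLength_add (a b : ℤ) : bitLength (a + b) ≤ bitLength a + bitLength b + 1 := by
  rw [bitLength_le_iff]
  have ha := natAbs_lt_bitLength a
  have hb := natAbs_lt_bitLength b
  have h1 : 2 ^ bitLength a ≤ 2 ^ (bitLength a + bitLength b) :=
    Nat.pow_le_pow_right (by norm_num) (by omega)
  have h2 : 2 ^ bitLength b ≤ 2 ^ (bitLength a + bitLength b) :=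
    Nat.pow_le_pow_right (by norm_num) (by omega)
  have := Int.natAbs_add_le a b
  rw [pow_succ]
  omega

theorem bitLength_sub (a b : ℤ) : bitLength (a - b) ≤ bitLength a + bitLength b + 1 := by
  have := bitLength_add a (-b)
  rwa [← sub_eq_add_neg, show bitLength (-b) = bitLength b by simp [bitLength]] at this

theorem bitLength_mul (a b : ℤ) : bitLength (a * b) ≤ bitLength a + bitLength b := by
  rw [bitLength_le_iff, Int.natAbs_mul, pow_add]
  exact Nat.mul_lt_mul'' (natAbs_lt_bitLength a) (natAbs_lt_bitLength b)

theorem bitLength_mono {a b : ℤ} (h : a.natAbs ≤ b.natAbs) : bitLength a ≤ bitLength b :=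
  Nat.size_le_size h

theorem bitLength_div (a b : ℤ) : bitLength (a / b) ≤ bitLength a := by
  apply bitLength_mono
  have := Int.abs_ediv_le_abs a b
  rw [Int.abs_eq_natAbs, Int.abs_eq_natAbs] at this
  exact_mod_cast this

/-- For `N ≥ 2` a constant factor can be absorbed into the exponent. All cost estimates can
therefore be single powers of `N`. -/
theorem mul_pow_le_pow_add {N : ℕ} (hN : 2 ≤ N) (m c : ℕ) : m * N ^ c ≤ N ^ (c + m) := by
  rw [pow_add, mul_comm]
  exact Nat.mul_le_mul_left _ (Nat.lt_two_pow_self.le.trans (Nat.pow_le_pow_left hN m))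

/-! ### Execution with a bound on the time -/

/-- Started in `σ`, the program halts within time `T` in a store that satisfies `Q`. -/
def Runs (p : Prog) (σ : Store) (Q : Store → Prop) (T : ℕ) : Prop :=
  ∃ σ' t, Exec p σ σ' t ∧ t ≤ T ∧ Q σ'

theorem Runs.mono {p : Prog} {σ : Store} {Q Q' : Store → Prop} {T T' : ℕ} (h : Runs p σ Q T)
    (hT : T ≤ T') (hQ : ∀ τ, Q τ → Q' τ) : Runs p σ Q' T' := by
  obtain ⟨τ, t, h1, h2, h3⟩ := h
  exact ⟨τ, t, h1, h2.trans hT, hQ _ h3⟩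

theorem Runs.assign {r : ℕ} {e : Expr} {σ : Store} {Q : Store → Prop} {T : ℕ}
    (hQ : Q (σ.setReg r (e.value σ))) (hT : e.cost σ + 1 + bitLength (e.value σ) ≤ T) :
    Runs (.assign r e) σ Q T :=
  ⟨_, _, .assign r e σ, hT, hQ⟩

theorem Runs.store {a e : Expr} {σ : Store} {Q : Store → Prop} {T : ℕ}
    (hQ : Q (σ.setMem (a.value σ) (e.value σ)))
    (hT : a.cost σ + e.cost σ + 1 + bitLength (a.value σ) + bitLength (e.value σ) ≤ T) :
    Runs (.store a e) σ Q T :=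
  ⟨_, _, .store a e σ, hT, hQ⟩

theorem Runs.seq {p q : Prog} {σ : Store} {Q Q' : Store → Prop} {T U : ℕ}
    (hp : Runs p σ Q T) (hq : ∀ τ, Q τ → Runs q τ Q' U) : Runs (.seq p q) σ Q' (T + U) := by
  obtain ⟨τ, t, h1, h2, h3⟩ := hp
  obtain ⟨υ, u, h4, h5, h6⟩ := hq τ h3
  exact ⟨υ, t + u, .seq h1 h4, by omega, h6⟩

theorem Runs.ite {e : Expr} {p q : Prog} {σ : Store} {Q : Store → Prop} {T : ℕ}
    (hp : 0 < e.value σ → Runs p σ Q T) (hq : ¬ 0 < e.value σ → Runs q σ Q T) :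
    Runs (.ite e p q) σ Q (e.cost σ + 1 + T) := by
  by_cases h : 0 < e.value σ
  · obtain ⟨τ, t, h1, h2, h3⟩ := hp h
    exact ⟨τ, _, .ite_pos h h1, by omega, h3⟩
  · obtain ⟨τ, t, h1, h2, h3⟩ := hq h
    exact ⟨τ, _, .ite_neg h h1, by omega, h3⟩

/-- Induction on the number of remaining rounds, which the tested expression displays. The factor `n
+ 1` accounts for the last test, which fails. -/
theorem Runs.loop {e : Expr} {p : Prog} {n G T : ℕ} (I : ℕ → Store → Prop)
    (hval : ∀ i ≤ n, ∀ σ, I i σ → e.value σ = (n : ℤ) - i ∧ e.cost σ ≤ G)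
    (hbody : ∀ i < n, ∀ σ, I i σ → Runs p σ (I (i + 1)) T) {σ : Store} (h0 : I 0 σ) :
    Runs (.loop e p) σ (I n) ((n + 1) * (G + 1 + T)) := by
  have key : ∀ j i, i + j = n → ∀ σ, I i σ →
      Runs (.loop e p) σ (I n) ((j + 1) * (G + 1 + T)) := by
    intro j
    induction j with
    | zero =>
      intro i hi σ hσ
      obtain rfl : i = n := by omega
      obtain ⟨hv, hc⟩ := hval i le_rfl σ hσ
      exact ⟨σ, e.cost σ + 1, by constructor; omega, by omega, hσ⟩
    | succ j ih =>
      intro i hi σ hσ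
      obtain ⟨hv, hc⟩ := hval i (by omega) σ hσ
      obtain ⟨τ, t, h1, h2, h3⟩ := hbody i (by omega) σ hσ
      obtain ⟨υ, u, h4, h5, h6⟩ := ih (i + 1) (by omega) τ h3
      exact ⟨υ, _, .loop_step (by omega) h1 h4, by linarith, h6⟩
  exact key n 0 (by omega) σ h0

/-! ### Compilation -/

/-- The expression for the `k`-th power of register `1`. -/
def powExpr : ℕ → Expr
  | 0 => .lit 1
  | k + 1 => .mul (powExpr k) (.reg 1)

/-- Clamps register `d` to the value of register `d + 2`. -/
def clampProg (d : ℕ) : Prog :=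
  .ite (.sub (.reg d) (.reg (d + 2))) (.assign d (.reg (d + 2)))
    (.ite (.sub (.sub (.lit 0) (.reg (d + 2))) (.reg d))
      (.assign d (.sub (.lit 0) (.reg (d + 2)))) (.assign d (.reg d)))

/-- The program that computes a term in register `d`; `ρ` gives the registers of the variables.
Register `1` contains the size. -/
def Tm.comp : Tm → (ℕ → ℕ) → ℕ → Prog
  | .lit z, _, d => .assign d (.lit z)
  | .size, _, d => .assign d (.reg 1)
  | .var x, ρ, d => .assign d (.reg (ρ x))
  | .mem t, ρ, d => .seq (t.comp ρ d) (.assign d (.mem (.reg d)))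
  | .add t u, ρ, d =>
      .seq (t.comp ρ d) (.seq (u.comp ρ (d + 1)) (.assign d (.add (.reg d) (.reg (d + 1)))))
  | .sub t u, ρ, d =>
      .seq (t.comp ρ d) (.seq (u.comp ρ (d + 1)) (.assign d (.sub (.reg d) (.reg (d + 1)))))
  | .mul t u, ρ, d =>
      .seq (t.comp ρ d) (.seq (u.comp ρ (d + 1)) (.assign d (.mul (.reg d) (.reg (d + 1)))))
  | .div t u, ρ, d =>
      .seq (t.comp ρ d) (.seq (u.comp ρ (d + 1)) (.assign d (.div (.reg d) (.reg (d + 1)))))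
  | .ite c t u, ρ, d => .seq (c.comp ρ d) (.ite (.reg d) (t.comp ρ d) (u.comp ρ d))
  -- Register `d` holds the accumulator, `d + 1` the number of the round and `d + 2` the power of
  -- the size, which is both the number of rounds and the bound for clamping. The body works from `d
  -- + 3` on and cannot disturb them.
  | .fold k x y init body, ρ, d =>
      .seq (init.comp ρ d) (.seq (.assign (d + 2) (powExpr k)) (.seq (clampProg d)
        (.seq (.assign (d + 1) (.lit 0))
          (.loop (.sub (.reg (d + 2)) (.reg (d + 1)))
            (.seq (body.comp (Function.update (Function.update ρ x d) y (d + 1)) (d + 3))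
              (.seq (.assign d (.reg (d + 3)))
                (.seq (clampProg d)
                  (.assign (d + 1) (.add (.reg (d + 1)) (.lit 1))))))))))

/-- The store contains the environment, all of whose numbers have at most `N` bits. -/
structure Holds (σ : Store) (ρ : ℕ → ℕ) (E : Env) (N : ℕ) : Prop where
  size : σ.reg 1 = E.size
  mem : σ.mem = E.mem
  var : ∀ x, σ.reg (ρ x) = E.var x
  size_le : E.size ≤ N
  mem_le : ∀ a, bitLength (E.mem a) ≤ N
  var_le : ∀ x, bitLength (E.var x) ≤ N

/-- `τ` arises from `σ` by changing registers from `d` on, and register `d` contains `z`. -/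
structure Result (σ : Store) (d : ℕ) (z : ℤ) (τ : Store) : Prop where
  mem : τ.mem = σ.mem
  low : ∀ r < d, τ.reg r = σ.reg r
  val : τ.reg d = z

/-- The whole environment lives in the memory and in registers below `d`, with the size in register
`1`; hence it survives the evaluation of a subterm from register `d` on. -/
theorem Holds.of_agree {σ τ : Store} {ρ : ℕ → ℕ} {E : Env} {N d : ℕ} (h : Holds σ ρ E N)
    (hd : 2 ≤ d) (hρ : ∀ x, ρ x < d) (hm : τ.mem = σ.mem) (hr : ∀ r < d, τ.reg r = σ.reg r) :
    Holds τ ρ E N :=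
  ⟨by rw [hr 1 (by omega), h.size], by rw [hm, h.mem], fun x => by rw [hr _ (hρ x), h.var],
    h.size_le, h.mem_le, h.var_le⟩

theorem powExpr_value (σ : Store) (k : ℕ) : (powExpr k).value σ = σ.reg 1 ^ k := by
  induction k with
  | zero => simp [powExpr, Expr.value]
  | succ k ih => simp [powExpr, Expr.value, ih, pow_succ]

theorem bitLength_pow_le {R N : ℕ} (h : R ≤ N) (k : ℕ) : bitLength ((R : ℤ) ^ k) ≤ N ^ k := by
  refine (bitLength_le_natAbs _).trans ?_
  rw [Int.natAbs_pow, Int.natAbs_natCast]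
  exact Nat.pow_le_pow_left h k

/-- One more multiplication adds a few terms, each bounded by the previous power of `N`, so that the
factor `N ^ 4 ≥ 16` suffices. -/
theorem powExpr_cost {σ : Store} {R N : ℕ} (hN : 2 ≤ N) (h1 : σ.reg 1 = R) (h : R ≤ N) (k : ℕ) :
    (powExpr k).cost σ ≤ N ^ (4 * k + 2) := by
  induction k with
  | zero =>
    have : bitLength 1 = 1 := by decide
    have h4 : 2 ^ 2 ≤ N ^ 2 := Nat.pow_le_pow_left hN 2
    simp only [powExpr, Expr.cost, this, Nat.mul_zero, Nat.zero_add]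
    omega
  | succ k ih =>
    simp only [powExpr, Expr.cost, powExpr_value, Expr.value, h1]
    have hk := bitLength_pow_le h k
    have hR : bitLength (R : ℤ) ≤ N := by simpa using bitLength_pow_le h 1
    have e1 : N ^ k ≤ N ^ (4 * k + 2) := Nat.pow_le_pow_right (by omega) (by omega)
    have e2 : N ^ 1 ≤ N ^ (4 * k + 2) := Nat.pow_le_pow_right (by omega) (by omega)
    have e3 : N ^ (4 * (k + 1) + 2) = N ^ 4 * N ^ (4 * k + 2) := by ring
    have h4 : 2 ^ 4 ≤ N ^ 4 := Nat.pow_le_pow_left hN 4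
    have e4 : 16 * N ^ (4 * k + 2) ≤ N ^ 4 * N ^ (4 * k + 2) := Nat.mul_le_mul_right _ h4
    rw [pow_one] at e2
    omega

@[simp] theorem setReg_reg_self (σ : Store) (r : ℕ) (z : ℤ) : (σ.setReg r z).reg r = z := by
  simp [Store.setReg]

@[simp] theorem setReg_reg_ne (σ : Store) {r s : ℕ} (z : ℤ) (h : s ≠ r) :
    (σ.setReg r z).reg s = σ.reg s := by
  simp [Store.setReg, h]

@[simp] theorem setReg_mem (σ : Store) (r : ℕ) (z : ℤ) : (σ.setReg r z).mem = σ.mem := rfl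

theorem clampProg_runs {σ : Store} {d : ℕ} {b z : ℤ} {B : ℕ} (hb : σ.reg (d + 2) = b)
    (hz : σ.reg d = z) (hbB : bitLength b ≤ B) (hzB : bitLength z ≤ B) :
    Runs (clampProg d) σ (fun τ => τ = σ.setReg d (clamp b z)) (20 * B + 20) := by
  have h0 : bitLength 0 = 0 := by decide
  have e1 := bitLength_sub z b
  have e2 := bitLength_sub 0 b
  have e3 := bitLength_sub (0 - b) z
  rw [h0] at e2
  refine (Runs.ite (T := 13 * B + 14) (fun h => ?_) (fun h => ?_)).mono ?_ (fun _ => id)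
  · simp only [Expr.value, hb, hz] at h
    refine Runs.assign ?_ ?_
    · simp only [clamp, Expr.value, hb]
      rw [if_pos h]
    · simp only [Expr.cost, Expr.value, hb]
      omega
  · simp only [Expr.value, hb, hz] at h
    refine (Runs.ite (T := 6 * B + 6) (fun h' => ?_) (fun h' => ?_)).mono ?_ (fun _ => id)
    · simp only [Expr.value, hb, hz] at h'
      refine Runs.assign ?_ ?_
      · simp only [clamp, Expr.value, hb]
        rw [if_neg h, if_pos h']
      · simp only [Expr.cost, Expr.value, hb]
        omega
    · simp only [Expr.value, hb, hz] at h'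
      refine Runs.assign ?_ ?_
      · simp only [clamp, Expr.value, hz]
        rw [if_neg h, if_neg h']
      · simp only [Expr.cost, Expr.value, hz]
        omega
    · simp only [Expr.cost, Expr.value, hb, hz]
      omega
  · simp only [Expr.cost, Expr.value, hb, hz]
    omega

end Ram

/-! ### Polynomial running time of compiled terms -/

namespace Ram

/-- On all environments with numbers of at most `N` bits, the term has a value of at most `N ^ c`
bits, which its program computes in time at most `N ^ c`. -/
def Tm.Feasible (t : Tm) (c : ℕ) : Prop :=
  ∀ ⦃N : ℕ⦄ ⦃σ : Store⦄ ⦃ρ : ℕ → ℕ⦄ ⦃d : ℕ⦄ ⦃E : Env⦄, 2 ≤ N → 2 ≤ d → (∀ x, ρ x < d) →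
    Holds σ ρ E N → Runs (t.comp ρ d) σ (Result σ d (t.value E)) (N ^ c) ∧
      bitLength (t.value E) ≤ N ^ c

theorem result_setReg (σ : Store) (d : ℕ) (z : ℤ) : Result σ d z (σ.setReg d z) :=
  ⟨rfl, fun r hr => by rw [setReg_reg_ne _ _ (by omega)], by simp⟩

theorem Tm.Feasible.leaf {t : Tm} {e : (ℕ → ℕ) → Expr} (ht : ∀ ρ d, t.comp ρ d = .assign d (e ρ))
    (c : ℕ)
    (h : ∀ ⦃N : ℕ⦄ ⦃σ : Store⦄ ⦃ρ : ℕ → ℕ⦄ ⦃E : Env⦄, 2 ≤ N → Holds σ ρ E N →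
      (e ρ).value σ = t.value E ∧ (e ρ).cost σ ≤ N ^ c ∧ bitLength (t.value E) ≤ N ^ c) :
    t.Feasible (c + 3) := by
  intro N σ ρ d E hN hd hρ hE
  obtain ⟨h1, h2, h3⟩ := h hN hE
  have hp : 1 ≤ N ^ c := Nat.one_le_pow _ _ (by omega)
  have h4 := mul_pow_le_pow_add hN 3 c
  refine ⟨?_, by omega⟩
  rw [ht]
  refine Runs.assign (by rw [h1]; exact result_setReg _ _ _) ?_
  rw [h1]
  omega

/-- The hypotheses collect what the four arithmetic operations have in common. The result is barely
longer than the operands together, so a fixed term never leaves the polynomial range. -/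
theorem Tm.Feasible.binary {t u v : Tm} {e : Expr → Expr → Expr} {f : ℤ → ℤ → ℤ}
    (hv : ∀ ρ d, v.comp ρ d =
      .seq (t.comp ρ d) (.seq (u.comp ρ (d + 1)) (.assign d (e (.reg d) (.reg (d + 1))))))
    (he : ∀ σ a b, (e a b).value σ = f (a.value σ) (b.value σ))
    (hc : ∀ σ a b, (e a b).cost σ =
      a.cost σ + b.cost σ + 1 + bitLength (a.value σ) + bitLength (b.value σ))
    (hf : ∀ a b, bitLength (f a b) ≤ bitLength a + bitLength b + 1)
    (hval : ∀ E, v.value E = f (t.value E) (u.value E)) {c c' : ℕ} (ht : t.Feasible c)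
    (hu : u.Feasible c') : v.Feasible (c + c' + 20) := by
  intro N σ ρ d E hN hd hρ hE
  obtain ⟨h1, h2⟩ := ht hN hd hρ hE
  have e1 : N ^ c ≤ N ^ (c + c') := Nat.pow_le_pow_right (by omega) (by omega)
  have e2 : N ^ c' ≤ N ^ (c + c') := Nat.pow_le_pow_right (by omega) (by omega)
  have e3 : 1 ≤ N ^ (c + c') := Nat.one_le_pow _ _ (by omega)
  have e4 := mul_pow_le_pow_add hN 20 (c + c')
  have e5 := hf (t.value E) (u.value E)
  have e6 : bitLength (u.value E) ≤ N ^ c' := (hu hN hd hρ hE).2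
  rw [hval]
  refine ⟨?_, by omega⟩
  rw [hv]
  refine (Runs.seq h1 (U := N ^ c' + 12 * N ^ (c + c')) fun τ hτ => ?_).mono (by omega)
    (fun _ => id)
  have hE' := hE.of_agree hd hρ hτ.mem hτ.low
  obtain ⟨h3, h4⟩ := hu hN (d := d + 1) (by omega) (fun x => (hρ x).trans (by omega)) hE'
  refine Runs.seq h3 fun υ hυ => ?_
  have h5 : υ.reg d = t.value E := by rw [hυ.low d (by omega), hτ.val]
  refine Runs.assign ?_ ?_
  · rw [he]
    simp only [Expr.value, h5, hυ.val]
    exact ⟨hυ.mem.trans hτ.mem,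
      fun r hr => by rw [setReg_reg_ne _ _ (by omega), hυ.low r (by omega), hτ.low r hr], by simp⟩
  · rw [he, hc]
    simp only [Expr.value, Expr.cost, h5, hυ.val]
    omega

theorem bitLength_le_of_abs_le {z : ℤ} {R N k : ℕ} (h : |z| ≤ (R : ℤ) ^ k) (hR : R ≤ N) :
    bitLength z ≤ N ^ k := by
  refine (bitLength_le_natAbs z).trans ?_
  rw [Int.abs_eq_natAbs] at h
  exact (show z.natAbs ≤ R ^ k by exact_mod_cast h).trans (Nat.pow_le_pow_left hR k)

/-- Iteration does not compound the growth: thanks to clamping, the body is evaluated in every round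
on numbers of at most `N ^ (k + 1)` bits. A round thus costs about `(N ^ (k + 1)) ^ c'`, and there
are at most `N ^ k` rounds. -/
theorem Tm.Feasible.fold {init body : Tm} {c c' : ℕ} (k x y : ℕ) (ht : init.Feasible c)
    (hu : body.Feasible c') :
    (Tm.fold k x y init body).Feasible (5 * k + c + (k + 1) * c' + 300) := by
  intro N σ ρ d E hN hd hρ hE
  set b : ℤ := (E.size : ℤ) ^ k with hb
  have hb0 : 0 ≤ b := by positivity
  set f : ℤ → ℕ → ℤ := fun a i => body.value ((E.bind x a).bind y (i : ℤ)) with hf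
  set F := foldAcc b (init.value E) f with hF
  have hval : (Tm.fold k x y init body).value E = F (E.size ^ k) := rfl
  have hbl : ∀ i, bitLength (F i) ≤ N ^ k := fun i =>
    bitLength_le_of_abs_le (abs_foldAcc_le hb0 _ _ i) hE.size_le
  set X := N ^ (4 * k + c + (k + 1) * c' + 8) with hX
  have hXpow : ∀ j, j ≤ 4 * k + c + (k + 1) * c' + 8 → N ^ j ≤ X := fun j hj =>
    Nat.pow_le_pow_right (by omega) hj
  have x0 : 16 ≤ X := by
    refine le_trans ?_ (hXpow 4 (by omega))
    exact (show 16 = 2 ^ 4 by norm_num).le.trans (Nat.pow_le_pow_left hN 4)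
  have xk := hXpow k (by omega)
  have xc := hXpow c (by omega)
  have xc' : (N ^ (k + 1)) ^ c' ≤ X := by
    rw [← pow_mul]
    exact hXpow _ (by omega)
  have hbb : bitLength b ≤ N ^ k := bitLength_pow_le hE.size_le k
  rw [hval]
  refine ⟨?_, (hbl _).trans (Nat.pow_le_pow_right (by omega) (by omega))⟩
  obtain ⟨h1, h2⟩ := ht hN hd hρ hE
  let I : ℕ → Store → Prop := fun i τ =>
    Result σ d (F i) τ ∧ τ.reg (d + 1) = i ∧ τ.reg (d + 2) = b
  have hbody : ∀ i < E.size ^ k, ∀ τ, I i τ →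
      Runs (.seq (body.comp (Function.update (Function.update ρ x d) y (d + 1)) (d + 3))
              (.seq (.assign d (.reg (d + 3)))
                (.seq (clampProg d)
                  (.assign (d + 1) (.add (.reg (d + 1)) (.lit 1)))))) τ (I (i + 1))
        (60 * X) := by
    intro i hi τ hτ
    obtain ⟨hr, hi1, hi2⟩ := hτ
    have hbi : bitLength (i : ℤ) ≤ N ^ k := by
      refine (bitLength_le_natAbs _).trans ?_
      simp only [Int.natAbs_natCast]
      exact hi.le.trans (Nat.pow_le_pow_left hE.size_le k)
    have hN' : N ≤ N ^ (k + 1) := Nat.le_self_pow (by omega) N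
    have hkk : N ^ k ≤ N ^ (k + 1) := Nat.pow_le_pow_right (by omega) (by omega)
    -- The bound `N ^ (k + 1)` covers at the same time the old numbers of `N` bits and the
    -- accumulator and the counter, which have at most `N ^ k` bits.
    have hE' : Holds τ (Function.update (Function.update ρ x d) y (d + 1))
        ((E.bind x (F i)).bind y (i : ℤ)) (N ^ (k + 1)) := by
      have h := hE.of_agree hd hρ hr.mem hr.low
      refine ⟨h.size, h.mem, fun z => ?_, h.size_le.trans hN', fun a => (h.mem_le a).trans hN',
        fun z => ?_⟩
      · by_cases hzy : z = y
        · subst hzy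
          simp [Env.bind, hi1]
        · by_cases hzx : z = x
          · subst hzx
            simp [Env.bind, hzy, hr.val]
          · simp [Env.bind, hzy, hzx, h.var]
      · by_cases hzy : z = y
        · subst hzy
          simpa [Env.bind] using hbi.trans hkk
        · by_cases hzx : z = x
          · subst hzx
            simpa [Env.bind, hzy] using (hbl i).trans hkk
          · simpa [Env.bind, hzy, hzx] using (h.var_le z).trans hN'
    have hρ' : ∀ z, Function.update (Function.update ρ x d) y (d + 1) z < d + 3 := by
      intro z
      by_cases hzy : z = y
      · subst hzy; simp
      · by_cases hzx : z = x
        · subst hzx; simp [hzy]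
        · simp only [Function.update_of_ne hzy, Function.update_of_ne hzx]
          have := hρ z
          omega
    obtain ⟨h3, h4⟩ := hu (hN.trans hN') (by omega : 2 ≤ d + 3) hρ' hE'
    change bitLength (f (F i) i) ≤ _ at h4
    refine (Runs.seq h3 (U := 4 * X + ((20 * X + 20) + 10 * X)) fun υ hυ => ?_).mono (by omega)
      (fun _ => id)
    have hv : υ.reg (d + 3) = f (F i) i := hυ.val
    refine Runs.seq (Q := fun χ => χ = υ.setReg d (f (F i) i)) (Runs.assign ?_ ?_)
      fun χ hχ => ?_
    · simp [Expr.value, hv]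
    · simp only [Expr.value, Expr.cost, hv]
      omega
    subst hχ
    have r2 : υ.reg (d + 2) = b := by rw [hυ.low _ (by omega), hi2]
    have r1 : υ.reg (d + 1) = i := by rw [hυ.low _ (by omega), hi1]
    refine Runs.seq (clampProg_runs (b := b) (z := f (F i) i) (by simp [r2]) (by simp)
      (hbb.trans xk) (h4.trans xc')) fun χ hχ => ?_
    subst hχ
    refine Runs.assign ?_ ?_
    · refine ⟨⟨?_, fun r hr' => ?_, ?_⟩, ?_, ?_⟩
      · simp [hυ.mem, hr.mem]
      · rw [setReg_reg_ne _ _ (by omega), setReg_reg_ne _ _ (by omega),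
          setReg_reg_ne _ _ (by omega), hυ.low _ (by omega), hr.low _ hr']
      · rw [setReg_reg_ne _ _ (by omega)]
        simp [hF, foldAcc]
      · simp [Expr.value, r1]
      · rw [setReg_reg_ne _ _ (by omega)]
        simp [r2]
    · have hone : bitLength 1 = 1 := by decide
      have := bitLength_add (i : ℤ) 1
      simp only [Expr.value, Expr.cost, setReg_reg_ne _ _ (show d + 1 ≠ d by omega), r1, hone]
      omega
  have hp := powExpr_cost hN (R := E.size) hE.size hE.size_le k
  have xp := hXpow (4 * k + 2) (by omega)
  have hone : 1 ≤ N ^ k := Nat.one_le_pow _ _ (by omega)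
  have hsize : E.size ^ k ≤ N ^ k := Nat.pow_le_pow_left hE.size_le k
  have hXX : X ≤ N ^ k * X := Nat.le_mul_of_pos_left _ hone
  have htotal : 230 * (N ^ k * X) ≤ N ^ (5 * k + c + (k + 1) * c' + 300) := by
    refine (mul_pow_le_pow_add hN 230 _ |>.trans_eq' ?_).trans
      (Nat.pow_le_pow_right (by omega) (?_ : 5 * k + c + (k + 1) * c' + 8 + 230 ≤ _))
    · rw [hX, ← pow_add]
      ring_nf
    · omega
  refine (Runs.seq h1 (U := 4 * X + ((20 * X + 20) + (10 + (N ^ k + 1) * (70 * X))))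
    fun τ hτ => ?_).mono ?_ (fun _ => id)
  · refine Runs.seq (Q := fun υ => υ = τ.setReg (d + 2) b) (Runs.assign ?_ ?_) fun υ hυ => ?_
    · rw [powExpr_value, hτ.low 1 (by omega), hE.size]
    · rw [powExpr_value, hτ.low 1 (by omega), hE.size]
      have := powExpr_cost hN (σ := τ) (R := E.size) (by rw [hτ.low 1 (by omega), hE.size])
        hE.size_le k
      have := bitLength_pow_le hE.size_le k
      omega
    subst hυ
    refine Runs.seq (clampProg_runs (b := b) (z := init.value E) (by simp)
      (by rw [setReg_reg_ne _ _ (by omega), hτ.val]) (hbb.trans xk) (h2.trans xc)) fun υ hυ => ?_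
    subst hυ
    refine Runs.seq (Q := I 0) (Runs.assign ?_ ?_) fun υ hυ => ?_
    · refine ⟨⟨hτ.mem, fun r hr => ?_, ?_⟩, ?_, ?_⟩
      · rw [setReg_reg_ne _ _ (by omega), setReg_reg_ne _ _ (by omega),
          setReg_reg_ne _ _ (by omega), hτ.low r hr]
      · rw [setReg_reg_ne _ _ (by omega)]
        simp [hF, foldAcc]
      · simp [Expr.value]
      · rw [setReg_reg_ne _ _ (by omega), setReg_reg_ne _ _ (by omega)]
        simp
    · have hzero : bitLength 0 = 0 := by decide
      simp only [Expr.value, Expr.cost, hzero]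
      omega
    refine (Runs.loop (n := E.size ^ k) (G := 5 * X) I (fun i hi χ hχ => ?_) hbody hυ).mono ?_
      fun χ hχ => hχ.1
    · have hbi : bitLength (i : ℤ) ≤ N ^ k := by
        refine (bitLength_le_natAbs _).trans ?_
        simp only [Int.natAbs_natCast]
        exact hi.trans hsize
      simp only [Expr.value, Expr.cost, hχ.2.1, hχ.2.2]
      refine ⟨by rw [hb]; push_cast; ring, by omega⟩
    · exact Nat.mul_le_mul (by omega) (by omega)
  · have : (N ^ k + 1) * (70 * X) = 70 * (N ^ k * X) + 70 * X := by ring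
    omega

theorem Tm.exists_feasible (t : Tm) : ∃ c, t.Feasible c := by
  induction t with
  | lit z =>
    refine ⟨_, Tm.Feasible.leaf (e := fun _ => .lit z) (fun _ _ => rfl) (1 + bitLength z) ?_⟩
    intro N σ ρ E hN hE
    have := Nat.lt_two_pow_self.le.trans (Nat.pow_le_pow_left hN (1 + bitLength z))
    refine ⟨rfl, this, le_trans (Nat.le_add_left (bitLength z) 1) this⟩
  | size =>
    refine ⟨_, Tm.Feasible.leaf (e := fun _ => .reg 1) (fun _ _ => rfl) 2 ?_⟩
    intro N σ ρ E hN hE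
    have : bitLength (E.size : ℤ) ≤ N := by simpa using bitLength_pow_le hE.size_le 1
    simp only [Expr.value, Expr.cost, Tm.value, hE.size]
    refine ⟨trivial, ?_, ?_⟩ <;> nlinarith
  | var x =>
    refine ⟨_, Tm.Feasible.leaf (e := fun ρ => .reg (ρ x)) (fun _ _ => rfl) 2 ?_⟩
    intro N σ ρ E hN hE
    have := hE.var_le x
    simp only [Expr.value, Expr.cost, Tm.value, hE.var]
    refine ⟨trivial, ?_, ?_⟩ <;> nlinarith
  | mem t ih =>
    obtain ⟨c, hc⟩ := ih
    refine ⟨c + 1 + 20, ?_⟩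
    intro N σ ρ d E hN hd hρ hE
    obtain ⟨h1, h2⟩ := hc hN hd hρ hE
    have e0 := hE.mem_le (t.value E)
    have e1 : N ^ c ≤ N ^ (c + 1) := Nat.pow_le_pow_right (by omega) (by omega)
    have e2 : N ≤ N ^ (c + 1) := Nat.le_self_pow (by omega) N
    have e3 := mul_pow_le_pow_add hN 20 (c + 1)
    refine ⟨(Runs.seq h1 (U := 14 * N ^ (c + 1)) fun τ hτ => ?_).mono (by omega) (fun _ => id),
      e0.trans (by omega)⟩
    have hm : τ.mem = E.mem := hτ.mem.trans hE.mem
    refine Runs.assign ?_ ?_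
    · simp only [Expr.value, hτ.val, hm]
      exact ⟨hτ.mem, fun r hr => by rw [setReg_reg_ne _ _ (by omega), hτ.low r hr], by
        simp [Tm.value]⟩
    · simp only [Expr.value, Expr.cost, hτ.val, hm]
      omega
  | add t u iht ihu =>
    obtain ⟨c, hc⟩ := iht
    obtain ⟨c', hc'⟩ := ihu
    exact ⟨_, hc.binary (v := .add t u) (f := fun a b => a + b) (fun _ _ => rfl)
      (fun _ _ _ => rfl) (fun _ _ _ => rfl) bitLength_add (fun _ => rfl) hc'⟩
  | sub t u iht ihu =>
    obtain ⟨c, hc⟩ := iht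
    obtain ⟨c', hc'⟩ := ihu
    exact ⟨_, hc.binary (v := .sub t u) (f := fun a b => a - b) (fun _ _ => rfl)
      (fun _ _ _ => rfl) (fun _ _ _ => rfl) bitLength_sub (fun _ => rfl) hc'⟩
  | mul t u iht ihu =>
    obtain ⟨c, hc⟩ := iht
    obtain ⟨c', hc'⟩ := ihu
    exact ⟨_, hc.binary (v := .mul t u) (f := fun a b => a * b) (fun _ _ => rfl)
      (fun _ _ _ => rfl) (fun _ _ _ => rfl) (fun a b => (bitLength_mul a b).trans (by omega))
      (fun _ => rfl) hc'⟩
  | div t u iht ihu =>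
    obtain ⟨c, hc⟩ := iht
    obtain ⟨c', hc'⟩ := ihu
    exact ⟨_, hc.binary (v := .div t u) (f := fun a b => a / b) (fun _ _ => rfl)
      (fun _ _ _ => rfl) (fun _ _ _ => rfl) (fun a b => (bitLength_div a b).trans (by omega))
      (fun _ => rfl) hc'⟩
  | ite t u v iht ihu ihv =>
    obtain ⟨c, hc⟩ := iht
    obtain ⟨c', hc'⟩ := ihu
    obtain ⟨c'', hc''⟩ := ihv
    refine ⟨c + c' + c'' + 20, ?_⟩
    intro N σ ρ d E hN hd hρ hE
    obtain ⟨h1, h2⟩ := hc hN hd hρ hE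
    have e1 : N ^ c ≤ N ^ (c + c' + c'') := Nat.pow_le_pow_right (by omega) (by omega)
    have e2 : N ^ c' ≤ N ^ (c + c' + c'') := Nat.pow_le_pow_right (by omega) (by omega)
    have e3 : N ^ c'' ≤ N ^ (c + c' + c'') := Nat.pow_le_pow_right (by omega) (by omega)
    have e4 : 1 ≤ N ^ (c + c' + c'') := Nat.one_le_pow _ _ (by omega)
    have e5 := mul_pow_le_pow_add hN 20 (c + c' + c'')
    refine ⟨(Runs.seq h1 (U := 4 * N ^ (c + c' + c'')) fun τ hτ => ?_).mono (by omega)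
      (fun _ => id), ?_⟩
    · have hE' := hE.of_agree hd hρ hτ.mem hτ.low
      refine (Runs.ite (T := N ^ (c + c' + c'')) (fun h => ?_) (fun h => ?_)).mono ?_
        (fun _ => id)
      · refine (hc' hN hd hρ hE').1.mono e2 fun υ hυ => ?_
        simp only [Expr.value, hτ.val] at h
        simp only [Tm.value, if_pos h]
        exact ⟨hυ.mem.trans hτ.mem, fun r hr => (hυ.low r hr).trans (hτ.low r hr), hυ.val⟩
      · refine (hc'' hN hd hρ hE').1.mono e3 fun υ hυ => ?_
        simp only [Expr.value, hτ.val] at h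
        simp only [Tm.value, if_neg h]
        exact ⟨hυ.mem.trans hτ.mem, fun r hr => (hυ.low r hr).trans (hτ.low r hr), hυ.val⟩
      · simp only [Expr.cost, hτ.val]
        omega
    · simp only [Tm.value]
      split_ifs
      · exact (hc' hN hd hρ hE).2.trans (by omega)
      · exact (hc'' hN hd hρ hE).2.trans (by omega)
  | fold k x y init body iht ihu =>
    obtain ⟨c, hc⟩ := iht
    obtain ⟨c', hc'⟩ := ihu
    exact ⟨_, hc.fold k x y hc'⟩

end Ram

namespace Ram

/-! ## Filling a table in rounds -/

/-- Register `1` becomes the sum of the absolute values of the first `reg 0` memory cells, each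
increased by one. -/
def sizeProg : Prog :=
  .loop (.sub (.reg 0) (.reg 2))
    (.seq (.ite (.mem (.reg 2)) (.assign 1 (.add (.add (.reg 1) (.mem (.reg 2))) (.lit 1)))
        (.assign 1 (.add (.sub (.reg 1) (.mem (.reg 2))) (.lit 1))))
      (.assign 2 (.add (.reg 2) (.lit 1))))

/-- In round `i < size ^ k` the value of `v` is stored at the address `a`; the answer is whether
`w` is positive in the end.  The variables of the terms have the value `i`. -/
def tableProg (k : ℕ) (a v w : Tm) : Prog :=
  .seq sizeProg (.seq (.assign 2 (.lit 0)) (.seq (.assign 3 (powExpr k))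
    (.seq (.loop (.sub (.reg 3) (.reg 2))
        (.seq (a.comp (fun _ => 2) 4) (.seq (v.comp (fun _ => 2) 5)
          (.seq (.store (.reg 4) (.reg 5)) (.assign 2 (.add (.reg 2) (.lit 1)))))))
      (.seq (w.comp (fun _ => 2) 4) (.ite (.reg 4) (.assign 0 (.lit 1)) (.assign 0 (.lit 0)))))))

/-- The memory after `i` rounds. -/
def tableMem (R : ℕ) (a v : Tm) (m : ℤ → ℤ) : ℕ → ℤ → ℤ
  | 0 => m
  | i + 1 => Function.update (tableMem R a v m i)
      (a.value ⟨R, tableMem R a v m i, fun _ => i⟩) (v.value ⟨R, tableMem R a v m i, fun _ => i⟩)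

theorem unarySize_take_succ (l : List ℤ) {i : ℕ} (h : i < l.length) :
    unarySize (l.take (i + 1)) = unarySize (l.take i) + (l[i].natAbs + 1) := by
  rw [List.take_succ_eq_append_getElem h]
  simp only [unarySize, List.map_append, List.sum_append, List.map_cons, List.map_nil,
    List.sum_cons, List.sum_nil, Nat.add_zero]

theorem unarySize_take_le (l : List ℤ) (i : ℕ) : unarySize (l.take i) ≤ unarySize l := by
  conv_rhs => rw [← List.take_append_drop i l]
  rw [unarySize, unarySize, List.map_append, List.sum_append]
  exact Nat.le_add_right _ _

theorem natAbs_lt_unarySize {l : List ℤ} {z : ℤ} (h : z ∈ l) : z.natAbs < unarySize l := by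
  have := List.single_le_sum (l := l.map fun z => z.natAbs + 1) (by simp) (z.natAbs + 1)
    (List.mem_map.2 ⟨z, h, rfl⟩)
  exact this

theorem length_le_unarySize (l : List ℤ) : l.length ≤ unarySize l := by
  induction l with
  | nil => simp
  | cons a l ih => simp only [unarySize, List.map_cons, List.sum_cons, List.length_cons] at *; omega

theorem initial_mem_natCast (l : List ℤ) {i : ℕ} (h : i < l.length) :
    (initial l).mem i = l[i] := by
  simp [initial, h]

theorem natAbs_initial_mem_le (l : List ℤ) (a : ℤ) :
    ((initial l).mem a).natAbs ≤ unarySize l := by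
  simp only [initial]
  split_ifs with h
  · by_cases h' : a.toNat < l.length
    · rw [List.getD_eq_getElem _ _ h']
      exact (natAbs_lt_unarySize (List.getElem_mem h')).le
    · rw [List.getD_eq_default _ _ (by omega)]
      simp
  · simp

theorem sizeProg_runs (l : List ℤ) (h2 : 2 ≤ unarySize l) :
    Runs sizeProg (initial l) (fun τ => τ.mem = (initial l).mem ∧ τ.reg 1 = unarySize l)
      (unarySize l ^ 100) := by
  set R := unarySize l with hR
  have hlen : l.length ≤ R := length_le_unarySize l
  have hone : bitLength 1 = 1 := by decide
  let I : ℕ → Store → Prop := fun i τ =>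
    τ.mem = (initial l).mem ∧ τ.reg 0 = l.length ∧ τ.reg 1 = unarySize (l.take i) ∧ τ.reg 2 = i
  have hbit : ∀ n : ℕ, n ≤ R → bitLength (n : ℤ) ≤ R := fun n hn =>
    (bitLength_le_natAbs _).trans (by simpa using hn)
  refine (Runs.loop (n := l.length) (G := 10 * R) (T := 100 * R) I (fun i hi τ hτ => ?_)
    (fun i hi τ hτ => ?_) ?_).mono ?_ (fun τ hτ => ⟨hτ.1, by rw [hτ.2.2.1, List.take_length]⟩)
  · obtain ⟨-, h0, -, h3⟩ := hτ
    have := hbit l.length hlen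
    have := hbit i (by omega)
    simp only [Expr.value, Expr.cost, h0, h3]
    exact ⟨trivial, by omega⟩
  · obtain ⟨hm, h0, h1, h3⟩ := hτ
    have hbi := hbit i (by omega)
    have hbs := hbit _ (unarySize_take_le l i)
    have hbz : bitLength l[i] ≤ R := (bitLength_le_natAbs _).trans
      (natAbs_lt_unarySize (List.getElem_mem hi)).le
    have hs := unarySize_take_succ l hi
    have hmi := initial_mem_natCast l hi
    have hb' := hbit _ (unarySize_take_le l (i + 1))
    refine (Runs.seq (Q := fun υ => υ = τ.setReg 1 (unarySize (l.take (i + 1)))) (T := 50 * R)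
      (U := 20 * R) ?_ fun υ hυ => ?_).mono (by omega) (fun _ => id)
    · refine (Runs.ite (T := 40 * R) (fun h => Runs.assign ?_ ?_)
        (fun h => Runs.assign ?_ ?_)).mono ?_ (fun _ => id)
      · simp only [Expr.value, h3, hm, hmi] at h
        simp only [Expr.value, h1, h3, hm, hmi, hs]
        congr 1
        omega
      · simp only [Expr.value, h3, hm, hmi] at h
        have e1 := bitLength_add (unarySize (l.take i)) l[i]
        have e2 := bitLength_add (unarySize (l.take i) + l[i]) 1
        simp only [Expr.value, Expr.cost, h1, h3, hm, hmi, hone]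
        omega
      · simp only [Expr.value, h3, hm, hmi] at h
        simp only [Expr.value, h1, h3, hm, hmi, hs]
        congr 1
        omega
      · simp only [Expr.value, h3, hm, hmi] at h
        have e1 := bitLength_sub (unarySize (l.take i)) l[i]
        have e2 := bitLength_add (unarySize (l.take i) - l[i]) 1
        simp only [Expr.value, Expr.cost, h1, h3, hm, hmi, hone]
        omega
      · simp only [Expr.value, Expr.cost, h3, hm, hmi]
        omega
    · subst hυ
      have e := bitLength_add (i : ℤ) 1
      refine Runs.assign ?_ ?_
      · refine ⟨hm, ?_, ?_, ?_⟩ <;> simp [Store.setReg, Expr.value, h0, h3]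
      · simp only [Expr.value, Expr.cost, setReg_reg_ne _ _ (show 2 ≠ 1 by decide), h3, hone]
        omega
  · refine ⟨rfl, ?_, ?_, ?_⟩ <;> simp [initial, unarySize]
  · calc (l.length + 1) * (10 * R + 1 + 100 * R) ≤ (R * 2) * (112 * R) :=
          Nat.mul_le_mul (by omega) (by omega)
      _ = 224 * R ^ 2 := by ring
      _ ≤ R ^ 8 * R ^ 2 := Nat.mul_le_mul_right _
          (le_trans (by norm_num) (Nat.pow_le_pow_left h2 8))
      _ = R ^ 10 := by ring
      _ ≤ R ^ 100 := Nat.pow_le_pow_right (by omega) (by norm_num)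

/-- Only values between `-1` and `1` are ever written. The memory therefore remains short in all
rounds, and the terms stay feasible on it. -/
theorem natAbs_tableMem_le {l : List ℤ} (h2 : 2 ≤ unarySize l) (a : Tm) {v : Tm}
    (hv : ∀ E, |v.value E| ≤ 1) (R i : ℕ) (z : ℤ) :
    (tableMem R a v (initial l).mem i z).natAbs ≤ unarySize l := by
  induction i generalizing z with
  | zero => exact natAbs_initial_mem_le l z
  | succ i ih =>
    simp only [tableMem, Function.update_apply]
    split_ifs
    · have := hv ⟨R, tableMem R a v (initial l).mem i, fun _ => i⟩
      rw [abs_le] at this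
      omega
    · exact ih z

/-- This is the only place where a program is run on an instance; what remains is to find three
terms. Every round evaluates fixed terms on numbers of at most `R ^ (k + 1)` bits, with `R` the
unary size, and there are `R ^ k` rounds. -/
theorem solvable_of_table {α : Type} {Inst : α → Prop} {enc : α → List ℤ} {Yes : α → Prop}
    (k : ℕ) (a v w : Tm) (hv : ∀ E, |v.value E| ≤ 1) (h2 : ∀ x, Inst x → 2 ≤ unarySize (enc x))
    (hw : ∀ x, Inst x → (0 < w.value ⟨unarySize (enc x), tableMem (unarySize (enc x)) a v
      (initial (enc x)).mem (unarySize (enc x) ^ k), fun _ => unarySize (enc x) ^ k⟩ ↔ Yes x)) :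
    SolvableInPseudopolynomialTime Inst enc Yes := by
  obtain ⟨ca, hca⟩ := a.exists_feasible
  obtain ⟨cv, hcv⟩ := v.exists_feasible
  obtain ⟨cw, hcw⟩ := w.exists_feasible
  -- A sum of the exponents needed for the input size (`100`), the power of the size (`4 * k + 2`),
  -- the bit lengths and the three terms, so that each of these costs is at most `R ^ C`. The
  -- summand `300` in the final bound absorbs constants.
  set C := 100 + 4 * k + 2 + (k + 1) + (k + 1) * ca + (k + 1) * cv + (k + 1) * cw with hC
  refine ⟨tableProg k a v w, Polynomial.X ^ (k + C + 300), fun x hx => ?_⟩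
  specialize h2 x hx
  specialize hw x hx
  have hrun : Runs (tableProg k a v w) (initial (enc x))
      (fun τ => (Yes x → τ.reg 0 = 1) ∧ (¬ Yes x → τ.reg 0 = 0))
      (unarySize (enc x) ^ (k + C + 300)) := by
    set l := enc x
    set R := unarySize l with hR
    set M := tableMem R a v (initial l).mem with hM
    set X := R ^ C with hX
    have hone : bitLength 1 = 1 := by decide
    have hzero : bitLength 0 = 0 := by decide
    have hpow : ∀ j, j ≤ C → R ^ j ≤ X := fun j hj => Nat.pow_le_pow_right (by omega) hj
    have x1 : 1 ≤ X := Nat.one_le_pow _ _ (by omega)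
    have xk1 := hpow (k + 1) (by omega)
    have xa : (R ^ (k + 1)) ^ ca ≤ X := by rw [← pow_mul]; exact hpow _ (by omega)
    have xv : (R ^ (k + 1)) ^ cv ≤ X := by rw [← pow_mul]; exact hpow _ (by omega)
    have xw : (R ^ (k + 1)) ^ cw ≤ X := by rw [← pow_mul]; exact hpow _ (by omega)
    have hRN : R ≤ R ^ (k + 1) := Nat.le_self_pow (by omega) R
    have hkN : R ^ k ≤ R ^ (k + 1) := Nat.pow_le_pow_right (by omega) (by omega)
    have hbit : ∀ i ≤ R ^ k, bitLength (i : ℤ) ≤ R ^ (k + 1) := fun i hi =>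
      (bitLength_le_natAbs _).trans (by simpa using hi.trans hkN)
    let I : ℕ → Store → Prop := fun i τ =>
      τ.mem = M i ∧ τ.reg 1 = R ∧ τ.reg 2 = i ∧ τ.reg 3 = (R : ℤ) ^ k
    have hI : ∀ i ≤ R ^ k, ∀ τ, I i τ →
        Holds τ (fun _ => 2) ⟨R, M i, fun _ => i⟩ (R ^ (k + 1)) := fun i hi τ hτ =>
      ⟨hτ.2.1, hτ.1, fun _ => hτ.2.2.1, hRN,
        fun z => ((bitLength_le_natAbs _).trans (natAbs_tableMem_le h2 a hv _ _ _)).trans hRN,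
        fun _ => hbit i hi⟩
    have hloop : 250 * (R ^ k * X) ≤ R ^ (k + C + 300) := by
      rw [hX, ← pow_add]
      exact (mul_pow_le_pow_add (by omega) 250 (k + C)).trans
        (Nat.pow_le_pow_right (by omega) (by omega))
    have hXX : X ≤ R ^ k * X := Nat.le_mul_of_pos_left _ (Nat.one_le_pow _ _ (by omega))
    refine (Runs.seq ((sizeProg_runs l h2).mono (hpow 100 (by omega)) (fun _ => id))
      (U := 10 * X + (10 * X + ((R ^ k + 1) * (60 * X) + 20 * X))) fun τ hτ => ?_).mono ?_
      (fun _ => id)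
    · refine Runs.seq (Q := fun υ => υ = τ.setReg 2 0) (Runs.assign rfl ?_) fun υ hυ => ?_
      · simp only [Expr.value, Expr.cost, hzero]
        omega
      subst hυ
      refine Runs.seq (Q := I 0) (Runs.assign ?_ ?_) fun υ hυ => ?_
      · refine ⟨hτ.1, ?_, ?_, ?_⟩
        · simp [Store.setReg, hτ.2, ← hR]
        · simp [Store.setReg]
        · simp [powExpr_value, Store.setReg, hτ.2, ← hR]
      · have h1 : (τ.setReg 2 0).reg 1 = R := by simp [Store.setReg, hτ.2, ← hR]
        have := powExpr_cost h2 h1 le_rfl k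
        have := hpow (4 * k + 2) (by omega)
        have := bitLength_pow_le (le_refl R) k
        rw [powExpr_value, h1]
        omega
      refine Runs.seq ((Runs.loop (n := R ^ k) (G := 8 * X) (T := 50 * X) I
        (fun i hi χ hχ => ?_) (fun i hi χ hχ => ?_) hυ).mono
        (Nat.mul_le_mul_left _ (by omega)) (fun _ => id)) fun χ hχ => ?_
      · have := hbit i hi
        have := bitLength_pow_le (le_refl R) k
        simp only [Expr.value, Expr.cost, hχ.2.2.1, hχ.2.2.2]
        exact ⟨by push_cast; ring, by omega⟩
      · have hH := hI i hi.le χ hχ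
        obtain ⟨ra, ba⟩ := hca (d := 4) (h2.trans hRN) (by omega) (fun _ => by omega) hH
        refine (Runs.seq ra (U := X + (20 * X + 20 * X)) fun ψ hψ => ?_).mono (by omega)
          (fun _ => id)
        obtain ⟨rv, bv⟩ := hcv (d := 5) (h2.trans hRN) (by omega) (fun _ => by omega)
          (hH.of_agree (by omega) (fun _ => by omega) hψ.mem hψ.low)
        refine (Runs.seq rv (U := 20 * X + 20 * X) fun ω hω => ?_).mono (by omega) (fun _ => id)
        have r4 : ω.reg 4 = a.value ⟨R, M i, fun _ => i⟩ := by
          rw [hω.low 4 (by omega), hψ.val]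
        refine Runs.seq (Q := fun ξ => ξ = ω.setMem (a.value ⟨R, M i, fun _ => i⟩)
          (v.value ⟨R, M i, fun _ => i⟩)) (Runs.store ?_ ?_) fun ξ hξ => ?_
        · simp only [Expr.value, r4, hω.val]
        · simp only [Expr.value, Expr.cost, r4, hω.val]
          omega
        subst hξ
        have hr : ∀ r < 4, ω.reg r = χ.reg r := fun r hr => by
          rw [hω.low r (by omega), hψ.low r hr]
        refine Runs.assign ⟨?_, ?_, ?_, ?_⟩ ?_
        · simp only [Store.setReg, Store.setMem, hω.mem, hψ.mem, hχ.1]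
          rfl
        · simp [Store.setReg, Store.setMem, hr, hχ.2.1]
        · simp [Store.setReg, Store.setMem, hr, hχ.2.2.1, Expr.value]
        · simp [Store.setReg, Store.setMem, hr, hχ.2.2.2]
        · have := hbit i hi.le
          have := bitLength_add i 1
          simp only [Store.setMem, Expr.value, Expr.cost, hr 2 (by omega), hχ.2.2.1, hone]
          omega
      · obtain ⟨rw', bw⟩ := hcw (d := 4) (h2.trans hRN) (by omega) (fun _ => by omega)
          (hI _ le_rfl χ hχ)
        refine (Runs.seq rw' (U := 10 * X) fun ψ hψ => ?_).mono (by omega) (fun _ => id)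
        refine (Runs.ite (T := 5 * X) (fun h => Runs.assign ?_ ?_)
          (fun h => Runs.assign ?_ ?_)).mono ?_ (fun _ => id)
        · simp only [Expr.value, hψ.val] at h
          push_cast at h
          exact ⟨fun _ => by simp [Expr.value], fun h' => absurd (hw.1 h) h'⟩
        · simp only [Expr.value, Expr.cost, hone]
          omega
        · simp only [Expr.value, hψ.val] at h
          push_cast at h
          exact ⟨fun h' => absurd (hw.2 h') h, fun _ => by simp [Expr.value]⟩
        · simp only [Expr.value, Expr.cost, hzero]
          omega
        · simp only [Expr.cost, hψ.val]
          omega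
    · have : (R ^ k + 1) * (60 * X) = 60 * (R ^ k * X) + 60 * X := by ring
      omega
  obtain ⟨σ, t, h1, h3, h4⟩ := hrun
  exact ⟨σ, t, h1, by simpa using h3, h4⟩

end Ram

/-! ## Definable functions and predicates -/

noncomputable section

namespace PortalGame

open scoped Classical
open Ram

/-- A level together with a memory that starts with its encoding. -/
structure Base where
  lvl : Level
  wf : lvl.WellFormed
  mem : ℤ → ℤ
  mem_eq : ∀ (i : ℕ) (h : i < lvl.encode.length), mem i = lvl.encode[i]

/-- Contexts: levels with finitely many integer variables. -/
class Ctx (Γ : Type) where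
  base : Γ → Base
  depth : ℕ
  var : Γ → ℕ → ℤ

abbrev lv {Γ : Type} [Ctx Γ] (γ : Γ) : Level := (Ctx.base γ).lvl

@[irreducible] def Base.size (b : Base) : ℕ := unarySize b.lvl.encode

theorem Base.size_eq (b : Base) : b.size = unarySize b.lvl.encode := by rw [Base.size]

abbrev sz {Γ : Type} [Ctx Γ] (γ : Γ) : ℕ := (Ctx.base γ).size

/-- The environment contains the level and the variables. -/
structure Rep {Γ : Type} [Ctx Γ] (γ : Γ) (E : Env) : Prop where
  size : E.size = sz γ
  mem : E.mem = (Ctx.base γ).mem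
  var : ∀ x < Ctx.depth Γ, E.var x = Ctx.var γ x

/-- The context with one more variable, which is less than the `k`-th power of the size. -/
structure Ext (k : ℕ) (Γ : Type) [Ctx Γ] where
  c : Γ
  i : ℕ
  lt : i < sz c ^ k

instance : Ctx Base where
  base γ := γ
  depth := 0
  var _ _ := 0

-- The new variable gets the first unused number. Old variables keep theirs, so that terms over `Γ`
-- can be used over the extension without change.
@[reducible] instance {k : ℕ} {Γ : Type} [Ctx Γ] : Ctx (Ext k Γ) where
  base x := Ctx.base x.c
  depth := Ctx.depth Γ + 1
  var x n := if n = Ctx.depth Γ then (x.i : ℤ) else Ctx.var x.c n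

/-- The function is computed by a term and polynomially bounded. -/
class Dfn {Γ : Type} [Ctx Γ] (f : Γ → ℤ) : Prop where
  tm : ∃ t : Tm, ∀ γ E, Rep γ E → t.value E = f γ
  bd : ∃ c : ℕ, ∀ γ, |f γ| ≤ (sz γ : ℤ) ^ c

/-- The predicate is decided by a term. -/
class DfnP {Γ : Type} [Ctx Γ] (p : Γ → Prop) : Prop where
  tm : ∃ t : Tm, ∀ γ E, Rep γ E → (0 < t.value E ↔ p γ)

/-- All components of the vector are definable. -/
class DfnV {Γ : Type} [Ctx Γ] (v : Γ → Vec) : Prop where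
  comp : ∀ j, Dfn fun γ => v γ j

theorem two_le_unarySize_encode (L : Level) : 2 ≤ unarySize L.encode := by
  refine le_trans ?_ (length_le_unarySize _)
  simp [Level.encode, Physics.encode]

section

variable {Γ : Type} [Ctx Γ]

theorem two_le_sz (γ : Γ) : 2 ≤ sz γ := by
  rw [sz, Base.size_eq]
  exact two_le_unarySize_encode _

theorem sz_pow_mono (γ : Γ) {c d : ℕ} (h : c ≤ d) : (sz γ : ℤ) ^ c ≤ (sz γ : ℤ) ^ d :=
  pow_le_pow_right₀ (by have := two_le_sz γ; omega) h

theorem le_sz_pow (γ : Γ) (n : ℕ) : (n : ℤ) ≤ (sz γ : ℤ) ^ n := by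
  have h := mul_pow_le_pow_add (two_le_sz γ) n 0
  simp only [pow_zero, mul_one, Nat.zero_add] at h
  exact_mod_cast h

theorem Rep.wk {k : ℕ} {x : Ext k Γ} {E : Env} (h : Rep x E) : Rep x.c E :=
  ⟨h.size, h.mem, fun y hy => by
    rw [h.var y (Nat.lt_succ_of_lt hy)]
    exact if_neg (by omega)⟩

theorem Rep.var_self {k : ℕ} {x : Ext k Γ} {E : Env} (h : Rep x E) :
    E.var (Ctx.depth Γ) = x.i := by
  rw [h.var _ (Nat.lt_succ_self _)]
  exact if_pos rfl

theorem Rep.bind {γ : Γ} {E : Env} (h : Rep γ E) {x : ℕ} (hx : Ctx.depth Γ ≤ x) (z : ℤ) :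
    Rep γ (E.bind x z) :=
  ⟨h.size, h.mem, fun y hy => by
    rw [← h.var y hy]
    exact Function.update_of_ne (by omega) _ _⟩

theorem Rep.ext {γ : Γ} {E : Env} (h : Rep γ E) {k i : ℕ} (hi : i < sz γ ^ k) :
    Rep (⟨γ, i, hi⟩ : Ext k Γ) (E.bind (Ctx.depth Γ) i) :=
  ⟨h.size, h.mem, fun y hy => by
    change Function.update E.var _ _ y = if y = Ctx.depth Γ then (i : ℤ) else Ctx.var γ y
    split_ifs with hyd
    · rw [hyd, Function.update_self]
    · rw [Function.update_of_ne hyd]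
      exact h.var y (by change y < Ctx.depth Γ + 1 at hy; omega)⟩

theorem Dfn.congr {f g : Γ → ℤ} (hf : Dfn f) (h : ∀ γ, g γ = f γ) : Dfn g := by
  rwa [show g = f from funext h]

theorem DfnP.congr {p q : Γ → Prop} (hp : DfnP p) (h : ∀ γ, q γ ↔ p γ) : DfnP q := by
  rwa [show q = p from funext fun γ => propext (h γ)]

instance Dfn.wk {f : Γ → ℤ} [hf : Dfn f] {k : ℕ} : Dfn fun x : Ext k Γ => f x.c := by
  obtain ⟨⟨t, ht⟩, c, hc⟩ := hf
  exact ⟨⟨t, fun γ E h => ht _ _ h.wk⟩, c, fun γ => hc γ.c⟩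

instance Dfn.ext_var {k : ℕ} : Dfn fun x : Ext k Γ => (x.i : ℤ) :=
  ⟨⟨.var (Ctx.depth Γ), fun γ E h => h.var_self⟩, k, fun γ => by
    rw [Nat.abs_cast]
    exact_mod_cast γ.lt.le⟩

instance Dfn.const (z : ℤ) : Dfn fun _ : Γ => z :=
  ⟨⟨.lit z, fun _ _ _ => rfl⟩, z.natAbs, fun γ => by
    rw [Int.abs_eq_natAbs]
    exact le_sz_pow γ _⟩

instance Dfn.size : Dfn fun γ : Γ => (sz γ : ℤ) :=
  ⟨⟨.size, fun γ E h => by rw [Tm.value, h.size]⟩, 1, fun γ => by rw [Nat.abs_cast, pow_one]⟩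

theorem two_mul_sz_pow_le (γ : Γ) (c : ℕ) : 2 * (sz γ : ℤ) ^ c ≤ (sz γ : ℤ) ^ (c + 1) := by
  rw [pow_succ, mul_comm]
  have := two_le_sz γ
  exact mul_le_mul_of_nonneg_left (by omega) (by positivity)

instance Dfn.add {f g : Γ → ℤ} [hf : Dfn f] [hg : Dfn g] : Dfn fun γ => f γ + g γ := by
  obtain ⟨⟨t, ht⟩, c, hc⟩ := hf
  obtain ⟨⟨u, hu⟩, d, hd⟩ := hg
  refine ⟨⟨.add t u, fun γ E h => by simp [Tm.value, ht γ E h, hu γ E h]⟩, c + d + 1,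
    fun γ => (abs_add_le _ _).trans ?_⟩
  have h1 := sz_pow_mono γ (show c ≤ c + d by omega)
  have h2 := sz_pow_mono γ (show d ≤ c + d by omega)
  have h3 := two_mul_sz_pow_le γ (c + d)
  linarith [hc γ, hd γ]

instance Dfn.mul {f g : Γ → ℤ} [hf : Dfn f] [hg : Dfn g] : Dfn fun γ => f γ * g γ := by
  obtain ⟨⟨t, ht⟩, c, hc⟩ := hf
  obtain ⟨⟨u, hu⟩, d, hd⟩ := hg
  refine ⟨⟨.mul t u, fun γ E h => by simp [Tm.value, ht γ E h, hu γ E h]⟩, c + d, fun γ => ?_⟩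
  rw [abs_mul, pow_add]
  exact mul_le_mul (hc γ) (hd γ) (abs_nonneg _) (by positivity)

instance Dfn.neg {f : Γ → ℤ} [hf : Dfn f] : Dfn fun γ => - f γ :=
  (show Dfn fun γ => (-1 : ℤ) * f γ from inferInstance).congr fun γ => by ring

instance Dfn.sub {f g : Γ → ℤ} [hf : Dfn f] [hg : Dfn g] : Dfn fun γ => f γ - g γ :=
  (Dfn.add (f := f) (g := fun γ => - g γ)).congr fun γ => by ring

instance Dfn.div {f g : Γ → ℤ} [hf : Dfn f] [hg : Dfn g] : Dfn fun γ => f γ / g γ := by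
  obtain ⟨⟨t, ht⟩, c, hc⟩ := hf
  obtain ⟨⟨u, hu⟩, d, hd⟩ := hg
  exact ⟨⟨.div t u, fun γ E h => by simp [Tm.value, ht γ E h, hu γ E h]⟩, c,
    fun γ => (Int.abs_ediv_le_abs _ _).trans (hc γ)⟩

instance Dfn.ite {p : Γ → Prop} {d : ∀ γ, Decidable (p γ)} {f g : Γ → ℤ} [hp : DfnP p]
    [hf : Dfn f] [hg : Dfn g] : Dfn fun γ => if p γ then f γ else g γ := by
  obtain ⟨s, hs⟩ := hp
  obtain ⟨⟨t, ht⟩, c, hc⟩ := hf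
  obtain ⟨⟨u, hu⟩, d, hd⟩ := hg
  refine ⟨⟨.ite s t u, fun γ E h => ?_⟩, c + d, fun γ => ?_⟩
  · simp only [Tm.value, hs γ E h, ht γ E h, hu γ E h]
  · split_ifs
    · exact (hc γ).trans (sz_pow_mono γ (by omega))
    · exact (hd γ).trans (sz_pow_mono γ (by omega))

instance Dfn.pow {f : Γ → ℤ} [hf : Dfn f] (n : ℕ) : Dfn fun γ => f γ ^ n := by
  induction n with
  | zero => exact (Dfn.const 1).congr fun γ => by simp
  | succ n ih => exact (Dfn.mul (f := fun γ => f γ ^ n) (g := f)).congr fun γ => by ring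

/-! ### Predicates -/

theorem DfnP.of_pos {f : Γ → ℤ} (hf : Dfn f) : DfnP fun γ => 0 < f γ := by
  obtain ⟨⟨t, ht⟩, -⟩ := hf
  exact ⟨t, fun γ E h => by rw [ht γ E h]⟩

instance DfnP.lt {f g : Γ → ℤ} [Dfn f] [Dfn g] : DfnP fun γ => f γ < g γ :=
  (DfnP.of_pos (f := fun γ => g γ - f γ) inferInstance).congr fun γ => by omega

instance DfnP.le {f g : Γ → ℤ} [Dfn f] [Dfn g] : DfnP fun γ => f γ ≤ g γ :=
  (DfnP.of_pos (f := fun γ => g γ + (1 : ℤ) - f γ) inferInstance).congr fun γ => by omega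

instance DfnP.not {p : Γ → Prop} [hp : DfnP p] : DfnP fun γ => ¬ p γ := by
  obtain ⟨t, ht⟩ := hp
  refine ⟨.sub (.lit 1) t, fun γ E h => ?_⟩
  rw [← ht γ E h]
  simp only [Tm.value]
  omega

instance DfnP.and {p q : Γ → Prop} [hp : DfnP p] [hq : DfnP q] : DfnP fun γ => p γ ∧ q γ := by
  obtain ⟨t, ht⟩ := hp
  obtain ⟨u, hu⟩ := hq
  refine ⟨.ite t u (.lit 0), fun γ E h => ?_⟩
  rw [← ht γ E h, ← hu γ E h]
  simp only [Tm.value]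
  split_ifs <;> simp_all

instance DfnP.or {p q : Γ → Prop} [hp : DfnP p] [hq : DfnP q] : DfnP fun γ => p γ ∨ q γ :=
  (DfnP.not (p := fun γ => ¬ p γ ∧ ¬ q γ)).congr fun γ => by tauto

instance DfnP.imp {p q : Γ → Prop} [hp : DfnP p] [hq : DfnP q] : DfnP fun γ => p γ → q γ :=
  (DfnP.or (p := fun γ => ¬ p γ) (q := q)).congr fun γ => by tauto

instance DfnP.iff {p q : Γ → Prop} [hp : DfnP p] [hq : DfnP q] : DfnP fun γ => (p γ ↔ q γ) :=
  (DfnP.and (p := fun γ => p γ → q γ) (q := fun γ => q γ → p γ)).congr fun γ => by tauto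

instance DfnP.eq {f g : Γ → ℤ} [Dfn f] [Dfn g] : DfnP fun γ => f γ = g γ :=
  (DfnP.and (p := fun γ => f γ ≤ g γ) (q := fun γ => g γ ≤ f γ)).congr fun γ => by omega

instance DfnP.wk {p : Γ → Prop} [hp : DfnP p] {k : ℕ} : DfnP fun x : Ext k Γ => p x.c := by
  obtain ⟨t, ht⟩ := hp
  exact ⟨t, fun γ E h => ht _ _ h.wk⟩

instance DfnP.const (p : Prop) : DfnP fun _ : Γ => p := by
  by_cases hp : p
  · exact (DfnP.of_pos (Dfn.const 1)).congr fun _ => by simp [hp]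
  · exact (DfnP.of_pos (Dfn.const 0)).congr fun _ => by simp [hp]

instance DfnP.nat_lt {f g : Γ → ℕ} [Dfn fun γ => (f γ : ℤ)] [Dfn fun γ => (g γ : ℤ)] :
    DfnP fun γ => f γ < g γ :=
  (DfnP.lt (f := fun γ => (f γ : ℤ)) (g := fun γ => (g γ : ℤ))).congr fun γ => by omega

instance DfnP.nat_le {f g : Γ → ℕ} [Dfn fun γ => (f γ : ℤ)] [Dfn fun γ => (g γ : ℤ)] :
    DfnP fun γ => f γ ≤ g γ :=
  (DfnP.le (f := fun γ => (f γ : ℤ)) (g := fun γ => (g γ : ℤ))).congr fun γ => by omega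

instance DfnP.nat_eq {f g : Γ → ℕ} [Dfn fun γ => (f γ : ℤ)] [Dfn fun γ => (g γ : ℤ)] :
    DfnP fun γ => f γ = g γ :=
  (DfnP.eq (f := fun γ => (f γ : ℤ)) (g := fun γ => (g γ : ℤ))).congr fun γ => by omega

instance DfnP.bool_eq {b c : Γ → Bool} [DfnP fun γ => b γ = true] [DfnP fun γ => c γ = true] :
    DfnP fun γ => b γ = c γ :=
  (DfnP.iff (p := fun γ => b γ = true) (q := fun γ => c γ = true)).congr fun γ => by
    cases b γ <;> cases c γ <;> simp

instance DfnP.decide {p : Γ → Prop} {d : ∀ γ, Decidable (p γ)} [DfnP p] :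
    DfnP fun γ => decide (p γ) = true :=
  DfnP.congr (p := p) ‹_› fun γ => by simp

instance Dfn.wk2 {f : Γ → ℤ} [hf : Dfn f] {k l : ℕ} :
    Dfn fun x : Ext l (Ext k Γ) => f x.c.c :=
  Dfn.wk (f := fun y : Ext k Γ => f y.c)

instance Dfn.nat_wk {f : Γ → ℕ} [hf : Dfn fun γ => (f γ : ℤ)] {k : ℕ} :
    Dfn fun x : Ext k Γ => (f x.c : ℤ) :=
  Dfn.wk (f := fun γ => (f γ : ℤ))

instance Dfn.nat_wk2 {f : Γ → ℕ} [hf : Dfn fun γ => (f γ : ℤ)] {k l : ℕ} :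
    Dfn fun x : Ext l (Ext k Γ) => (f x.c.c : ℤ) :=
  Dfn.wk (f := fun y : Ext k Γ => (f y.c : ℤ))

instance DfnP.bool_wk {f : Γ → Bool} [hf : DfnP fun γ => f γ = true] {k : ℕ} :
    DfnP fun x : Ext k Γ => f x.c = true :=
  DfnP.wk (p := fun γ => f γ = true)

/-! ### Bounded search and iteration -/

/-- The least `i < n` with `p i`, or `n` if there is none. -/
def firstIdx (n : ℕ) (p : ℕ → Prop) : ℕ := sInf {i | i = n ∨ p i}

theorem firstIdx_le (n : ℕ) (p : ℕ → Prop) : firstIdx n p ≤ n := Nat.sInf_le (Or.inl rfl)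

theorem firstIdx_spec {n : ℕ} {p : ℕ → Prop} (h : firstIdx n p < n) : p (firstIdx n p) := by
  have := Nat.sInf_mem (s := {i | i = n ∨ p i}) ⟨n, Or.inl rfl⟩
  exact this.resolve_left (Nat.ne_of_lt h)

theorem not_of_lt_firstIdx {n i : ℕ} {p : ℕ → Prop} (h : i < firstIdx n p) : ¬ p i :=
  fun hp => absurd (Nat.sInf_le (Or.inr hp)) (not_le.2 h)

theorem firstIdx_lt_iff {n : ℕ} {p : ℕ → Prop} : firstIdx n p < n ↔ ∃ i < n, p i :=
  ⟨fun h => ⟨_, h, firstIdx_spec h⟩, fun ⟨_, h, hp⟩ =>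
    lt_of_le_of_lt (Nat.sInf_le (Or.inr hp)) h⟩

theorem firstIdx_eq {n i : ℕ} {p : ℕ → Prop} (h : i = n ∨ i < n ∧ p i) (h' : ∀ j < i, ¬ p j) :
    firstIdx n p = i := by
  apply le_antisymm
  · exact Nat.sInf_le (h.imp id And.right)
  · by_contra hlt
    have hn : firstIdx n p < n := by omega
    exact h' _ (by omega) (firstIdx_spec hn)

/-- Bounded search is a fold whose accumulator is `n γ` as long as nothing has been found and is
frozen once it is smaller. Bounded quantifiers, `List.find?` and functions with a definable graph
all reduce to it. The hypothesis ranges over all `k` because the exponent that bounds `n` is known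
only inside the proof. -/
instance Dfn.firstIdx {n : Γ → ℕ} {p : Γ → ℕ → Prop} [hn : Dfn fun γ => (n γ : ℤ)]
    [hp : ∀ k, DfnP fun x : Ext k Γ => p x.c x.i] :
    Dfn fun γ => (firstIdx (n γ) (p γ) : ℤ) := by
  obtain ⟨⟨s, hs⟩, k, hk⟩ := hn
  obtain ⟨t, ht⟩ := hp k
  simp only [Nat.abs_cast] at hk
  have hb : ∀ γ, |((PortalGame.firstIdx (n γ) (p γ) : ℕ) : ℤ)| ≤ (sz γ : ℤ) ^ k := fun γ => by
    rw [Nat.abs_cast]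
    have := firstIdx_le (n γ) (p γ)
    have := hk γ
    omega
  -- The number of the round is the variable `Ctx.depth Γ`, which is the one that `t` sees as the
  -- new variable of `Ext k Γ`; the accumulator is the next variable.
  refine ⟨⟨.fold k (Ctx.depth Γ + 1) (Ctx.depth Γ) s (.ite (.sub s (.var (Ctx.depth Γ + 1)))
    (.var (Ctx.depth Γ + 1)) (.ite (.sub s (.var (Ctx.depth Γ)))
      (.ite t (.var (Ctx.depth Γ)) (.var (Ctx.depth Γ + 1))) (.var (Ctx.depth Γ + 1)))),
      fun γ E h => ?_⟩, k, hb⟩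
  have hf : ∀ (a : ℤ) (i : ℕ), i < sz γ ^ k → Tm.value (.ite (.sub s (.var (Ctx.depth Γ + 1)))
    (.var (Ctx.depth Γ + 1)) (.ite (.sub s (.var (Ctx.depth Γ)))
      (.ite t (.var (Ctx.depth Γ)) (.var (Ctx.depth Γ + 1))) (.var (Ctx.depth Γ + 1))))
        ((E.bind (Ctx.depth Γ + 1) a).bind (Ctx.depth Γ) (i : ℤ)) =
      if a < n γ then a else if i < n γ then if p γ i then (i : ℤ) else a else a := by
    intro a i hi
    have h1 := (h.bind (x := Ctx.depth Γ + 1) (by omega) a)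
    have h2 := h1.ext hi
    have h3 := ht _ _ h2
    have h4 := hs _ _ h2.wk
    have h5 : ((E.bind (Ctx.depth Γ + 1) a).bind (Ctx.depth Γ) i).var (Ctx.depth Γ + 1) = a := by
      simp [Env.bind]
    have h6 : ((E.bind (Ctx.depth Γ + 1) a).bind (Ctx.depth Γ) i).var (Ctx.depth Γ) = i := by
      simp [Env.bind]
    simp only [Tm.value, h3, h4, h5, h6, Int.sub_pos, Nat.cast_lt]
  rw [Tm.value, hs γ E h, h.size]
  have hE : ∀ a : ℕ, a ≤ n γ → clamp ((sz γ : ℤ) ^ k) a = a := fun a ha => by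
    apply clamp_of_abs_le
    rw [Nat.abs_cast]
    have := hk γ
    omega
  generalize hF : (fun (a : ℤ) (i : ℕ) => Tm.value _ ((E.bind (Ctx.depth Γ + 1) a).bind _ _)) = f
  replace hf : ∀ (a : ℤ) (i : ℕ), i < sz γ ^ k → f a i =
      if a < n γ then a else if i < n γ then if p γ i then (i : ℤ) else a else a := by
    intro a i hi
    rw [← hf a i hi, ← hF]
  -- Invariant: the accumulator is `n γ` or a solution already met, and no smaller number among the
  -- first `i` is a solution. Clamping never acts because `n γ ≤ sz γ ^ k`.
  have key : ∀ i ≤ sz γ ^ k, ∃ a : ℕ, foldAcc ((sz γ : ℤ) ^ k) (n γ) f i = a ∧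
      (a = n γ ∨ a < n γ ∧ a < i ∧ p γ a) ∧ ∀ j < a, j < i → ¬ p γ j := by
    intro i
    induction i with
    | zero => exact fun _ => ⟨n γ, hE _ le_rfl, Or.inl rfl, fun _ _ h => absurd h (by omega)⟩
    | succ i ih =>
      intro hi
      obtain ⟨a, h1, h2, h3⟩ := ih (by omega)
      simp only [foldAcc, h1, hf a i (by omega)]
      by_cases ha : a < n γ
      · obtain ⟨-, hai, hpa⟩ := h2.resolve_left (by omega)
        refine ⟨a, ?_, Or.inr ⟨ha, by omega, hpa⟩, fun j hj hji => h3 j hj (by omega)⟩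
        rw [if_pos (by omega), hE a ha.le]
      · obtain rfl : a = n γ := by omega
        rw [if_neg (by omega)]
        by_cases hin : i < n γ
        · rw [if_pos hin]
          by_cases hpi : p γ i
          · rw [if_pos hpi]
            exact ⟨i, hE i hin.le, Or.inr ⟨hin, by omega, hpi⟩, fun j hj _ => h3 j (by omega) hj⟩
          · rw [if_neg hpi]
            refine ⟨n γ, hE _ le_rfl, Or.inl rfl, fun j hj hji => ?_⟩
            rcases Nat.lt_succ_iff_lt_or_eq.1 hji with h | rfl
            · exact h3 j hj h
            · exact hpi
        · rw [if_neg hin]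
          exact ⟨n γ, hE _ le_rfl, Or.inl rfl, fun j hj _ => h3 j hj (by omega)⟩
  obtain ⟨a, h1, h2, h3⟩ := key _ le_rfl
  rw [h1]
  norm_cast
  symm
  apply firstIdx_eq (h2.imp id fun h => ⟨h.1, h.2.2⟩)
  intro j hj
  apply h3 j hj
  have h5 := hk γ
  have h6 : a ≤ n γ := by rcases h2 with h2 | h2 <;> omega
  have : (j : ℤ) < (sz γ : ℤ) ^ k := by omega
  exact_mod_cast this

instance DfnP.exists_lt {n : Γ → ℕ} {p : Γ → ℕ → Prop} [hn : Dfn fun γ => (n γ : ℤ)]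
    [hp : ∀ k, DfnP fun x : Ext k Γ => p x.c x.i] : DfnP fun γ => ∃ i, i < n γ ∧ p γ i :=
  (DfnP.nat_lt (f := fun γ => firstIdx (n γ) (p γ)) (g := n)).congr fun _ =>
    firstIdx_lt_iff.symm

instance DfnP.forall_lt {n : Γ → ℕ} {p : Γ → ℕ → Prop} [hn : Dfn fun γ => (n γ : ℤ)]
    [hp : ∀ k, DfnP fun x : Ext k Γ => p x.c x.i] : DfnP fun γ => ∀ i, i < n γ → p γ i :=
  (DfnP.not (p := fun γ => ∃ i, i < n γ ∧ ¬ p γ i)).congr fun _ => by push Not; rfl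

/-- The value is the first number, and the only one, that satisfies the graph. -/
theorem Dfn.of_graph {f n : Γ → ℕ} [hn : Dfn fun γ => (n γ : ℤ)] (hlt : ∀ γ, f γ < n γ)
    [hp : ∀ k, DfnP fun x : Ext k Γ => f x.c = x.i] : Dfn fun γ => (f γ : ℤ) :=
  (Dfn.firstIdx (n := n) (p := fun γ i => f γ = i)).congr fun γ => by
    rw [firstIdx_eq (Or.inr ⟨hlt γ, rfl⟩)]
    intro j hj h
    omega

/-- The fold has a fixed power of the size as its number of rounds, so rounds from `n γ` on must
change nothing. The bound `hb` on all intermediate values ensures that clamping has no effect. -/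
theorem Dfn.iterate {g : Γ → ℤ → ℤ} {n : Γ → ℕ} {init : Γ → ℤ} (c : ℕ)
    (hg : ∃ t : Tm, ∃ x ≥ Ctx.depth Γ, ∀ γ E, Rep γ E → t.value E = g γ (E.var x))
    [hn : Dfn fun γ => (n γ : ℤ)] [hi : Dfn init]
    (hb : ∀ γ, ∀ i ≤ n γ, |(g γ)^[i] (init γ)| ≤ (sz γ : ℤ) ^ c) :
    Dfn fun γ => (g γ)^[n γ] (init γ) := by
  obtain ⟨t, x, hx, ht⟩ := hg
  obtain ⟨⟨s, hs⟩, k, hk⟩ := hn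
  obtain ⟨⟨u, hu⟩, -⟩ := hi
  simp only [Nat.abs_cast] at hk
  refine ⟨⟨.fold (k + c) x (x + 1) u (.ite (.sub s (.var (x + 1))) t (.var x)),
    fun γ E h => ?_⟩, c, fun γ => hb γ _ le_rfl⟩
  rw [Tm.value, hu γ E h, h.size]
  set f : ℤ → ℕ → ℤ := fun a i =>
    Tm.value (.ite (.sub s (.var (x + 1))) t (.var x)) ((E.bind x a).bind (x + 1) i) with hf
  have hval : ∀ a i, f a i = if i < n γ then g γ a else a := by
    intro a i
    have h1 := (h.bind hx a).bind (x := x + 1) (by omega) i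
    have h2 := ht _ _ h1
    have h3 := hs _ _ h1
    have h4 : ((E.bind x a).bind (x + 1) i).var x = a := by simp [Env.bind]
    have h5 : ((E.bind x a).bind (x + 1) i).var (x + 1) = i := by simp [Env.bind]
    simp only [hf, Tm.value, h2, h3, h4, h5, Int.sub_pos, Nat.cast_lt]
  have key : ∀ i, foldAcc ((sz γ : ℤ) ^ (k + c)) (init γ) f i =
      (g γ)^[min i (n γ)] (init γ) := by
    intro i
    have hc : ∀ j ≤ n γ, |(g γ)^[j] (init γ)| ≤ (sz γ : ℤ) ^ (k + c) := fun j hj =>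
      (hb γ j hj).trans (sz_pow_mono γ (by omega))
    induction i with
    | zero =>
      rw [Nat.zero_min]
      exact clamp_of_abs_le (hc 0 (by omega))
    | succ i ih =>
      rw [foldAcc, ih, hval]
      by_cases hin : i < n γ
      · rw [if_pos hin, min_eq_left hin.le, min_eq_left (by omega),
          ← Function.iterate_succ_apply' (g γ)]
        exact clamp_of_abs_le (hc _ (by omega))
      · rw [if_neg hin, min_eq_right (by omega), min_eq_right (by omega)]
        exact clamp_of_abs_le (hc _ le_rfl)
  rw [key, min_eq_right]
  have h1 := hk γ
  have h2 := sz_pow_mono γ (show k ≤ k + c by omega)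
  have h3 := h1.trans h2
  exact_mod_cast h3

/-! ### Derived functions -/

instance Dfn.max {f g : Γ → ℤ} [Dfn f] [Dfn g] : Dfn fun γ => max (f γ) (g γ) :=
  (Dfn.ite (p := fun γ => f γ ≤ g γ) (d := fun _ => inferInstance) (f := g) (g := f)).congr
    fun _ => max_def _ _

instance Dfn.min {f g : Γ → ℤ} [Dfn f] [Dfn g] : Dfn fun γ => min (f γ) (g γ) :=
  (Dfn.ite (p := fun γ => f γ ≤ g γ) (d := fun _ => inferInstance) (f := f) (g := g)).congr
    fun _ => min_def _ _

instance Dfn.abs {f : Γ → ℤ} [Dfn f] : Dfn fun γ => |f γ| :=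
  (Dfn.max (f := f) (g := fun γ => - f γ)).congr fun _ => rfl

instance Dfn.sign {f : Γ → ℤ} [Dfn f] : Dfn fun γ => (f γ).sign :=
  (show Dfn fun γ => if 0 < f γ then (1 : ℤ) else if f γ < 0 then -1 else 0
    from inferInstance).congr fun γ => by
      rcases lt_trichotomy (f γ) 0 with h | h | h
      · rw [Int.sign_eq_neg_one_of_neg h, if_neg (by omega), if_pos h]
      · simp [h]
      · rw [Int.sign_eq_one_of_pos h, if_pos h]

instance Dfn.natAbs {f : Γ → ℤ} [Dfn f] : Dfn fun γ => ((f γ).natAbs : ℤ) :=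
  (Dfn.abs (f := f)).congr fun _ => Int.natCast_natAbs _

instance Dfn.toNat {f : Γ → ℤ} [Dfn f] : Dfn fun γ => ((f γ).toNat : ℤ) :=
  (Dfn.max (f := f) (g := fun _ : Γ => (0 : ℤ))).congr fun _ => Int.toNat_eq_max _

instance Dfn.nat_const (n : ℕ) : Dfn fun _ : Γ => (n : ℤ) := Dfn.const _

instance Dfn.nat_add {f g : Γ → ℕ} [Dfn fun γ => (f γ : ℤ)] [Dfn fun γ => (g γ : ℤ)] :
    Dfn fun γ => ((f γ + g γ : ℕ) : ℤ) :=
  (Dfn.add (f := fun γ => (f γ : ℤ)) (g := fun γ => (g γ : ℤ))).congr fun _ => by push_cast; rfl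

instance Dfn.nat_mul {f g : Γ → ℕ} [Dfn fun γ => (f γ : ℤ)] [Dfn fun γ => (g γ : ℤ)] :
    Dfn fun γ => ((f γ * g γ : ℕ) : ℤ) :=
  (Dfn.mul (f := fun γ => (f γ : ℤ)) (g := fun γ => (g γ : ℤ))).congr fun _ => by push_cast; rfl

instance Dfn.nat_div {f g : Γ → ℕ} [Dfn fun γ => (f γ : ℤ)] [Dfn fun γ => (g γ : ℤ)] :
    Dfn fun γ => ((f γ / g γ : ℕ) : ℤ) :=
  (Dfn.div (f := fun γ => (f γ : ℤ)) (g := fun γ => (g γ : ℤ))).congr fun _ => by push_cast; rfl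

instance Dfn.nat_pow {f : Γ → ℕ} [Dfn fun γ => (f γ : ℤ)] (n : ℕ) :
    Dfn fun γ => ((f γ ^ n : ℕ) : ℤ) :=
  (Dfn.pow (f := fun γ => (f γ : ℤ)) n).congr fun _ => by push_cast; rfl

instance Dfn.nat_sub {f g : Γ → ℕ} [Dfn fun γ => (f γ : ℤ)] [Dfn fun γ => (g γ : ℤ)] :
    Dfn fun γ => ((f γ - g γ : ℕ) : ℤ) :=
  (Dfn.max (f := fun γ => (f γ : ℤ) - (g γ : ℤ)) (g := fun _ : Γ => (0 : ℤ))).congr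
    fun _ => by omega

instance Dfn.nat_ite {p : Γ → Prop} {d : ∀ γ, Decidable (p γ)} {f g : Γ → ℕ} [hp : DfnP p]
    [hf : Dfn fun γ => (f γ : ℤ)] [hg : Dfn fun γ => (g γ : ℤ)] :
    Dfn fun γ => ((if p γ then f γ else g γ : ℕ) : ℤ) :=
  (Dfn.ite (p := p) (d := d) (f := fun γ => (f γ : ℤ)) (g := fun γ => (g γ : ℤ))).congr
    fun _ => by push_cast; rfl

instance DfnP.ite {p : Γ → Prop} {d : ∀ γ, Decidable (p γ)} {q r : Γ → Prop} [hp : DfnP p]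
    [DfnP q] [DfnP r] : DfnP fun γ => if p γ then q γ else r γ :=
  (DfnP.and (p := fun γ => p γ → q γ) (q := fun γ => ¬ p γ → r γ)).congr fun γ => by
    split_ifs <;> simp_all

instance Dfn.sqrt {f : Γ → ℕ} [Dfn fun γ => (f γ : ℤ)] : Dfn fun γ => (Nat.sqrt (f γ) : ℤ) := by
  have : ∀ k, DfnP fun x : Ext k Γ => Nat.sqrt (f x.c) = x.i := fun k =>
    (show DfnP fun x : Ext k Γ => x.i * x.i ≤ f x.c ∧ f x.c < (x.i + 1) * (x.i + 1) from
      inferInstance).congr fun x => by rw [eq_comm, Nat.eq_sqrt]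
  exact Dfn.of_graph (n := fun γ => f γ + 1) fun γ => Nat.lt_succ_of_le (Nat.sqrt_le_self _)

/-! ### Vectors -/

instance Dfn.comp {v : Γ → Vec} [hv : DfnV v] {j : Fin 3} : Dfn fun γ => v γ j := hv.comp j

instance DfnV.wk {v : Γ → Vec} [hv : DfnV v] {k : ℕ} : DfnV fun x : Ext k Γ => v x.c :=
  ⟨fun j => Dfn.wk (f := fun γ => v γ j)⟩

instance DfnV.wk2 {f : Γ → Vec} [hf : DfnV f] {k l : ℕ} :
    DfnV fun x : Ext l (Ext k Γ) => f x.c.c :=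
  DfnV.wk (v := fun y : Ext k Γ => f y.c)

instance DfnV.const (v : Vec) : DfnV fun _ : Γ => v := ⟨fun j => Dfn.const (v j)⟩

instance DfnV.add {v w : Γ → Vec} [DfnV v] [DfnV w] : DfnV fun γ => v γ + w γ :=
  ⟨fun j => inferInstanceAs (Dfn fun γ => v γ j + w γ j)⟩

instance DfnV.sub {v w : Γ → Vec} [DfnV v] [DfnV w] : DfnV fun γ => v γ - w γ :=
  ⟨fun j => inferInstanceAs (Dfn fun γ => v γ j - w γ j)⟩

instance DfnV.neg {v : Γ → Vec} [DfnV v] : DfnV fun γ => - v γ :=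
  ⟨fun j => inferInstanceAs (Dfn fun γ => - v γ j)⟩

instance DfnV.smul {f : Γ → ℤ} {v : Γ → Vec} [Dfn f] [DfnV v] : DfnV fun γ => f γ • v γ :=
  ⟨fun j => inferInstanceAs (Dfn fun γ => f γ * v γ j)⟩

instance DfnV.ite {p : Γ → Prop} {d : ∀ γ, Decidable (p γ)} {v w : Γ → Vec} [DfnP p] [DfnV v]
    [DfnV w] : DfnV fun γ => if p γ then v γ else w γ :=
  ⟨fun j => (show Dfn fun γ => if p γ then v γ j else w γ j from inferInstance).congr fun γ => by
    split_ifs <;> rfl⟩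

theorem DfnV.mk' {v : Γ → Vec} (h0 : Dfn fun γ => v γ 0) (h1 : Dfn fun γ => v γ 1)
    (h2 : Dfn fun γ => v γ 2) : DfnV v :=
  ⟨fun j => by fin_cases j <;> assumption⟩

instance DfnV.vec {f g h : Γ → ℤ} [Dfn f] [Dfn g] [Dfn h] : DfnV fun γ => ![f γ, g γ, h γ] :=
  DfnV.mk' ‹Dfn f› ‹Dfn g› ‹Dfn h›

instance Dfn.dot {v w : Γ → Vec} [DfnV v] [DfnV w] : Dfn fun γ => v γ ⬝ᵥ w γ :=
  (show Dfn fun γ => v γ 0 * w γ 0 + v γ 1 * w γ 1 + v γ 2 * w γ 2 from inferInstance).congr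
    fun γ => by simp [dotProduct, Fin.sum_univ_three]

instance DfnV.cross {v w : Γ → Vec} [DfnV v] [DfnV w] : DfnV fun γ => v γ ⨯₃ w γ := by
  simp only [cross_apply]
  infer_instance

instance DfnP.vec_eq {v w : Γ → Vec} [DfnV v] [DfnV w] : DfnP fun γ => v γ = w γ :=
  (show DfnP fun γ => v γ 0 = w γ 0 ∧ v γ 1 = w γ 1 ∧ v γ 2 = w γ 2 from inferInstance).congr
    fun γ => by
      constructor
      · intro h; simp [h]
      · rintro ⟨h0, h1, h2⟩; ext j; fin_cases j <;> assumption

instance Dfn.divSqrt {f : Γ → ℤ} {n : Γ → ℕ} [Dfn f] [Dfn fun γ => (n γ : ℤ)] :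
    Dfn fun γ => divSqrt (f γ) (n γ) := by
  unfold PortalGame.divSqrt
  infer_instance

end

end PortalGame

end

/-! ## Integer solutions of strict linear inequalities -/

noncomputable section

namespace PortalGame

open scoped Classical

theorem abs_sum_mul_le {n : ℕ} {A w : Fin n → ℤ} {M G : ℤ} (hM : 0 ≤ M) (hA : ∀ j, |A j| ≤ M)
    (hw : ∀ j, |w j| ≤ G) : |∑ j, A j * w j| ≤ n * (M * G) := by
  refine (Finset.abs_sum_le_sum_abs _ _).trans ?_
  refine (Finset.sum_le_card_nsmul _ _ (M * G) fun j _ => ?_).trans (by simp)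
  rw [abs_mul]
  exact mul_le_mul (hA j) (hw j) (abs_nonneg _) hM

/-- A system of strict homogeneous linear inequalities with bounded integer coefficients that has a
real solution has a polynomially bounded integer solution. -/
theorem exists_int_solution (n : ℕ) : ∃ c : ℕ, ∀ M : ℤ, 2 ≤ M → ∀ S : Set (Fin n → ℤ),
    (∀ A ∈ S, ∀ j, |A j| ≤ M) →
    (∃ w : Fin n → ℝ, ∀ A ∈ S, 0 < ∑ j, (A j : ℝ) * w j) →
    ∃ w : Fin n → ℤ, (∀ j, |w j| ≤ M ^ c) ∧ ∀ A ∈ S, 0 < ∑ j, A j * w j := by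
  induction n with
  | zero =>
    refine ⟨0, fun M _ S _ ⟨w, hw⟩ => ⟨0, fun j => j.elim0, fun A hA => ?_⟩⟩
    simpa using hw A hA
  | succ n ih =>
    obtain ⟨c, hc⟩ := ih
    refine ⟨n + 5 + 3 * c, fun M hM S hS ⟨w, hw⟩ => ?_⟩
    -- Fourier–Motzkin elimination of the variable `0`: rows without it, and positive combinations
    -- of two rows in which it has opposite signs. The new coefficients are at most `2 * M ^ 2 ≤ M ^
    -- 3`, and the tail of the real solution solves the new system.
    set S' : Set (Fin n → ℤ) := {A | ∃ B ∈ S, B 0 = 0 ∧ A = Fin.tail B} ∪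
      {A | ∃ B ∈ S, ∃ C ∈ S, 0 < B 0 ∧ C 0 < 0 ∧
        A = fun j => -(C 0) * B j.succ + B 0 * C j.succ} with hS'
    have hM3 : 2 ≤ M ^ 3 := by nlinarith [sq_nonneg M, pow_succ M 2]
    have hMM : 2 * M ^ 2 ≤ M ^ 3 := by nlinarith [sq_nonneg M]
    obtain ⟨w', hw'b, hw'⟩ := hc (M ^ 3) hM3 S' (by
      rintro A (⟨B, hB, -, rfl⟩ | ⟨B, hB, C, hC, -, -, rfl⟩) j
      · exact (hS B hB _).trans (by nlinarith [sq_nonneg M])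
      · refine (abs_add_le _ _).trans ?_
        rw [abs_mul, abs_mul, abs_neg]
        have h1 := mul_le_mul (hS C hC 0) (hS B hB j.succ) (abs_nonneg _) (by omega)
        have h2 := mul_le_mul (hS B hB 0) (hS C hC j.succ) (abs_nonneg _) (by omega)
        nlinarith) ⟨Fin.tail w, by
      rintro A (⟨B, hB, hB0, rfl⟩ | ⟨B, hB, C, hC, hB0, hC0, rfl⟩)
      · have := hw B hB
        rw [Fin.sum_univ_succ, hB0] at this
        simpa [Fin.tail] using this
      · have h1 := hw B hB
        have h2 := hw C hC
        rw [Fin.sum_univ_succ] at h1 h2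
        have h3 : (0 : ℝ) < B 0 := by exact_mod_cast hB0
        have h4 : (C 0 : ℝ) < 0 := by exact_mod_cast hC0
        have h5 : ∑ j : Fin n, (((-(C 0) * B j.succ + B 0 * C j.succ : ℤ)) : ℝ) * Fin.tail w j
            = -(C 0 : ℝ) * ∑ j : Fin n, (B j.succ : ℝ) * w j.succ
              + B 0 * ∑ j : Fin n, (C j.succ : ℝ) * w j.succ := by
          rw [Finset.mul_sum, Finset.mul_sum, ← Finset.sum_add_distrib]
          refine Finset.sum_congr rfl fun j _ => ?_
          simp only [Fin.tail]
          push_cast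
          ring
        rw [h5]
        nlinarith [mul_pos (neg_pos.2 h4) h1, mul_pos h3 h2]⟩
    set G : ℤ := (M ^ 3) ^ c with hG
    have hG1 : 1 ≤ G := one_le_pow₀ (by omega)
    -- The integer solution `w'` of the eliminated system is scaled by `D`. Its combined
    -- inequalities then have slack at least `D`, more than a product of two coefficients, which
    -- leaves room for an integer value of the eliminated variable.
    set D : ℤ := M ^ 2 + 1 with hD
    set T : ℤ := n * (M * G) with hT
    have hT0 : 0 ≤ T := by positivity
    have hdot : ∀ A ∈ S, |∑ j : Fin n, A j.succ * w' j| ≤ T := fun A hA =>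
      abs_sum_mul_le (by omega) (fun j => hS A hA j.succ) hw'b
    have hD1 : 1 ≤ D := by nlinarith
    set Y : ℤ := D * T + 1 with hY
    have hY1 : 1 ≤ Y := by nlinarith
    -- The eliminated variable becomes the least integer from `-Y` on that satisfies all rows with
    -- positive leading coefficient, that is, all lower bounds. The value `Y` does satisfy them
    -- since `Y` exceeds `D * T`.
    let P : ℤ → Prop := fun y =>
      -Y ≤ y ∧ ∀ A ∈ S, 0 < A 0 → 0 < D * (∑ j : Fin n, A j.succ * w' j) + A 0 * y
    have hPY : P Y := by
      refine ⟨by omega, fun A hA hA0 => ?_⟩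
      have h1 := (abs_le.1 (hdot A hA)).1
      nlinarith [mul_le_mul_of_nonneg_left h1 (by omega : 0 ≤ D),
        mul_le_mul_of_nonneg_right (show 1 ≤ A 0 by omega) (by omega : 0 ≤ Y)]
    obtain ⟨y, ⟨hy1, hy2⟩, hymin⟩ := Int.exists_least_of_bdd ⟨-Y, fun z hz => hz.1⟩ ⟨Y, hPY⟩
    have hyY : y ≤ Y := hymin Y hPY
    have hpow : ∀ j, M ^ j ≤ M ^ (j + 1) := fun j => pow_le_pow_right₀ (by omega) (by omega)
    have hDM : D ≤ M ^ 3 := by nlinarith [sq_nonneg M]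
    have hYM : Y ≤ M ^ (n + 5 + 3 * c) := by
      have h1 : (n : ℤ) ≤ M ^ n := by
        have := (Nat.lt_two_pow_self (n := n)).le
        calc (n : ℤ) ≤ 2 ^ n := by exact_mod_cast this
          _ ≤ M ^ n := pow_le_pow_left₀ (by norm_num) hM n
      have h2 : D * T ≤ M ^ (n + 4 + 3 * c) := by
        calc D * T ≤ M ^ 3 * (M ^ n * (M * G)) := by
              apply mul_le_mul hDM (mul_le_mul_of_nonneg_right h1 (by positivity)) hT0
              positivity
          _ = M ^ (n + 4 + 3 * c) := by rw [hG]; ring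
      have h3 : (1 : ℤ) ≤ M ^ (n + 4 + 3 * c) := one_le_pow₀ (by omega)
      have h4 : M ^ (n + 5 + 3 * c) = M * M ^ (n + 4 + 3 * c) := by ring
      nlinarith
    refine ⟨Fin.cons y fun j => D * w' j, fun j => ?_, fun A hA => ?_⟩
    · refine Fin.cases ?_ (fun j => ?_) j
      · rw [Fin.cons_zero, abs_le]
        constructor <;> omega
      · rw [Fin.cons_succ, abs_mul, abs_of_pos (by omega : 0 < D)]
        calc D * |w' j| ≤ M ^ 3 * G := mul_le_mul hDM (hw'b j) (abs_nonneg _) (by positivity)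
          _ = M ^ (3 + 3 * c) := by rw [hG]; ring
          _ ≤ _ := pow_le_pow_right₀ (by omega) (by omega)
    · rw [Fin.sum_univ_succ, Fin.cons_zero]
      have hsum : ∑ j : Fin n, A j.succ * Fin.cons (α := fun _ => ℤ) y (fun j => D * w' j) j.succ
          = D * ∑ j : Fin n, A j.succ * w' j := by
        rw [Finset.mul_sum]
        exact Finset.sum_congr rfl fun j _ => by rw [Fin.cons_succ]; ring
      rw [hsum]
      rcases lt_trichotomy (A 0) 0 with h0 | h0 | h0
      · by_cases hP : P (y - 1)
        · have := hymin _ hP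
          omega
        have hb : |A 0| ≤ M := hS A hA 0
        rw [abs_of_neg h0] at hb
        by_cases hlow : -Y ≤ y - 1
        -- By minimality some lower bound, given by a row `B`, fails at `y - 1`. Combining it with
        -- the row `A`, and using the slack `D` of the combined row against `B 0 * -(A 0) ≤ M ^ 2`,
        -- gives the upper bound expressed by `A`.
        · have : ∃ B ∈ S, 0 < B 0 ∧ D * (∑ j : Fin n, B j.succ * w' j) + B 0 * (y - 1) ≤ 0 := by
            by_contra hno
            push Not at hno
            exact hP ⟨hlow, hno⟩
          obtain ⟨B, hB, hB0, hBy⟩ := this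
          have hBM := hS B hB 0
          rw [abs_of_pos hB0] at hBM
          have h1 := hw' _ (Or.inr ⟨B, hB, A, hA, hB0, h0, rfl⟩)
          have h2 : ∑ j : Fin n, (-(A 0) * B j.succ + B 0 * A j.succ) * w' j
              = -(A 0) * ∑ j : Fin n, B j.succ * w' j + B 0 * ∑ j : Fin n, A j.succ * w' j := by
            rw [Finset.mul_sum, Finset.mul_sum, ← Finset.sum_add_distrib]
            exact Finset.sum_congr rfl fun j _ => by ring
          rw [h2] at h1
          generalize ∑ j : Fin n, B j.succ * w' j = p at h1 hBy
          generalize ∑ j : Fin n, A j.succ * w' j = q at h1 ⊢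
          have h3 : D ≤ D * (-(A 0) * p + B 0 * q) := by nlinarith
          have h4 : -(A 0) * (D * p + B 0 * (y - 1)) ≤ 0 := by nlinarith
          have h5 : B 0 * -(A 0) ≤ M ^ 2 := by nlinarith
          have h6 : 0 < B 0 * (A 0 * y + D * q) := by nlinarith
          exact (mul_pos_iff_of_pos_left hB0).1 h6
        -- At the left end `-Y` the term `A 0 * y` is at least `Y` and outweighs the rest of the
        -- row.
        · have h1 : y = -Y := by omega
          have h2 := (abs_le.1 (hdot A hA)).1
          rw [h1]
          nlinarith [mul_le_mul_of_nonneg_left h2 (by omega : 0 ≤ D)]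
      · rw [h0, zero_mul, zero_add]
        exact mul_pos (by omega) (hw' _ (Or.inl ⟨A, hA, h0, rfl⟩))
      · have := hy2 A hA h0
        linarith

/-! ### Boxes that meet polygons -/

/-- The polygon, enlarged by the factor `m`, meets an open box. -/
def Meets (m : ℤ) (lo hi : Vec) (P : Polygon) : Prop :=
  ∃ x ∈ P.region, ∀ j, (lo j : ℝ) < m * x j ∧ m * x j < hi j

def Polygon.corner (P : Polygon) (i : ℕ) : Vec := P.corners.getD i 0

theorem Polygon.mem_corners_iff {P : Polygon} {v : Vec} :
    v ∈ P.corners ↔ ∃ i < P.corners.length, v = P.corner i := by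
  rw [List.mem_iff_getElem]
  constructor
  · rintro ⟨i, hi, rfl⟩
    exact ⟨i, hi, by rw [Polygon.corner, List.getD_eq_getElem _ _ hi]⟩
  · rintro ⟨i, hi, rfl⟩
    exact ⟨i, hi, by rw [Polygon.corner, List.getD_eq_getElem _ _ hi]⟩

/-- A convex combination of four corners with bounded integer weights lies in the box. -/
def MeetsComb (W : ℕ) (m : ℤ) (lo hi : Vec) (P : Polygon) : Prop :=
  ∃ i l : Fin 4 → ℕ, (∀ t, i t < P.corners.length) ∧ (∀ t, 0 < l t ∧ l t < W) ∧
    ∀ j, lo j * ∑ t, (l t : ℤ) < m * ∑ t, (l t : ℤ) * P.corner (i t) j ∧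
      m * ∑ t, (l t : ℤ) * P.corner (i t) j < hi j * ∑ t, (l t : ℤ)

/-- Carathéodory's theorem in dimension three. All four weights are to be positive, since the linear
system for them is strict; if fewer corners occur, some are repeated and share their weight. -/
theorem exists_four_corners {P : Polygon} {x : Point} (hx : x ∈ P.region) :
    ∃ (i : Fin 4 → ℕ) (w : Fin 4 → ℝ), (∀ t, i t < P.corners.length) ∧ (∀ t, 0 < w t) ∧
      ∑ t, w t = 1 ∧ ∀ j, ∑ t, w t * P.corner (i t) j = x j := by
  obtain ⟨ι, hι, z, w, hz, hai, hw, hw1, hwx⟩ := eq_pos_convex_span_of_mem_convexHull hx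
  have hcard : Fintype.card ι ≤ 4 := by
    have := hai.card_le_finrank_succ
    have h2 := this.trans (Nat.add_le_add_right (Submodule.finrank_le _) 1)
    simpa using h2
  have hne : Nonempty ι := by
    by_contra h
    rw [not_nonempty_iff] at h
    simp at hw1
  obtain ⟨e⟩ : Nonempty (ι ↪ Fin 4) := Function.Embedding.nonempty_of_card_le (by simpa using hcard)
  set f : Fin 4 → ι := Function.invFun e with hf
  have hfe : ∀ a, f (e a) = a := Function.leftInverse_invFun e.injective
  set N : ι → ℕ := fun a => (Finset.univ.filter fun t => f t = a).card with hN
  have hNpos : ∀ a, 0 < N a := fun a => Finset.card_pos.2 ⟨e a, by simp [hfe]⟩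
  -- The surjection `f` from four indices onto the corners in use has fibres of size `N a`.
  -- Splitting every weight evenly over its fibre preserves all sums.
  have key : ∀ g : ι → ℝ, ∑ t, g (f t) / N (f t) = ∑ a, g a := by
    intro g
    rw [← Finset.sum_fiberwise (s := Finset.univ) (g := f)]
    refine Finset.sum_congr rfl fun a _ => ?_
    rw [Finset.sum_congr rfl (g := fun _ => g a / N a) fun t ht => by
      rw [(Finset.mem_filter.1 ht).2]]
    rw [Finset.sum_const, nsmul_eq_mul]
    have := hNpos a
    change (N a : ℝ) * (g a / N a) = g a
    field_simp
  have hcorner : ∀ a, ∃ i < P.corners.length, z a = toPoint (P.corner i) := fun a => by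
    obtain ⟨v, hv, hva⟩ := hz ⟨a, rfl⟩
    obtain ⟨i, hi, rfl⟩ := Polygon.mem_corners_iff.1 hv
    exact ⟨i, hi, hva⟩
  choose c hc hzc using hcorner
  refine ⟨fun t => c (f t), fun t => w (f t) / N (f t), fun t => hc _,
    fun t => div_pos (hw _) (by exact_mod_cast hNpos _), (key w).trans hw1, fun j => ?_⟩
  have h1 := key fun a => w a * z a j
  have h2 : x j = ∑ a, w a * z a j := by
    rw [← hwx]
    simp [Finset.sum_apply]
  rw [h2, ← h1]
  refine Finset.sum_congr rfl fun t _ => ?_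
  rw [hzc (f t)]
  simp only [toPoint]
  ring

theorem MeetsComb.meets {W : ℕ} {m : ℤ} {lo hi : Vec} {P : Polygon}
    (h : MeetsComb W m lo hi P) : Meets m lo hi P := by
  obtain ⟨i, l, hi', hl, h⟩ := h
  have hS : (0 : ℝ) < ∑ t, (l t : ℝ) :=
    Finset.sum_pos (fun t _ => by exact_mod_cast (hl t).1) Finset.univ_nonempty
  set S : ℝ := ∑ t, (l t : ℝ) with hSdef
  refine ⟨∑ t, ((l t : ℝ) / S) • toPoint (P.corner (i t)), ?_, fun j => ?_⟩
  · refine (convex_convexHull ℝ _).sum_mem (fun t _ => by positivity) ?_ fun t _ =>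
      subset_convexHull ℝ _ ⟨_, Polygon.mem_corners_iff.2 ⟨_, hi' t, rfl⟩, rfl⟩
    rw [← Finset.sum_div, div_self hS.ne']
  · have hx : m * (∑ t, ((l t : ℝ) / S) • toPoint (P.corner (i t))) j =
        (m * ∑ t, (l t : ℝ) * P.corner (i t) j) / S := by
      simp only [Finset.sum_apply, Pi.smul_apply, smul_eq_mul, toPoint]
      rw [mul_div_assoc, Finset.sum_div]
      congr 1
      exact Finset.sum_congr rfl fun t _ => by ring
    rw [hx, lt_div_iff₀ hS, div_lt_iff₀ hS]
    obtain ⟨h1, h2⟩ := h j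
    exact ⟨by rw [hSdef]; exact_mod_cast h1, by rw [hSdef]; exact_mod_cast h2⟩

/-- For fixed corners, the conditions on the four weights are strict and linear, and multiplying the
box conditions by the total weight makes them homogeneous. Real weights can thus be replaced by
integers of polynomial size, with an exponent that depends only on the number four. This makes
contact a finite search. -/
theorem exists_meets_iff : ∃ b : ℕ, ∀ (M : ℕ) (m : ℤ) (lo hi : Vec) (P : Polygon), 2 ≤ M →
    (∀ v ∈ P.corners, ∀ j, |m * v j| ≤ M) → (∀ j, |lo j| ≤ M) → (∀ j, |hi j| ≤ M) →
    (Meets m lo hi P ↔ MeetsComb (M ^ b) m lo hi P) := by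
  obtain ⟨c, hc⟩ := exists_int_solution 4
  refine ⟨2 * c + 1, fun M m lo hi P hM hP hlo hhi => ⟨?_, MeetsComb.meets⟩⟩
  rintro ⟨x, hx, hbox⟩
  obtain ⟨i, w, hi', hw, hw1, hwx⟩ := exists_four_corners hx
  have hmul : ∀ j, ∑ t, (m * P.corner (i t) j : ℝ) * w t = m * x j := fun j => by
    rw [← hwx j, Finset.mul_sum]
    exact Finset.sum_congr rfl fun t _ => by ring
  have hcor : ∀ t j, |m * P.corner (i t) j| ≤ (M : ℤ) := fun t j =>
    hP _ (Polygon.mem_corners_iff.2 ⟨_, hi' t, rfl⟩) j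
  have hM2 : (2 : ℤ) ≤ (M : ℤ) ^ 2 := by nlinarith
  have h2M : 2 * (M : ℤ) ≤ (M : ℤ) ^ 2 := by nlinarith
  obtain ⟨l, hlb, hl⟩ := hc ((M : ℤ) ^ 2) hM2
    ({A | ∃ t, A = Pi.single t 1} ∪ ({A | ∃ j, A = fun t => m * P.corner (i t) j - lo j} ∪
      {A | ∃ j, A = fun t => hi j - m * P.corner (i t) j}))
    (by
      rintro A (⟨t, rfl⟩ | ⟨j, rfl⟩ | ⟨j, rfl⟩) s
      · rw [Pi.single_apply]
        split_ifs
        · simpa using hM2.trans' one_le_two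
        · simp
      · have := abs_sub (m * P.corner (i s) j) (lo j)
        linarith [hcor s j, hlo j]
      · have := abs_sub (hi j) (m * P.corner (i s) j)
        linarith [hcor s j, hhi j])
    ⟨w, by
      rintro A (⟨t, rfl⟩ | ⟨j, rfl⟩ | ⟨j, rfl⟩)
      · simpa [Pi.single_apply] using hw t
      · have h1 : ∑ t, (((m * P.corner (i t) j - lo j : ℤ)) : ℝ) * w t = m * x j - lo j := by
          push_cast
          simp only [sub_mul]
          rw [Finset.sum_sub_distrib, hmul, ← Finset.mul_sum, hw1, mul_one]
        rw [h1]
        linarith [(hbox j).1]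
      · have h1 : ∑ t, (((hi j - m * P.corner (i t) j : ℤ)) : ℝ) * w t = hi j - m * x j := by
          push_cast
          simp only [sub_mul]
          rw [Finset.sum_sub_distrib, hmul, ← Finset.mul_sum, hw1, mul_one]
        rw [h1]
        linarith [(hbox j).2]⟩
  have hpos : ∀ t, 0 < l t := fun t => by
    have := hl _ (Or.inl ⟨t, rfl⟩)
    simpa [Pi.single_apply] using this
  have hcast : ∀ t, ((l t).toNat : ℤ) = l t := fun t => Int.toNat_of_nonneg (hpos t).le
  refine ⟨i, fun t => (l t).toNat, hi', fun t => ⟨Int.lt_toNat.2 (hpos t), ?_⟩, fun j => ?_⟩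
  · have h1 := (le_abs_self _).trans (hlb t)
    have h2 : ((M : ℤ) ^ 2) ^ c < (M : ℤ) ^ (2 * c + 1) := by
      rw [← pow_mul]
      exact pow_lt_pow_right₀ (by omega) (by omega)
    zify
    rw [hcast]
    exact lt_of_le_of_lt h1 h2
  · simp only [hcast]
    have h1 := hl _ (Or.inr (Or.inl ⟨j, rfl⟩))
    have h2 := hl _ (Or.inr (Or.inr ⟨j, rfl⟩))
    simp only [sub_mul, Finset.sum_sub_distrib, ← Finset.mul_sum] at h1 h2
    have h3 : m * ∑ t, l t * P.corner (i t) j = ∑ t, m * P.corner (i t) j * l t := by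
      rw [Finset.mul_sum]
      exact Finset.sum_congr rfl fun t _ => by ring
    rw [h3]
    constructor <;> linarith

/-! ### Rational points in polygons -/

theorem isClosed_region (P : Polygon) : IsClosed P.region := by
  apply Set.Finite.isClosed_convexHull ℝ
  refine ((List.finite_toSet P.corners).image toPoint).subset ?_
  rintro x ⟨v, hv, rfl⟩
  exact ⟨v, hv, rfl⟩

/-- A rational point lies in a polygon if a sufficiently small box around it meets the polygon. -/
theorem exists_mem_region_iff : ∃ b : ℕ, ∀ (M : ℕ) (Q : ℤ) (X : Vec) (P : Polygon), 2 ≤ M →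
    0 < Q → (∀ v ∈ P.corners, ∀ j, |Q * v j| ≤ M) → (∀ j, |X j| ≤ M) →
    ((fun j => (X j : ℝ) / Q) ∈ P.region ↔ Meets ((M : ℤ) ^ b * Q)
      (fun j => (M : ℤ) ^ b * X j - 1) (fun j => (M : ℤ) ^ b * X j + 1) P) := by
  obtain ⟨c, hc⟩ := exists_int_solution 3
  refine ⟨2 * c + 2, fun M Q X P hM hQ hP hX => ⟨fun h => ⟨_, h, fun j => ?_⟩, fun h => ?_⟩⟩
  · have hQ' : (Q : ℝ) ≠ 0 := by exact_mod_cast hQ.ne'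
    have : (((M : ℤ) ^ (2 * c + 2) * Q : ℤ) : ℝ) * ((X j : ℝ) / Q) =
        (M : ℝ) ^ (2 * c + 2) * X j := by
      push_cast
      field_simp
    rw [this]
    push_cast
    constructor <;> linarith
  · by_contra hx
    obtain ⟨f, u, hfx, hfP⟩ := geometric_hahn_banach_point_closed (convex_convexHull ℝ _)
      (isClosed_region P) hx
    have hM2 : (2 : ℤ) ≤ (M : ℤ) ^ 2 := by nlinarith
    have h2M : 2 * (M : ℤ) ≤ (M : ℤ) ^ 2 := by nlinarith
    have hQ' : (0 : ℝ) < Q := by exact_mod_cast hQ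
    have hf : ∀ y : Point, f y = ∑ j, y j * f (Pi.single j 1) := fun y => by
      have := LinearMap.pi_apply_eq_sum_univ (f : Point →ₗ[ℝ] ℝ) y
      simp only [smul_eq_mul, ContinuousLinearMap.coe_coe] at this
      rw [this]
      refine Finset.sum_congr rfl fun j _ => ?_
      congr 2
      ext i
      simp [Pi.single_apply, eq_comm]
    -- A point outside is strictly separated from the corners by a real functional. Separation is a
    -- strict linear system for the coefficients of the functional, so they may be taken to be
    -- integers of polynomial size.
    obtain ⟨w, hwb, hw⟩ := hc ((M : ℤ) ^ 2) hM2
      {A | ∃ v ∈ P.corners, A = fun j => Q * v j - X j}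
      (by
        rintro A ⟨v, hv, rfl⟩ j
        have := abs_sub (Q * v j) (X j)
        linarith [hP v hv j, hX j])
      ⟨fun j => f (Pi.single j 1), by
        rintro A ⟨v, hv, rfl⟩
        have h1 := hfP (toPoint v) (subset_convexHull ℝ _ ⟨v, hv, rfl⟩)
        have h2 := hfx.trans h1
        rw [hf, hf (toPoint v)] at h2
        have h3 := mul_lt_mul_of_pos_left h2 hQ'
        rw [Finset.mul_sum, Finset.mul_sum] at h3
        rw [← sub_pos, ← Finset.sum_sub_distrib] at h3
        refine h3.trans_eq (Finset.sum_congr rfl fun j _ => ?_)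
        simp only [toPoint]
        push_cast
        field_simp⟩
    obtain ⟨y, hy, hbox⟩ := h
    -- By integrality the positive values at the corners are at least one, and this passes to the
    -- convex hull. In the box around the point, however, the value is less than one.
    have hconv : y ∈ {y : Point | (1 : ℝ) ≤ ∑ j, (Q * y j - X j) * w j} := by
      refine convexHull_min ?_ ?_ hy
      · rintro y ⟨v, hv, rfl⟩
        have := hw _ ⟨v, hv, rfl⟩
        have h1 : (1 : ℤ) ≤ ∑ j, (Q * v j - X j) * w j := this
        simp only [Set.mem_ofPred_eq, toPoint]
        exact_mod_cast h1
      · intro a ha b hb s t hs ht hst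
        simp only [Set.mem_ofPred_eq] at ha hb ⊢
        have : ∑ j, (Q * (s • a + t • b) j - X j) * w j =
            s * ∑ j, (Q * a j - X j) * w j + t * ∑ j, (Q * b j - X j) * w j := by
          rw [Finset.mul_sum, Finset.mul_sum, ← Finset.sum_add_distrib]
          refine Finset.sum_congr rfl fun j _ => ?_
          simp only [Pi.add_apply, Pi.smul_apply, smul_eq_mul]
          linear_combination (X j : ℝ) * w j * hst
        rw [this]
        nlinarith
    simp only [Set.mem_ofPred_eq] at hconv
    set K : ℝ := (M : ℝ) ^ (2 * c + 2) with hK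
    set G : ℝ := Int.cast (((M : ℤ) ^ 2) ^ c) with hG
    have hKpos : 0 < K := by positivity
    have hG1 : 1 ≤ G := by
      have : (1 : ℤ) ≤ ((M : ℤ) ^ 2) ^ c := one_le_pow₀ (by omega)
      rw [hG]
      exact_mod_cast this
    -- The summand `2` in the exponent provides the factor `M ^ 2 ≥ 4`: the three coordinates
    -- contribute at most `G / K` each, in total at most three quarters.
    have hKG : 4 * G ≤ K := by
      rw [hK, hG, pow_add, pow_mul]
      push_cast
      have hM' : (2 : ℝ) ≤ M := by exact_mod_cast hM
      have : (4 : ℝ) ≤ (M : ℝ) ^ 2 := by nlinarith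
      have h0 : (0 : ℝ) ≤ ((M : ℝ) ^ 2) ^ c := by positivity
      nlinarith
    have hterm : ∀ j, K * ((Q * y j - X j) * w j) ≤ G := by
      intro j
      have h1 := hbox j
      push_cast at h1
      rw [← hK] at h1
      have h2 : |K * (Q * y j - X j)| ≤ 1 := by
        rw [abs_le]
        constructor <;> nlinarith
      have h3 : |(w j : ℝ)| ≤ G := by
        rw [hG]
        exact_mod_cast hwb j
      calc K * ((Q * y j - X j) * w j) ≤ |K * (Q * y j - X j) * w j| := by
            rw [← mul_assoc]; exact le_abs_self _
        _ = |K * (Q * y j - X j)| * |(w j : ℝ)| := abs_mul _ _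
        _ ≤ 1 * G := mul_le_mul h2 h3 (abs_nonneg _) zero_le_one
        _ = G := one_mul G
    have hsum : K * ∑ j, (Q * y j - X j) * w j ≤ 3 * G := by
      rw [Finset.mul_sum]
      refine (Finset.sum_le_sum fun j _ => hterm j).trans ?_
      simp
    nlinarith

end PortalGame

end

/-! ## Reading the level -/

noncomputable section

namespace PortalGame

open scoped Classical
open Ram

/-- The content of a memory cell, or zero if it is too large to belong to the level. -/
def Base.rd (b : Base) (a : ℤ) : ℤ := if |b.mem a| ≤ b.size then b.mem a else 0

/-- The two tests say that the content is at most the size and at least its negative. The filter is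
there because the memory is arbitrary outside the encoding, whereas `Dfn` requires a polynomial
bound. -/
def rdTm (t : Tm) : Tm :=
  .ite (.sub (.add .size (.lit 1)) (.mem t))
    (.ite (.sub (.add (.mem t) .size) (.lit (-1))) (.mem t) (.lit 0)) (.lit 0)

theorem rdTm_value {Γ : Type} [Ctx Γ] {γ : Γ} {E : Env} (h : Rep γ E) (t : Tm) :
    (rdTm t).value E = (Ctx.base γ).rd (t.value E) := by
  have hs := h.size
  simp only [sz] at hs
  simp only [rdTm, Tm.value, h.mem, hs, Base.rd, abs_le]
  split_ifs <;> first | rfl | omega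

/-- The encoding of the level contains the list from position `a` on. -/
def Base.At (b : Base) (a : ℤ) (l : List ℤ) : Prop :=
  ∃ l₁ l₂, b.lvl.encode = l₁ ++ l ++ l₂ ∧ a = l₁.length

theorem Base.At.rd {b : Base} {a : ℤ} {l : List ℤ} (h : b.At a l) {i : ℕ} (hi : i < l.length) :
    b.rd (a + i) = l[i] := by
  obtain ⟨l₁, l₂, h, rfl⟩ := h
  have h1 : l₁.length + i < b.lvl.encode.length := by
    rw [h]
    simp only [List.length_append]
    omega
  have h2 := b.mem_eq _ h1
  have h3 : b.lvl.encode[l₁.length + i] = l[i] := by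
    simp only [h]
    rw [List.getElem_append_left (by simp only [List.length_append]; omega),
      List.getElem_append_right (by omega)]
    simp
  rw [h3] at h2
  push_cast at h2
  rw [Base.rd, h2, if_pos]
  have : l[i] ∈ b.lvl.encode := by
    rw [h]
    simp
  have := natAbs_lt_unarySize this
  rw [Int.abs_eq_natAbs, Base.size_eq]
  exact_mod_cast this.le

theorem Base.At.le_size {b : Base} {a : ℤ} {l : List ℤ} (h : b.At a l) :
    0 ≤ a ∧ a + l.length ≤ b.size := by
  obtain ⟨l₁, l₂, h, rfl⟩ := h
  have := length_le_unarySize b.lvl.encode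
  rw [h] at this
  simp only [List.length_append] at this
  refine ⟨by omega, ?_⟩
  rw [Base.size_eq, h]
  omega

theorem Base.At.left {b : Base} {a : ℤ} {l l' : List ℤ} (h : b.At a (l ++ l')) : b.At a l := by
  obtain ⟨l₁, l₂, h, rfl⟩ := h
  exact ⟨l₁, l' ++ l₂, by simpa using h, rfl⟩

theorem Base.At.right {b : Base} {a : ℤ} {l l' : List ℤ} (h : b.At a (l ++ l')) :
    b.At (a + l.length) l' := by
  obtain ⟨l₁, l₂, h, rfl⟩ := h
  exact ⟨l₁ ++ l, l₂, by simpa using h, by simp⟩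

/-- The address of the next block of numbers, if blocks consist of `e` numbers and a polygon. -/
def Base.next (b : Base) (e : ℕ) (a : ℤ) : ℤ := a + (e + 1) + 3 * b.rd (a + e)

/-- Blocks differ in length, but each contains the number of its corners; the block with number `i`
is found by skipping `i` blocks. -/
theorem Base.At.iterate_next {α : Type} {f : α → List ℤ} {b : Base} {e : ℕ}
    (hf : ∀ x a, b.At a (f x) → b.next e a = a + (f x).length) {xs : List α} :
    ∀ {a : ℤ}, b.At a (xs.flatMap f) → ∀ i ≤ xs.length,
      (b.next e)^[i] a = a + ((xs.take i).flatMap f).length ∧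
        (∀ h : i < xs.length, b.At ((b.next e)^[i] a) (f xs[i])) := by
  induction xs with
  | nil =>
    intro a ha i hi
    obtain rfl : i = 0 := by simpa using hi
    simp
  | cons x xs ih =>
    intro a ha i hi
    rw [List.flatMap_cons] at ha
    cases i with
    | zero => exact ⟨by simp, fun _ => ha.left⟩
    | succ i =>
      obtain ⟨h1, h2⟩ := ih ha.right i (by simpa using hi)
      rw [Function.iterate_succ_apply, hf x a ha.left]
      refine ⟨?_, fun h => h2 (by simpa using h)⟩
      rw [h1]
      simp only [List.take_succ_cons, List.flatMap_cons, List.length_append]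
      push_cast
      ring

theorem length_flatMap_encodeVec (l : List Vec) : (l.flatMap encodeVec).length = 3 * l.length := by
  induction l with
  | nil => rfl
  | cons v l ih => rw [List.flatMap_cons, List.length_append, ih]; simp [encodeVec]; ring

theorem getElem_flatMap_encodeVec (l : List Vec) (i : ℕ) (hi : i < l.length) (j : Fin 3)
    (h : 3 * i + j.val < (l.flatMap encodeVec).length) :
    (l.flatMap encodeVec)[3 * i + j.val] = l[i] j := by
  induction l generalizing i with
  | nil => simp at hi
  | cons v l ih =>
    cases i with
    | zero =>
      simp only [List.flatMap_cons, Nat.mul_zero, Nat.zero_add, List.getElem_cons_zero]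
      rw [List.getElem_append_left (by simp [encodeVec])]
      fin_cases j <;> rfl
    | succ i =>
      simp only [List.flatMap_cons, List.getElem_cons_succ]
      rw [List.getElem_append_right (by simp [encodeVec]; omega)]
      rw [← ih i (by simpa using hi)
        (by rw [length_flatMap_encodeVec]; simp at hi; omega)]
      congr 1
      simp [encodeVec]
      omega

/-- The polygon is stored from address `a` on. -/
def Base.PolyAt (b : Base) (a : ℤ) (P : Polygon) : Prop :=
  b.rd a = P.corners.length ∧
    ∀ i < P.corners.length, ∀ j : Fin 3, b.rd (a + 1 + 3 * i + j.val) = P.corner i j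

theorem Base.At.polyAt {b : Base} {a : ℤ} {P : Polygon} (h : b.At a P.encode) : b.PolyAt a P := by
  constructor
  · have := h.rd (i := 0) (by simp [Polygon.encode])
    simpa [Polygon.encode] using this
  · intro i hi j
    have h' : b.At a ([(P.corners.length : ℤ)] ++ P.corners.flatMap encodeVec) := h
    have hlt : 3 * i + j.val < (P.corners.flatMap encodeVec).length := by
      rw [length_flatMap_encodeVec]
      omega
    have := h'.right.rd hlt
    rw [getElem_flatMap_encodeVec _ _ hi] at this
    rw [Polygon.corner, List.getD_eq_getElem _ _ hi, ← this]
    congr 1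
    push_cast
    simp only [List.length_singleton]
    push_cast
    ring

theorem Base.next_surface {b : Base} (s : Surface) (a : ℤ) (h : b.At a s.encode) :
    b.next 1 a = a + s.encode.length := by
  have h' : b.At a ([if s.portalable then 1 else 0] ++ s.shape.encode) := h
  have := h'.right.polyAt.1
  simp only [List.length_singleton] at this
  rw [Base.next, this]
  simp only [Surface.encode, Polygon.encode, List.length_cons, length_flatMap_encodeVec]
  push_cast
  ring

theorem Base.next_grill {b : Base} (P : Polygon) (a : ℤ) (h : b.At a P.encode) :
    b.next 0 a = a + P.encode.length := by
  have := h.polyAt.1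
  rw [Base.next, Nat.cast_zero, add_zero, this]
  simp only [Polygon.encode, List.length_cons, length_flatMap_encodeVec]
  push_cast
  ring

def Level.header (L : Level) : List ℤ :=
  [(L.range : ℤ)] ++ L.physics.encode ++ encodeVec L.start ++ encodeVec L.goal ++
    [(L.surfaces.length : ℤ)]

theorem Base.at_header (b : Base) : b.At 0 b.lvl.header :=
  ⟨[], b.lvl.surfaces.flatMap Surface.encode ++
    ([(b.lvl.grills.length : ℤ)] ++ b.lvl.grills.flatMap Polygon.encode), by
      rw [Level.encode, Level.header]
      simp only [List.append_assoc, List.nil_append], rfl⟩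

/-- The header consists of `1 + 11 + 3 + 3 + 1 = 19` numbers: range, constants, start, goal and the
number of surfaces. -/
theorem Base.at_surfaces (b : Base) : b.At 19 (b.lvl.surfaces.flatMap Surface.encode) :=
  ⟨b.lvl.header, _, by
    rw [Level.encode, Level.header, List.append_assoc (_ ++ _) _ _], rfl⟩

theorem Base.at_grills (b : Base) :
    b.At ((b.next 1)^[b.lvl.surfaces.length] 19)
      ([(b.lvl.grills.length : ℤ)] ++ b.lvl.grills.flatMap Polygon.encode) := by
  have h : b.At (19 + ((b.lvl.surfaces.flatMap Surface.encode).length : ℤ))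
      ([(b.lvl.grills.length : ℤ)] ++ b.lvl.grills.flatMap Polygon.encode) :=
    ⟨b.lvl.header ++ b.lvl.surfaces.flatMap Surface.encode, [], by
      rw [Level.encode, Level.header]
      simp only [List.append_assoc, List.append_nil], by
      rw [List.length_append]
      rfl⟩
  rwa [(b.at_surfaces.iterate_next Base.next_surface _ le_rfl).1, List.take_length]

section

variable {Γ : Type} [Ctx Γ]

instance Dfn.rd {a : Γ → ℤ} [ha : Dfn a] : Dfn fun γ => (Ctx.base γ).rd (a γ) := by
  obtain ⟨⟨t, ht⟩, -⟩ := ha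
  refine ⟨⟨rdTm t, fun γ E h => by rw [rdTm_value h, ht γ E h]⟩, 1, fun γ => ?_⟩
  rw [Base.rd, pow_one]
  split_ifs with h
  · exact h
  · simp

theorem Dfn.iterate_next {a : Γ → ℤ} {n : Γ → ℕ} {e : ℕ} [Dfn a] [Dfn fun γ => (n γ : ℤ)]
    (hb : ∀ γ, ∀ i ≤ n γ, |((Ctx.base γ).next e)^[i] (a γ)| ≤ sz γ) :
    Dfn fun γ => ((Ctx.base γ).next e)^[n γ] (a γ) := by
  refine Dfn.iterate (g := fun γ => (Ctx.base γ).next e) 1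
    ⟨.add (.add (.var (Ctx.depth Γ)) (.lit (e + 1)))
      (.mul (.lit 3) (rdTm (.add (.var (Ctx.depth Γ)) (.lit e)))), Ctx.depth Γ, le_rfl,
      fun γ E h => ?_⟩ (by simpa using hb)
  simp only [Tm.value, rdTm_value h, Base.next]

theorem Dfn.header {f : Level → ℤ} (i : ℕ)
    (h : ∀ L : Level, L.header[i]? = some (f L)) :
    Dfn fun γ : Γ => f (lv γ) :=
  (show Dfn fun γ : Γ => (Ctx.base γ).rd (i : ℤ) from inferInstance).congr fun γ => by
    obtain ⟨h1, h2⟩ := List.getElem?_eq_some_iff.1 (h (lv γ))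
    rw [← h2, ← (Base.at_header (Ctx.base γ)).rd h1, zero_add]

instance : Dfn fun γ : Γ => ((lv γ).range : ℤ) := Dfn.header 0 fun _ => rfl

instance : Dfn fun γ : Γ => ((lv γ).physics.radius : ℤ) := Dfn.header 1 fun _ => rfl

instance : Dfn fun γ : Γ => ((lv γ).physics.height : ℤ) := Dfn.header 2 fun _ => rfl

instance : Dfn fun γ : Γ => ((lv γ).physics.crouchHeight : ℤ) := Dfn.header 3 fun _ => rfl

instance : Dfn fun γ : Γ => ((lv γ).physics.eyeHeight : ℤ) := Dfn.header 4 fun _ => rfl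

instance : Dfn fun γ : Γ => ((lv γ).physics.crouchEyeHeight : ℤ) := Dfn.header 5 fun _ => rfl

instance : Dfn fun γ : Γ => ((lv γ).physics.gravity : ℤ) := Dfn.header 6 fun _ => rfl

instance : Dfn fun γ : Γ => ((lv γ).physics.jumpSpeed : ℤ) := Dfn.header 7 fun _ => rfl

instance : Dfn fun γ : Γ => ((lv γ).physics.walkSpeed : ℤ) := Dfn.header 8 fun _ => rfl

instance : Dfn fun γ : Γ => ((lv γ).physics.airSpeed : ℤ) := Dfn.header 9 fun _ => rfl

instance : Dfn fun γ : Γ => ((lv γ).physics.stepHeight : ℤ) := Dfn.header 10 fun _ => rfl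

instance : Dfn fun γ : Γ => ((lv γ).physics.portalRadius : ℤ) := Dfn.header 11 fun _ => rfl

instance : DfnV fun γ : Γ => (lv γ).start :=
  DfnV.mk' (Dfn.header 12 fun _ => rfl) (Dfn.header 13 fun _ => rfl) (Dfn.header 14 fun _ => rfl)

instance : DfnV fun γ : Γ => (lv γ).goal :=
  DfnV.mk' (Dfn.header 15 fun _ => rfl) (Dfn.header 16 fun _ => rfl) (Dfn.header 17 fun _ => rfl)

instance : Dfn fun γ : Γ => ((lv γ).surfaces.length : ℤ) := Dfn.header 18 fun _ => rfl

/-! ### Definable polygons -/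

/-- The polygon that takes the place of a missing one. -/
def trivialPolygon : Polygon := ⟨![0, 0, 0], ![1, 0, 0], ![0, 1, 0], []⟩

/-- Outside the list the value is a valid surface that is not portalable, so that validity of the
polygon, and with it a nonzero normal, holds for every index. -/
def Level.surfAt (L : Level) (i : ℕ) : Surface := L.surfaces.getD i ⟨trivialPolygon, false⟩

def Level.grillAt (L : Level) (i : ℕ) : Polygon := L.grills.getD i trivialPolygon

/-- The polygon is stored at a definable address or is missing. -/
class DfnPoly (P : Γ → Polygon) : Prop where
  rep : ∃ (a : Γ → ℤ) (p : Γ → Prop), Dfn a ∧ DfnP p ∧ ∀ γ,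
    (p γ → (Ctx.base γ).PolyAt (a γ) (P γ)) ∧ (¬ p γ → P γ = trivialPolygon)
  valid : ∀ γ, (P γ).Valid
  bound : ∀ γ, ∀ v ∈ (P γ).corners, ∀ j, |v j| ≤ sz γ

theorem trivialPolygon_valid : trivialPolygon.Valid := by
  constructor
  · intro h
    have := congrFun h 2
    simp [Polygon.normal, trivialPolygon, cross_apply] at this
  · intro v hv
    simp only [trivialPolygon, Polygon.corners, List.mem_cons, List.not_mem_nil, or_false] at hv
    rcases hv with rfl | rfl | rfl <;>
      simp [Polygon.normal, trivialPolygon, cross_apply, dotProduct, Fin.sum_univ_three]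

theorem trivialPolygon_bound {v : Vec} (hv : v ∈ trivialPolygon.corners) (j : Fin 3) :
    |v j| ≤ 1 := by
  simp only [trivialPolygon, Polygon.corners, List.mem_cons, List.not_mem_nil, or_false] at hv
  rcases hv with rfl | rfl | rfl <;> fin_cases j <;> simp

theorem Base.mem_encode_le (b : Base) {z : ℤ} (h : z ∈ b.lvl.encode) : |z| ≤ b.size := by
  have := natAbs_lt_unarySize h
  rw [Int.abs_eq_natAbs, Base.size_eq]
  exact_mod_cast this.le

theorem Base.range_le (b : Base) : (b.lvl.range : ℤ) ≤ b.size := by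
  have := b.mem_encode_le (z := b.lvl.range) (by simp [Level.encode])
  rwa [Nat.abs_cast] at this

theorem polygon_props (b : Base) {P : Polygon} (h : P ∈ b.lvl.polygons) :
    P.Valid ∧ ∀ v ∈ P.corners, ∀ j, |v j| ≤ b.size :=
  ⟨(b.wf.1 P h).1, fun v hv j => ((b.wf.1 P h).2 v hv j).trans b.range_le⟩

theorem surfAt_props (b : Base) (i : ℕ) : (b.lvl.surfAt i).shape.Valid ∧
    ∀ v ∈ (b.lvl.surfAt i).shape.corners, ∀ j, |v j| ≤ b.size := by
  by_cases h : i < b.lvl.surfaces.length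
  · rw [Level.surfAt, List.getD_eq_getElem _ _ h]
    exact polygon_props b (List.mem_append_left _ (List.mem_map_of_mem (List.getElem_mem h)))
  · rw [Level.surfAt, List.getD_eq_default _ _ (by omega)]
    refine ⟨trivialPolygon_valid, fun v hv j => (trivialPolygon_bound hv j).trans ?_⟩
    have := two_le_sz b
    change 2 ≤ b.size at this
    omega

theorem grillAt_props (b : Base) (i : ℕ) : (b.lvl.grillAt i).Valid ∧
    ∀ v ∈ (b.lvl.grillAt i).corners, ∀ j, |v j| ≤ b.size := by
  by_cases h : i < b.lvl.grills.length
  · rw [Level.grillAt, List.getD_eq_getElem _ _ h]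
    exact polygon_props b (List.mem_append_right _ (List.getElem_mem h))
  · rw [Level.grillAt, List.getD_eq_default _ _ (by omega)]
    refine ⟨trivialPolygon_valid, fun v hv j => (trivialPolygon_bound hv j).trans ?_⟩
    have := two_le_sz b
    change 2 ≤ b.size at this
    omega

theorem ite_lt_le (i n : ℕ) : (if i < n then i else n) ≤ n := by
  split_ifs <;> omega

theorem Base.At.abs_iterate_next_le {α : Type} {f : α → List ℤ} {b : Base} {e : ℕ}
    (hf : ∀ x a, b.At a (f x) → b.next e a = a + (f x).length) {xs : List α} {a : ℤ}
    (h : b.At a (xs.flatMap f)) {i : ℕ} (hi : i ≤ xs.length) :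
    |(b.next e)^[i] a| ≤ b.size := by
  have h1 := (h.iterate_next hf i hi).1
  have h2 : ((xs.take i).flatMap f).length ≤ (xs.flatMap f).length := by
    conv_rhs => rw [← List.take_append_drop i xs, List.flatMap_append, List.length_append]
    omega
  have h3 := h.le_size
  rw [h1, abs_le]
  constructor <;> omega

/-- The index is cut off at the number of surfaces, so that no iterate leaves the encoding and all
of them are bounded by the size. -/
instance Dfn.surfAddr {i : Γ → ℕ} [Dfn fun γ => (i γ : ℤ)] : Dfn fun γ =>
    ((Ctx.base γ).next 1)^[if i γ < (lv γ).surfaces.length then i γ else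
      (lv γ).surfaces.length] 19 :=
  Dfn.iterate_next fun _ _ hj => (Base.at_surfaces _).abs_iterate_next_le Base.next_surface <|
    hj.trans (ite_lt_le _ _)

theorem Dfn.grillsAddr : Dfn fun γ : Γ =>
    ((Ctx.base γ).next 1)^[(lv γ).surfaces.length] 19 :=
  Dfn.iterate_next fun _ _ hj => (Base.at_surfaces _).abs_iterate_next_le Base.next_surface hj

instance Dfn.grills_length : Dfn fun γ : Γ => ((lv γ).grills.length : ℤ) :=
  haveI := Dfn.grillsAddr (Γ := Γ)
  (show Dfn fun γ : Γ => (Ctx.base γ).rd (((Ctx.base γ).next 1)^[(lv γ).surfaces.length] 19) from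
    inferInstance).congr fun γ => by
      have := (Ctx.base γ).at_grills.rd (i := 0) (by simp)
      simpa using this.symm

theorem Dfn.grillAddr {i : Γ → ℕ} [Dfn fun γ => (i γ : ℤ)] : Dfn fun γ =>
    ((Ctx.base γ).next 0)^[if i γ < (lv γ).grills.length then i γ else
      (lv γ).grills.length] (((Ctx.base γ).next 1)^[(lv γ).surfaces.length] 19 + 1) :=
  haveI := Dfn.grillsAddr (Γ := Γ)
  Dfn.iterate_next fun _ _ hj =>
    (Base.at_grills _).right.abs_iterate_next_le Base.next_grill <|
      hj.trans (ite_lt_le _ _)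

instance DfnPoly.surf {i : Γ → ℕ} [Dfn fun γ => (i γ : ℤ)] :
    DfnPoly fun γ => ((lv γ).surfAt (i γ)).shape where
  rep := by
    refine ⟨fun γ => ((Ctx.base γ).next 1)^[if i γ < (lv γ).surfaces.length then i γ else
      (lv γ).surfaces.length] 19 + 1, fun γ => i γ < (lv γ).surfaces.length, inferInstance,
      inferInstance, fun γ => ⟨fun h => ?_, fun h => ?_⟩⟩
    · dsimp only at h ⊢
      rw [if_pos h, Level.surfAt, List.getD_eq_getElem _ _ h]
      have h1 := ((Ctx.base γ).at_surfaces.iterate_next Base.next_surface (i γ) h.le).2 h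
      have h2 : (Ctx.base γ).At _ ([if (lv γ).surfaces[i γ].portalable then 1 else 0] ++
        (lv γ).surfaces[i γ].shape.encode) := h1
      exact h2.right.polyAt
    · rw [Level.surfAt, List.getD_eq_default _ _ (by omega)]
  valid γ := (surfAt_props (Ctx.base γ) _).1
  bound γ := (surfAt_props (Ctx.base γ) _).2

instance DfnP.portalable {i : Γ → ℕ} [Dfn fun γ => (i γ : ℤ)] :
    DfnP fun γ => ((lv γ).surfAt (i γ)).portalable = true :=
  (show DfnP fun γ => i γ < (lv γ).surfaces.length ∧ 0 < (Ctx.base γ).rd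
    (((Ctx.base γ).next 1)^[if i γ < (lv γ).surfaces.length then i γ else
      (lv γ).surfaces.length] 19) from inferInstance).congr fun γ => by
    by_cases h : i γ < (lv γ).surfaces.length
    · rw [if_pos h, Level.surfAt, List.getD_eq_getElem _ _ h]
      have h1 := ((Ctx.base γ).at_surfaces.iterate_next Base.next_surface (i γ) h.le).2 h
      have h2 := h1.rd (i := 0) (by simp [Surface.encode])
      simp only [Nat.cast_zero, add_zero, Surface.encode, List.getElem_cons_zero] at h2
      rw [h2]
      split_ifs with h3 <;> simp [h3, h]
    · rw [Level.surfAt, List.getD_eq_default _ _ (by omega)]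
      simp [h]

instance DfnPoly.grill {i : Γ → ℕ} [Dfn fun γ => (i γ : ℤ)] :
    DfnPoly fun γ => (lv γ).grillAt (i γ) where
  rep := by
    have := Dfn.grillAddr (i := i)
    refine ⟨_, fun γ => i γ < (lv γ).grills.length, this,
      inferInstance, fun γ => ⟨fun h => ?_, fun h => ?_⟩⟩
    · rw [if_pos h, Level.grillAt, List.getD_eq_getElem _ _ h]
      exact (((Ctx.base γ).at_grills.right.iterate_next Base.next_grill (i γ) h.le).2 h).polyAt
    · rw [Level.grillAt, List.getD_eq_default _ _ (by omega)]
  valid γ := (grillAt_props (Ctx.base γ) _).1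
  bound γ := (grillAt_props (Ctx.base γ) _).2

instance DfnPoly.wk {P : Γ → Polygon} [hP : DfnPoly P] {k : ℕ} :
    DfnPoly fun x : Ext k Γ => P x.c where
  rep := by
    obtain ⟨a, p, ha, hp, h⟩ := hP.rep
    exact ⟨fun x => a x.c, fun x => p x.c, inferInstance, inferInstance, fun x => h x.c⟩
  valid x := hP.valid x.c
  bound x := hP.bound x.c

instance DfnPoly.wk2 {P : Γ → Polygon} [hP : DfnPoly P] {k l : ℕ} :
    DfnPoly fun x : Ext l (Ext k Γ) => P x.c.c :=
  DfnPoly.wk (P := fun y : Ext k Γ => P y.c)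

instance Dfn.corners_length {P : Γ → Polygon} [hP : DfnPoly P] :
    Dfn fun γ => ((P γ).corners.length : ℤ) := by
  obtain ⟨a, p, ha, hp, h⟩ := hP.rep
  refine (show Dfn fun γ => if p γ then (Ctx.base γ).rd (a γ) else 3 from inferInstance).congr
    fun γ => ?_
  split_ifs with hpγ
  · rw [((h γ).1 hpγ).1]
  · rw [(h γ).2 hpγ]
    rfl

theorem corner_of_length_le {P : Polygon} {i : ℕ} (h : P.corners.length ≤ i) : P.corner i = 0 := by
  rw [Polygon.corner, List.getD_eq_default _ _ h]

instance DfnV.corner {P : Γ → Polygon} {i : Γ → ℕ} [hP : DfnPoly P] [Dfn fun γ => (i γ : ℤ)] :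
    DfnV fun γ => (P γ).corner (i γ) := by
  obtain ⟨a, p, ha, hp, h⟩ := hP.rep
  refine ⟨fun j => (show Dfn fun γ => if p γ then if i γ < (P γ).corners.length then
    (Ctx.base γ).rd (a γ + 1 + 3 * (i γ : ℤ) + (j.val : ℤ)) else 0
    else if i γ = 0 then trivialPolygon.corner 0 j else if i γ = 1 then trivialPolygon.corner 1 j
      else if i γ = 2 then trivialPolygon.corner 2 j else 0
    from inferInstance).congr fun γ => ?_⟩
  split_ifs with h1 h2 h3 h4 h5
  · rw [((h γ).1 h1).2 _ h2]
  · rw [corner_of_length_le (by omega)]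
    rfl
  · rw [(h γ).2 h1, h3]
  · rw [(h γ).2 h1, h4]
  · rw [(h γ).2 h1, h5]
  · rw [(h γ).2 h1, corner_of_length_le (by simp [trivialPolygon, Polygon.corners]; omega)]
    rfl

instance DfnV.poly_a {P : Γ → Polygon} [hP : DfnPoly P] : DfnV fun γ => (P γ).a :=
  inferInstanceAs (DfnV fun γ => (P γ).corner 0)

instance DfnV.poly_b {P : Γ → Polygon} [hP : DfnPoly P] : DfnV fun γ => (P γ).b :=
  inferInstanceAs (DfnV fun γ => (P γ).corner 1)

instance DfnV.poly_c {P : Γ → Polygon} [hP : DfnPoly P] : DfnV fun γ => (P γ).c :=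
  inferInstanceAs (DfnV fun γ => (P γ).corner 2)

instance DfnV.normal {P : Γ → Polygon} [hP : DfnPoly P] : DfnV fun γ => (P γ).normal :=
  inferInstanceAs (DfnV fun γ => ((P γ).b - (P γ).a) ⨯₃ ((P γ).c - (P γ).a))

end

end PortalGame

end

/-! ## Definability of contact -/

noncomputable section

namespace PortalGame

open scoped Classical
open Ram

section

variable {Γ : Type} [Ctx Γ]

theorem Dfn.exists_bound {f : Γ → ℤ} (hf : Dfn f) : ∃ c, ∀ γ, ∀ d ≥ c, |f γ| ≤ (sz γ : ℤ) ^ d := by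
  obtain ⟨-, c, hc⟩ := hf
  exact ⟨c, fun γ d hd => (hc γ).trans (sz_pow_mono γ hd)⟩

theorem DfnV.exists_bound {v : Γ → Vec} (hv : DfnV v) :
    ∃ c, ∀ γ, ∀ d ≥ c, ∀ j, |v γ j| ≤ (sz γ : ℤ) ^ d := by
  choose c hc using fun j => (hv.comp j).exists_bound
  refine ⟨c 0 + c 1 + c 2, fun γ d hd j => hc j γ d ?_⟩
  fin_cases j <;> simp <;> omega

/-- There are `n` corners with positive weights that, added to the combination `v` of weight `s`,
give a point in the box. -/
def CombSearch (W : ℕ) (m : ℤ) (lo hi : Vec) (P : Polygon) : ℕ → ℤ → Vec → Prop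
  | 0, s, v => ∀ j, lo j * s < m * v j ∧ m * v j < hi j * s
  | n + 1, s, v => ∃ i, i < P.corners.length ∧ ∃ l, l < W ∧ (0 < l ∧
      CombSearch W m lo hi P n (s + (l : ℤ)) (v + (l : ℤ) • P.corner i))

theorem meetsComb_iff (W : ℕ) (m : ℤ) (lo hi : Vec) (P : Polygon) :
    MeetsComb W m lo hi P ↔ CombSearch W m lo hi P 4 0 0 := by
  simp only [CombSearch]
  constructor
  · rintro ⟨i, l, h1, h2, h3⟩
    refine ⟨_, h1 0, _, (h2 0).2, (h2 0).1, _, h1 1, _, (h2 1).2, (h2 1).1, _, h1 2, _, (h2 2).2,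
      (h2 2).1, _, h1 3, _, (h2 3).2, (h2 3).1, fun j => ?_⟩
    simpa [Fin.sum_univ_four] using h3 j
  · rintro ⟨i₀, a₀, l₀, b₀, c₀, i₁, a₁, l₁, b₁, c₁, i₂, a₂, l₂, b₂, c₂, i₃, a₃, l₃, b₃, c₃, h⟩
    refine ⟨![i₀, i₁, i₂, i₃], ![l₀, l₁, l₂, l₃], fun t => ?_, fun t => ?_, fun j => ?_⟩
    · fin_cases t <;> assumption
    · fin_cases t
      exacts [⟨c₀, b₀⟩, ⟨c₁, b₁⟩, ⟨c₂, b₂⟩, ⟨c₃, b₃⟩]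
    · simpa [Fin.sum_univ_four] using h j

theorem forall_fin_three {p : Fin 3 → Prop} : (∀ j, p j) ↔ p 0 ∧ p 1 ∧ p 2 :=
  ⟨fun h => ⟨h 0, h 1, h 2⟩, fun ⟨h0, h1, h2⟩ j => by fin_cases j <;> assumption⟩

instance DfnP.forall_fin {p : Γ → Fin 3 → Prop} [h : ∀ j, DfnP fun γ => p γ j] :
    DfnP fun γ => ∀ j, p γ j := by
  have := h 0
  have := h 1
  have := h 2
  exact (show DfnP fun γ => p γ 0 ∧ p γ 1 ∧ p γ 2 from inferInstance).congr
    fun γ => forall_fin_three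

/-- The induction runs over all contexts at once, because each corner adds two variables, its index
and its weight. -/
theorem DfnP.combSearch (n : ℕ) : ∀ {Δ : Type} [Ctx Δ] {W : Δ → ℕ} {m s : Δ → ℤ}
    {lo hi v : Δ → Vec} {P : Δ → Polygon} [Dfn fun γ => (W γ : ℤ)] [Dfn m] [Dfn s] [DfnV lo]
    [DfnV hi] [DfnV v] [DfnPoly P],
    DfnP fun γ => CombSearch (W γ) (m γ) (lo γ) (hi γ) (P γ) n (s γ) (v γ) := by
  induction n with
  | zero =>
    intros
    unfold CombSearch
    infer_instance
  | succ n ih =>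
    intro Δ _ W m s lo hi v P _ _ _ _ _ _ _
    unfold CombSearch
    have : ∀ k l, DfnP fun x : Ext l (Ext k Δ) => CombSearch (W x.c.c) (m x.c.c) (lo x.c.c)
        (hi x.c.c) (P x.c.c) n (s x.c.c + (x.i : ℤ)) (v x.c.c + (x.i : ℤ) • (P x.c.c).corner x.c.i) :=
      fun k l => ih
    infer_instance

instance DfnP.meets {m : Γ → ℤ} {lo hi : Γ → Vec} {P : Γ → Polygon}
    [hm : Dfn m] [hlo : DfnV lo] [hhi : DfnV hi] [hP : DfnPoly P] :
    DfnP fun γ => Meets (m γ) (lo γ) (hi γ) (P γ) := by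
  obtain ⟨b, hb⟩ := exists_meets_iff
  obtain ⟨c₁, h₁⟩ := hm.exists_bound
  obtain ⟨c₂, h₂⟩ := hlo.exists_bound
  obtain ⟨c₃, h₃⟩ := hhi.exists_bound
  set d := c₁ + 1 + c₂ + c₃ with hd
  have : DfnP fun γ => CombSearch ((sz γ ^ d) ^ b) (m γ) (lo γ) (hi γ) (P γ) 4 0 0 :=
    DfnP.combSearch 4
  refine this.congr fun γ => ?_
  rw [← meetsComb_iff]
  refine hb (sz γ ^ d) _ _ _ _ ?_ (fun v hv j => ?_) (fun j => ?_) fun j => ?_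
  · exact (two_le_sz γ).trans (Nat.le_self_pow (by omega) _)
  · rw [abs_mul]
    push_cast
    calc |m γ| * |v j| ≤ (sz γ : ℤ) ^ c₁ * sz γ :=
          mul_le_mul (h₁ γ _ le_rfl) (hP.bound γ v hv j) (abs_nonneg _) (by positivity)
      _ = (sz γ : ℤ) ^ (c₁ + 1) := (pow_succ _ _).symm
      _ ≤ _ := sz_pow_mono γ (by omega)
  · push_cast
    exact h₂ γ _ (by omega) j
  · push_cast
    exact h₃ γ _ (by omega) j

/-- The sign of the denominator is part of the predicate: the criterion applies only to positive
denominators, and the predicate has to be decided everywhere. -/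
theorem DfnP.mem_region {X : Γ → Vec} {Q : Γ → ℤ} {P : Γ → Polygon} [hX : DfnV X] [hQ : Dfn Q]
    [hP : DfnPoly P] : DfnP fun γ => 0 < Q γ ∧ (fun j => (X γ j : ℝ) / Q γ) ∈ (P γ).region := by
  obtain ⟨b, hb⟩ := exists_mem_region_iff
  obtain ⟨c₁, h₁⟩ := hQ.exists_bound
  obtain ⟨c₂, h₂⟩ := hX.exists_bound
  set d := c₁ + 1 + c₂ with hd
  have e1 : DfnV fun γ => (fun j => ((sz γ : ℤ) ^ d) ^ b * X γ j - 1 : Vec) :=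
    ⟨fun j => inferInstance⟩
  have e2 : DfnV fun γ => (fun j => ((sz γ : ℤ) ^ d) ^ b * X γ j + 1 : Vec) :=
    ⟨fun j => inferInstance⟩
  refine (show DfnP fun γ => 0 < Q γ ∧ Meets (((sz γ : ℤ) ^ d) ^ b * Q γ)
    (fun j => ((sz γ : ℤ) ^ d) ^ b * X γ j - 1) (fun j => ((sz γ : ℤ) ^ d) ^ b * X γ j + 1) (P γ)
      from inferInstance).congr fun γ => and_congr_right fun hpos => ?_
  have := hb (sz γ ^ d) (Q γ) (X γ) (P γ) ?_ hpos (fun v hv j => ?_) (fun j => ?_)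
  · push_cast at this
    exact this
  · exact (two_le_sz γ).trans (Nat.le_self_pow (by omega) _)
  · rw [abs_mul]
    push_cast
    calc |Q γ| * |v j| ≤ (sz γ : ℤ) ^ c₁ * sz γ :=
          mul_le_mul (h₁ γ _ le_rfl) (hP.bound γ v hv j) (abs_nonneg _) (by positivity)
      _ = (sz γ : ℤ) ^ (c₁ + 1) := (pow_succ _ _).symm
      _ ≤ _ := sz_pow_mono γ (by omega)
  · push_cast
    exact h₂ γ _ (by omega) j

/-! ### The body of the avatar -/

/-- The corners of the body with the least and the greatest coordinates. -/
def bodyLo (F : Physics) (p : Vec) : Vec := ![p 0 - F.radius, p 1 - F.radius, p 2]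

def bodyHi (F : Physics) (cr : Bool) (p : Vec) : Vec :=
  ![p 0 + F.radius, p 1 + F.radius, p 2 + F.bodyHeight cr]

theorem mem_body_iff {F : Physics} {cr : Bool} {p : Vec} {x : Point} :
    x ∈ F.body cr p ↔ ∀ j, (bodyLo F p j : ℝ) < x j ∧ x j < bodyHi F cr p j := by
  rw [forall_fin_three]
  simp only [Physics.body, Set.mem_ofPred_eq, abs_lt, bodyLo, bodyHi, Matrix.cons_val_zero,
    Matrix.cons_val_one, Matrix.cons_val]
  push_cast
  constructor
  · rintro ⟨⟨h1, h2⟩, ⟨h3, h4⟩, h5, h6⟩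
    refine ⟨⟨?_, ?_⟩, ⟨?_, ?_⟩, ?_, ?_⟩ <;> linarith
  · rintro ⟨⟨h1, h2⟩, ⟨h3, h4⟩, h5, h6⟩
    refine ⟨⟨?_, ?_⟩, ⟨?_, ?_⟩, ?_, ?_⟩ <;> linarith

theorem body_inter_region_nonempty {F : Physics} {cr : Bool} {p : Vec} {P : Polygon} :
    (F.body cr p ∩ P.region).Nonempty ↔ Meets 1 (bodyLo F p) (bodyHi F cr p) P := by
  constructor
  · rintro ⟨x, h1, h2⟩
    exact ⟨x, h2, by simpa using mem_body_iff.1 h1⟩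
  · rintro ⟨x, h1, h2⟩
    exact ⟨x, mem_body_iff.2 (by simpa using h2), h1⟩

instance Dfn.bodyHeight {cr : Γ → Bool} [DfnP fun γ => cr γ = true] :
    Dfn fun γ => ((lv γ).physics.bodyHeight (cr γ) : ℤ) := by
  unfold Physics.bodyHeight
  infer_instance

instance DfnV.bodyLo {p : Γ → Vec} [DfnV p] : DfnV fun γ => bodyLo (lv γ).physics (p γ) := by
  unfold PortalGame.bodyLo
  infer_instance

instance DfnV.bodyHi {cr : Γ → Bool} {p : Γ → Vec} [DfnP fun γ => cr γ = true] [DfnV p] :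
    DfnV fun γ => bodyHi (lv γ).physics (cr γ) (p γ) := by
  unfold PortalGame.bodyHi
  infer_instance

theorem exists_surface_iff {L : Level} {q : Surface → Prop} :
    (∃ s ∈ L.surfaces, q s) ↔ ∃ i, i < L.surfaces.length ∧ q (L.surfAt i) := by
  constructor
  · rintro ⟨s, hs, h⟩
    obtain ⟨i, hi, rfl⟩ := List.mem_iff_getElem.1 hs
    exact ⟨i, hi, by rwa [Level.surfAt, List.getD_eq_getElem _ _ hi]⟩
  · rintro ⟨i, hi, h⟩
    rw [Level.surfAt, List.getD_eq_getElem _ _ hi] at h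
    exact ⟨_, List.getElem_mem hi, h⟩

theorem exists_grill_iff {L : Level} {q : Polygon → Prop} :
    (∃ s ∈ L.grills, q s) ↔ ∃ i, i < L.grills.length ∧ q (L.grillAt i) := by
  constructor
  · rintro ⟨s, hs, h⟩
    obtain ⟨i, hi, rfl⟩ := List.mem_iff_getElem.1 hs
    exact ⟨i, hi, by rwa [Level.grillAt, List.getD_eq_getElem _ _ hi]⟩
  · rintro ⟨i, hi, h⟩
    rw [Level.grillAt, List.getD_eq_getElem _ _ hi] at h
    exact ⟨_, List.getElem_mem hi, h⟩

instance DfnP.obstructed {cr : Γ → Bool} {p : Γ → Vec} [DfnP fun γ => cr γ = true] [DfnV p] :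
    DfnP fun γ => (lv γ).Obstructed (cr γ) (p γ) := by
  simp only [Level.Obstructed, exists_surface_iff, body_inter_region_nonempty]
  infer_instance

instance DfnP.inGrill {cr : Γ → Bool} {p : Γ → Vec} [DfnP fun γ => cr γ = true] [DfnV p] :
    DfnP fun γ => (lv γ).InGrill (cr γ) (p γ) := by
  simp only [Level.InGrill, exists_grill_iff, body_inter_region_nonempty]
  infer_instance

instance DfnP.coplanar {P Q : Γ → Polygon} [DfnPoly P] [DfnPoly Q] :
    DfnP fun γ => (P γ).Coplanar (Q γ) := by
  unfold Polygon.Coplanar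
  infer_instance

/-- The surface with number `i - 1` and the place of a portal. -/
def Level.placed (L : Level) (i : ℕ) (v : Vec) : Placed := ⟨L.surfAt (i - 1), v⟩

/-- The corners of the part of the body that is within reach of the centre of a portal. -/
def clipLo (F : Physics) (p v : Vec) : Vec := fun j => max (bodyLo F p j) (v j - F.portalRadius)

def clipHi (F : Physics) (cr : Bool) (p v : Vec) : Vec :=
  fun j => min (bodyHi F cr p j) (v j + F.portalRadius)

instance DfnV.clipLo {p v : Γ → Vec} [DfnV p] [DfnV v] :
    DfnV fun γ => clipLo (lv γ).physics (p γ) (v γ) :=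
  ⟨fun j => by unfold PortalGame.clipLo; infer_instance⟩

instance DfnV.clipHi {cr : Γ → Bool} {p v : Γ → Vec} [DfnP fun γ => cr γ = true] [DfnV p]
    [DfnV v] : DfnV fun γ => clipHi (lv γ).physics (cr γ) (p γ) (v γ) :=
  ⟨fun j => by unfold PortalGame.clipHi; infer_instance⟩

/-- The body and the reach of a portal are open boxes, and so is their intersection; contact with an
opening is again contact of a box with a polygon. -/
theorem body_inter_opening_nonempty {L : Level} {cr : Bool} {p : Vec} {i : ℕ} {v : Vec} :
    (L.physics.body cr p ∩ L.opening (L.placed i v)).Nonempty ↔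
      ∃ s, s < L.surfaces.length ∧ ((L.surfAt s).portalable = true ∧
        (L.surfAt (i - 1)).shape.Coplanar (L.surfAt s).shape ∧
        Meets 1 (clipLo L.physics p v) (clipHi L.physics cr p v)
          (L.surfAt s).shape) := by
  rw [← exists_surface_iff (q := fun s => s.portalable = true ∧
        (L.surfAt (i - 1)).shape.Coplanar s.shape ∧
        Meets 1 (clipLo L.physics p v) (clipHi L.physics cr p v) s.shape)]
  have hbox : ∀ x : Point, (∀ j, (clipLo L.physics p v j : ℝ) < (1 : ℤ) * x j ∧
      (1 : ℤ) * x j < clipHi L.physics cr p v j) ↔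
      x ∈ L.physics.body cr p ∧ ∀ j, |x j - v j| < L.physics.portalRadius := by
    intro x
    rw [mem_body_iff, ← forall_and]
    refine forall_congr' fun j => ?_
    simp only [clipLo, clipHi]
    push_cast
    rw [one_mul, max_lt_iff, lt_min_iff, abs_lt]
    constructor
    · rintro ⟨⟨h1, h2⟩, h3, h4⟩
      refine ⟨⟨h1, h3⟩, ?_, ?_⟩ <;> linarith
    · rintro ⟨⟨h1, h2⟩, h3, h4⟩
      refine ⟨⟨h1, ?_⟩, h2, ?_⟩ <;> linarith
  constructor
  · rintro ⟨x, h1, ⟨s, h2, h3, h4, h5⟩, h6⟩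
    exact ⟨s, h2, h3, h4, x, h5, (hbox x).2 ⟨h1, h6⟩⟩
  · rintro ⟨s, h2, h3, h4, x, h5, h6⟩
    obtain ⟨h1, h6⟩ := (hbox x).1 h6
    exact ⟨x, h1, ⟨s, h2, h3, h4, h5⟩, h6⟩

instance DfnP.opening {cr : Γ → Bool} {p v : Γ → Vec} {i : Γ → ℕ} [DfnP fun γ => cr γ = true]
    [DfnV p] [DfnV v] [Dfn fun γ => (i γ : ℤ)] : DfnP fun γ =>
      ((lv γ).physics.body (cr γ) (p γ) ∩ (lv γ).opening ((lv γ).placed (i γ) (v γ))).Nonempty := by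
  simp only [body_inter_opening_nonempty]
  infer_instance

end

end PortalGame

end

/-! ## Definability of shots and passages -/

noncomputable section

namespace PortalGame

open scoped Classical
open Ram

theorem find?_range {n : ℕ} {p : ℕ → Prop} [DecidablePred p] : (List.range n).find? (fun i => decide (p i)) =
    if firstIdx n p < n then some (firstIdx n p) else none := by
  split_ifs with h
  · rw [List.find?_range_eq_some]
    refine ⟨by simpa using firstIdx_spec h, List.mem_range.2 h, fun j hj => ?_⟩
    simpa using not_of_lt_firstIdx hj
  · rw [List.find?_eq_none]
    intro i hi
    have := not_of_lt_firstIdx (n := n) (p := p) (i := i)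
      ((List.mem_range.1 hi).trans_le (not_lt.1 h))
    simpa using this

theorem find?_map_range {α : Type} (f : ℕ → α) {n : ℕ} {p : α → Prop} [DecidablePred p] :
    ((List.range n).map f).find? (fun i => decide (p i)) =
      if firstIdx n (fun i => p (f i)) < n then some (f (firstIdx n fun i => p (f i)))
      else none := by
  rw [List.find?_map]
  change Option.map f ((List.range n).find? fun i => decide (p (f i))) = _
  rw [find?_range (p := fun i => p (f i))]
  split_ifs <;> rfl

theorem find?_surfaces {L : Level} {p : Surface → Prop} [DecidablePred p] :
    L.surfaces.find? (fun s => decide (p s)) =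
      if firstIdx L.surfaces.length (fun i => p (L.surfAt i)) < L.surfaces.length then
        some (L.surfAt (firstIdx L.surfaces.length fun i => p (L.surfAt i))) else none := by
  have : L.surfaces = (List.range L.surfaces.length).map L.surfAt := by
    apply List.ext_getElem
    · simp
    · intro i h1 h2
      simp [Level.surfAt, List.getElem?_eq_getElem h1]
  conv_lhs => rw [this]
  exact find?_map_range _

theorem round_intCast_div {a q : ℤ} (hq : 0 < q) :
    round ((a : ℝ) / q) = (2 * a + q) / (2 * q) := by
  rw [round_eq, Int.floor_eq_iff]
  have hq' : (0 : ℝ) < q := by exact_mod_cast hq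
  have e : (a : ℝ) / q + 1 / 2 = ((2 * a + q : ℤ) : ℝ) / ((2 * q : ℤ) : ℝ) := by
    push_cast
    field_simp
  rw [e, le_div_iff₀ (by push_cast; positivity), div_lt_iff₀ (by push_cast; positivity)]
  have h1 := Int.ediv_mul_le (2 * a + q) (show 2 * q ≠ 0 by omega)
  have h2 := Int.lt_ediv_add_one_mul_self (2 * a + q) (show 0 < 2 * q by omega)
  exact ⟨by exact_mod_cast h1, by exact_mod_cast h2⟩

/-! ### Rays -/

/-- Numerator and denominator of the parameter at which a ray meets a plane. -/
def rayNum (e d : Vec) (P : Polygon) : ℤ := P.normal ⬝ᵥ (P.a - e) * (P.normal ⬝ᵥ d).sign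

def rayDen (d : Vec) (P : Polygon) : ℤ := |P.normal ⬝ᵥ d|

theorem rayParam_eq (e d : Vec) (P : Polygon) :
    rayParam e d P = (rayNum e d P : ℝ) / rayDen d P := by
  rw [rayParam, rayNum, rayDen]
  rcases lt_trichotomy (P.normal ⬝ᵥ d) 0 with h | h | h
  · rw [Int.sign_eq_neg_one_of_neg h, abs_of_neg h]
    push_cast
    rw [mul_neg_one, neg_div_neg_eq]
  · rw [h]
    simp
  · rw [Int.sign_eq_one_of_pos h, abs_of_pos h, mul_one]

theorem rayDen_pos {d : Vec} {P : Polygon} : 0 < rayDen d P ↔ P.normal ⬝ᵥ d ≠ 0 := abs_pos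

/-- The point of a ray in a plane, times the denominator. -/
def rayTip (e d : Vec) (P : Polygon) : Vec := rayDen d P • e + rayNum e d P • d

theorem rayPoint_eq {e d : Vec} {P : Polygon} (h : 0 < rayDen d P) :
    rayPoint e d P = fun j => (rayTip e d P j : ℝ) / rayDen d P := by
  have h' : (rayDen d P : ℝ) ≠ 0 := by exact_mod_cast h.ne'
  ext j
  rw [rayPoint, rayParam_eq, rayTip]
  simp only [Pi.add_apply, Pi.smul_apply, toPoint, smul_eq_mul]
  push_cast
  field_simp

theorem hits_iff {e d : Vec} {P : Polygon} : Hits e d P ↔ 0 ≤ rayNum e d P ∧ (0 < rayDen d P ∧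
    (fun j => (rayTip e d P j : ℝ) / rayDen d P) ∈ P.region) := by
  rw [Hits, ← rayDen_pos]
  constructor
  · rintro ⟨h1, h2, h3⟩
    have h' : (0 : ℝ) < rayDen d P := by exact_mod_cast h1
    rw [rayParam_eq, le_div_iff₀ h', zero_mul] at h2
    rw [rayPoint_eq h1] at h3
    exact ⟨by exact_mod_cast h2, h1, h3⟩
  · rintro ⟨h2, h1, h3⟩
    have h' : (0 : ℝ) < rayDen d P := by exact_mod_cast h1
    rw [rayParam_eq, le_div_iff₀ h', zero_mul, rayPoint_eq h1]
    exact ⟨h1, by exact_mod_cast h2, h3⟩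

theorem Hits.den_pos {e d : Vec} {P : Polygon} (h : Hits e d P) : 0 < rayDen d P :=
  rayDen_pos.2 h.1

theorem rayParam_le_iff {e d : Vec} {P Q : Polygon} (hP : 0 < rayDen d P) (hQ : 0 < rayDen d Q) :
    rayParam e d P ≤ rayParam e d Q ↔ rayNum e d P * rayDen d Q ≤ rayNum e d Q * rayDen d P := by
  rw [rayParam_eq, rayParam_eq, div_le_div_iff₀ (by exact_mod_cast hP) (by exact_mod_cast hQ)]
  norm_cast

theorem forall_surface_iff {L : Level} {q : Surface → Prop} :
    (∀ s ∈ L.surfaces, q s) ↔ ∀ i, i < L.surfaces.length → q (L.surfAt i) := by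
  have := (exists_surface_iff (L := L) (q := fun s => ¬ q s)).not
  push Not at this
  exact this

theorem forall_grill_iff {L : Level} {q : Polygon → Prop} :
    (∀ s ∈ L.grills, q s) ↔ ∀ i, i < L.grills.length → q (L.grillAt i) := by
  have := (exists_grill_iff (L := L) (q := fun s => ¬ q s)).not
  push Not at this
  exact this

/-- The ray parameters are compared by cross multiplication, which is correct since the denominators
of polygons that are hit are positive. -/
theorem shotLandsOn_iff {L : Level} {e d : Vec} {s : Surface} : L.ShotLandsOn e d s ↔
    s.portalable = true ∧ s.shape.normal ⬝ᵥ d < 0 ∧ Hits e d s.shape ∧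
      (∀ i, i < L.surfaces.length → Hits e d (L.surfAt i).shape →
        rayNum e d s.shape * rayDen d (L.surfAt i).shape ≤
          rayNum e d (L.surfAt i).shape * rayDen d s.shape) ∧
      ∀ i, i < L.grills.length → Hits e d (L.grillAt i) →
        rayNum e d s.shape * rayDen d (L.grillAt i) <
          rayNum e d (L.grillAt i) * rayDen d s.shape := by
  rw [Level.ShotLandsOn, forall_surface_iff
    (q := fun s' => Hits e d s'.shape → rayParam e d s.shape ≤ rayParam e d s'.shape),
    forall_grill_iff (q := fun P => Hits e d P → rayParam e d s.shape < rayParam e d P)]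
  refine and_congr_right fun _ => and_congr_right fun _ => and_congr_right fun hs =>
    and_congr ?_ ?_
  · exact forall_congr' fun i => imp_congr_right fun _ => imp_congr_right fun h =>
      rayParam_le_iff hs.den_pos h.den_pos
  · refine forall_congr' fun i => imp_congr_right fun _ => imp_congr_right fun h => ?_
    rw [← not_le, rayParam_le_iff h.den_pos hs.den_pos, not_le]

section

variable {Γ : Type} [Ctx Γ]

instance Dfn.rayNum {e d : Γ → Vec} {P : Γ → Polygon} [DfnV e] [DfnV d] [DfnPoly P] :
    Dfn fun γ => rayNum (e γ) (d γ) (P γ) := by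
  unfold PortalGame.rayNum
  infer_instance

instance Dfn.rayDen {d : Γ → Vec} {P : Γ → Polygon} [DfnV d] [DfnPoly P] :
    Dfn fun γ => rayDen (d γ) (P γ) := by
  unfold PortalGame.rayDen
  infer_instance

instance DfnV.rayTip {e d : Γ → Vec} {P : Γ → Polygon} [DfnV e] [DfnV d] [DfnPoly P] :
    DfnV fun γ => rayTip (e γ) (d γ) (P γ) := by
  unfold PortalGame.rayTip
  infer_instance

instance DfnP.hits {e d : Γ → Vec} {P : Γ → Polygon} [DfnV e] [DfnV d] [DfnPoly P] :
    DfnP fun γ => Hits (e γ) (d γ) (P γ) := by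
  have : DfnP fun γ => 0 < PortalGame.rayDen (d γ) (P γ) ∧
    (fun j => (PortalGame.rayTip (e γ) (d γ) (P γ) j : ℝ) / PortalGame.rayDen (d γ) (P γ)) ∈
      (P γ).region := DfnP.mem_region
  simp only [hits_iff]
  infer_instance

instance DfnP.shotLandsOn {e d : Γ → Vec} {i : Γ → ℕ} [DfnV e] [DfnV d]
    [Dfn fun γ => (i γ : ℤ)] :
    DfnP fun γ => (lv γ).ShotLandsOn (e γ) (d γ) ((lv γ).surfAt (i γ)) := by
  simp only [shotLandsOn_iff]
  infer_instance

/-- The number of the surface on which a shot makes a portal. -/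
def Level.shotIdx (L : Level) (e d : Vec) : ℕ :=
  firstIdx L.surfaces.length fun i => L.ShotLandsOn e d (L.surfAt i)

/-- The place at which a shot makes a portal. -/
def Level.shotCenter (L : Level) (e d : Vec) : Vec :=
  let P := (L.surfAt (L.shotIdx e d)).shape
  fun j => (2 * rayTip e d P j + rayDen d P) / (2 * rayDen d P)

instance Dfn.shotIdx {e d : Γ → Vec} [DfnV e] [DfnV d] :
    Dfn fun γ => ((lv γ).shotIdx (e γ) (d γ) : ℤ) := by
  unfold Level.shotIdx
  infer_instance

instance DfnV.shotCenter {e d : Γ → Vec} [DfnV e] [DfnV d] :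
    DfnV fun γ => (lv γ).shotCenter (e γ) (d γ) :=
  ⟨fun j => by unfold Level.shotCenter; infer_instance⟩

/-- The portals with the given surface numbers (increased by one) and places. -/
def Level.mkPortals (L : Level) (idx : Color → ℕ) (ctr : Color → Vec) : Portals := fun c =>
  if idx c = 0 then none else some (L.placed (idx c) (ctr c))

/-- The number `0` means that there is no portal, whence the shift by one. A shot that lands nowhere
shows in a search result equal to the number of surfaces. Rounding becomes an integer quotient. -/
theorem shoot_mkPortals {L : Level} {e d : Vec} {c : Color} {idx : Color → ℕ}
    {ctr : Color → Vec} : L.shoot e d c (L.mkPortals idx ctr) = L.mkPortals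
      (fun c' => if c' = c ∧ L.shotIdx e d < L.surfaces.length then L.shotIdx e d + 1 else idx c')
      fun c' => if c' = c ∧ L.shotIdx e d < L.surfaces.length then L.shotCenter e d
        else ctr c' := by
  rw [Level.shoot, find?_surfaces, ← Level.shotIdx]
  by_cases h : L.shotIdx e d < L.surfaces.length
  · rw [if_pos h]
    have hs : L.ShotLandsOn e d (L.surfAt (L.shotIdx e d)) := firstIdx_spec h
    have hpos := hs.2.2.1.den_pos
    funext c'
    simp only [Level.mkPortals, h, and_true]
    by_cases h1 : c' = c
    · simp only [h1, if_true, Nat.succ_ne_zero, if_false, Level.placed, Nat.add_sub_cancel,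
        Level.shotCenter, Option.some.injEq, Placed.mk.injEq, true_and]
      funext j
      rw [rayPoint_eq hpos, round_intCast_div hpos]
    · simp only [h1, if_false]
  · rw [if_neg h]
    simp [h]

/-! ### Passages -/

instance DfnV.upright {n : Γ → Vec} [DfnV n] : DfnV fun γ => upright (n γ) := by
  unfold PortalGame.upright PortalGame.up
  infer_instance

instance DfnV.turn {n m v : Γ → Vec} [DfnV n] [DfnV m] [DfnV v] :
    DfnV fun γ => turn (n γ) (m γ) (v γ) :=
  ⟨fun j => by unfold PortalGame.turn; infer_instance⟩

/-- The normal vector of a portal that lies on the surface with number `i - 1`. -/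
def Level.normalAt (L : Level) (i : ℕ) : Vec := (L.surfAt (i - 1)).shape.normal

instance DfnV.normalAt {i : Γ → ℕ} [Dfn fun γ => (i γ : ℤ)] :
    DfnV fun γ => (lv γ).normalAt (i γ) := by
  unfold Level.normalAt
  infer_instance

instance DfnV.inFront {i k : Γ → ℕ} {v : Γ → Vec} [Dfn fun γ => (i γ : ℤ)]
    [Dfn fun γ => (k γ : ℤ)] [DfnV v] :
    DfnV fun γ => inFront ((lv γ).placed (i γ) (v γ)) (k γ) := by
  refine ⟨fun j => ?_⟩
  change Dfn fun γ => v γ j + PortalGame.divSqrt ((k γ : ℤ) * (lv γ).normalAt (i γ) j)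
    ((lv γ).normalAt (i γ) ⬝ᵥ (lv γ).normalAt (i γ)).toNat
  infer_instance

/-- The infimum of a linear form on a box is the sum of the minima over its coordinates. For a
nonzero form it is not attained on the open box, so strict positivity on the body amounts to a weak
inequality for the infimum. -/
theorem before_iff {L : Level} (hwf : L.WellFormed) {cr : Bool} {P : Placed} {q : Vec}
    (hn : P.surface.shape.normal ≠ 0) : L.Before cr P q ↔
      P.surface.shape.normal ⬝ᵥ P.surface.shape.a ≤ ∑ j, min (P.surface.shape.normal j *
        bodyLo L.physics q j) (P.surface.shape.normal j * bodyHi L.physics cr q j) := by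
  set n := P.surface.shape.normal with hn_def
  set lo := bodyLo L.physics q with hlo
  set hi := bodyHi L.physics cr q with hhi
  have hlohi : ∀ j, lo j < hi j := by
    obtain ⟨-, -, -, h1, h2, h3, -⟩ := hwf
    have h4 : 2 ≤ L.physics.bodyHeight cr := by
      unfold Physics.bodyHeight
      split_ifs <;> omega
    rw [forall_fin_three]
    simp only [hlo, hhi, bodyLo, bodyHi, Matrix.cons_val_zero, Matrix.cons_val_one,
      Matrix.cons_val]
    omega
  have hdot : ∀ x : Point, toPoint n ⬝ᵥ (x - toPoint P.surface.shape.a) =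
      ∑ j, (n j : ℝ) * x j - ((n ⬝ᵥ P.surface.shape.a : ℤ) : ℝ) := by
    intro x
    simp [dotProduct, toPoint, mul_sub, Finset.sum_sub_distrib]
  constructor
  · intro h
    by_contra hlt
    push Not at hlt
    -- the corner with the least value, and the centre
    set y : Vec := fun j => if n j * lo j ≤ n j * hi j then lo j else hi j with hy
    have hyv : ∑ j, min (n j * lo j) (n j * hi j) = n ⬝ᵥ y := by
      rw [dotProduct]
      refine Finset.sum_congr rfl fun j _ => ?_
      simp only [hy, min_def]
      split_ifs <;> rfl
    set z : Point := fun j => ((lo j : ℝ) + hi j) / 2 with hz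
    have hmem : ∀ t : ℝ, 0 < t → t ≤ 1 → (fun j => (y j : ℝ) + t * (z j - y j)) ∈
        L.physics.body cr q := by
      intro t h0 h1
      rw [mem_body_iff]
      intro j
      have h2 : (lo j : ℝ) < hi j := by exact_mod_cast hlohi j
      have : (y j : ℝ) = lo j ∨ (y j : ℝ) = hi j := by
        simp only [hy]
        split_ifs
        · exact Or.inl rfl
        · exact Or.inr rfl
      simp only [hz]
      rcases this with h3 | h3 <;> rw [h3] <;> constructor <;> nlinarith
    set A : ℝ := ((n ⬝ᵥ y - n ⬝ᵥ P.surface.shape.a : ℤ) : ℝ) with hA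
    set D : ℝ := ∑ j, (n j : ℝ) * (z j - y j) with hD
    have hval : ∀ t : ℝ, 0 < t → t ≤ 1 → 0 < A + t * D := by
      intro t h0 h1
      have := h _ (hmem t h0 h1)
      rw [hdot] at this
      convert this using 1
      rw [hA, hD, Int.cast_sub, dotProduct, Finset.mul_sum]
      push_cast
      simp only [mul_add, Finset.sum_add_distrib]
      have : ∀ j, t * ((n j : ℝ) * (z j - y j)) = (n j : ℝ) * (t * (z j - y j)) := fun j => by ring
      simp only [this]
      ring
    have hAneg : A < 0 := by
      rw [hA, Int.cast_lt_zero]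
      rw [hyv] at hlt
      omega
    have h1 := hval 1 one_pos le_rfl
    have hDpos : 0 < D := by linarith
    -- On the segment from the least corner to the centre the form is `A + t * D`. It is negative at
    -- the corner and positive at the centre, so it vanishes at a point of the body.
    have h2 := hval (-A / D) (div_pos (by linarith) hDpos) (by rw [div_le_one hDpos]; linarith)
    rw [div_mul_cancel₀ _ hDpos.ne'] at h2
    linarith
  · intro h x hx
    rw [hdot, sub_pos]
    rw [mem_body_iff] at hx
    have h1 : ((n ⬝ᵥ P.surface.shape.a : ℤ) : ℝ) ≤
        ∑ j, ((min (n j * lo j) (n j * hi j) : ℤ) : ℝ) := by exact_mod_cast h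
    refine h1.trans_lt (Finset.sum_lt_sum (fun j _ => ?_) ?_)
    · push_cast
      rcases le_total 0 (n j : ℝ) with h2 | h2
      · exact (min_le_left _ _).trans (mul_le_mul_of_nonneg_left (hx j).1.le h2)
      · exact (min_le_right _ _).trans (mul_le_mul_of_nonpos_left (hx j).2.le h2)
    -- A coordinate in which the normal does not vanish makes the inequality strict.
    · obtain ⟨j, hj⟩ := Function.ne_iff.1 hn
      refine ⟨j, Finset.mem_univ _, ?_⟩
      push_cast
      rcases lt_or_gt_of_ne hj with h2 | h2
      · have h2 : (n j : ℝ) < 0 := by exact_mod_cast h2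
        exact (min_le_right _ _).trans_lt (mul_lt_mul_of_neg_left (hx j).2 h2)
      · have h2 : (0 : ℝ) < n j := by exact_mod_cast h2
        exact (min_le_left _ _).trans_lt (mul_lt_mul_of_pos_left (hx j).1 h2)

theorem normalAt_ne_zero (b : Base) (i : ℕ) : b.lvl.normalAt i ≠ 0 := (surfAt_props b _).1.1

instance DfnP.before {cr : Γ → Bool} {i : Γ → ℕ} {v q : Γ → Vec} [DfnP fun γ => cr γ = true]
    [Dfn fun γ => (i γ : ℤ)] [DfnV v] [DfnV q] :
    DfnP fun γ => (lv γ).Before (cr γ) ((lv γ).placed (i γ) (v γ)) (q γ) := by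
  refine DfnP.congr (p := fun γ => (lv γ).normalAt (i γ) ⬝ᵥ ((lv γ).surfAt (i γ - 1)).shape.a ≤
      min ((lv γ).normalAt (i γ) 0 * PortalGame.bodyLo (lv γ).physics (q γ) 0)
        ((lv γ).normalAt (i γ) 0 * PortalGame.bodyHi (lv γ).physics (cr γ) (q γ) 0) +
      min ((lv γ).normalAt (i γ) 1 * PortalGame.bodyLo (lv γ).physics (q γ) 1)
        ((lv γ).normalAt (i γ) 1 * PortalGame.bodyHi (lv γ).physics (cr γ) (q γ) 1) +
      min ((lv γ).normalAt (i γ) 2 * PortalGame.bodyLo (lv γ).physics (q γ) 2)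
        ((lv γ).normalAt (i γ) 2 * PortalGame.bodyHi (lv γ).physics (cr γ) (q γ) 2))
    inferInstance fun γ => ?_
  rw [before_iff (P := (lv γ).placed (i γ) (v γ)) (Ctx.base γ).wf
    (normalAt_ne_zero (Ctx.base γ) (i γ)), Fin.sum_univ_three]
  rfl

/-- The number of places in front of a portal that are tried. -/
def Level.exitRange (L : Level) : ℕ := 2 * L.physics.radius + L.physics.height + 4

/-- The distance from a portal at which the avatar appears. -/
def Level.exitIdx (L : Level) (cr : Bool) (i : ℕ) (v : Vec) : ℕ :=
  firstIdx L.exitRange fun k => L.Before cr (L.placed i v) (inFront (L.placed i v) k) ∧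
    ¬ L.Obstructed cr (inFront (L.placed i v) k)

theorem exit_placed {L : Level} {cr : Bool} {i : ℕ} {v : Vec} : L.exit cr (L.placed i v) =
    if L.exitIdx cr i v < L.exitRange then some (inFront (L.placed i v) (L.exitIdx cr i v))
    else none :=
  find?_map_range (n := L.exitRange) (inFront (L.placed i v))

instance Dfn.exitRange : Dfn fun γ : Γ => ((lv γ).exitRange : ℤ) := by
  unfold Level.exitRange
  infer_instance

instance Dfn.exitIdx {cr : Γ → Bool} {i : Γ → ℕ} {v : Γ → Vec} [DfnP fun γ => cr γ = true]
    [Dfn fun γ => (i γ : ℤ)] [DfnV v] :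
    Dfn fun γ => ((lv γ).exitIdx (cr γ) (i γ) (v γ) : ℤ) := by
  unfold Level.exitIdx
  infer_instance

end

end PortalGame

end

/-! ## Configurations in the middle of a tick -/

noncomputable section

namespace PortalGame

open scoped Classical
open Ram

/-- The avatar in the middle of a tick, together with the number `n` of substeps of the tick and
the number `rem` of substeps that remain; portals are given by the number of the surface,
increased by one, and the place. -/
@[ext] structure Cfg where
  base : Vec
  disp : Vec
  pos : Vec
  vel : Vec
  k : ℕ
  n : ℕ
  rem : ℕ
  cr : Bool
  walk : Bool
  idx : Color → ℕ
  ctr : Color → Vec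

namespace Cfg

def motion (L : Level) (x : Cfg) : Motion :=
  ⟨x.base, x.disp, x.k, x.pos, x.vel, L.mkPortals x.idx x.ctr⟩

def state (L : Level) (look : Vec) (x : Cfg) : State :=
  ⟨x.pos, x.vel, look, x.cr, L.mkPortals x.idx x.ctr⟩

end Cfg

/-- The place where the avatar leaves a portal. -/
def Level.exitPlace (L : Level) (cr : Bool) (i : ℕ) (v : Vec) : Vec :=
  inFront (L.placed i v) (L.exitIdx cr i v)

/-- A move to `q` in direction `d` passes through the portal of color `c`. -/
def Level.Passes (L : Level) (idx : Color → ℕ) (ctr : Color → Vec) (cr : Bool) (q d : Vec)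
    (c : Color) : Prop :=
  idx c ≠ 0 ∧ idx c.other ≠ 0 ∧ L.normalAt (idx c) ⬝ᵥ d < 0 ∧
    (L.physics.body cr q ∩ L.opening (L.placed (idx c) (ctr c))).Nonempty ∧
    L.exitIdx cr (idx c.other) (ctr c.other) < L.exitRange

theorem passVia_mkPortals {L : Level} {idx : Color → ℕ} {ctr : Color → Vec} {cr : Bool}
    {q d : Vec} {c : Color} : L.passVia (L.mkPortals idx ctr) cr q d c =
      if L.Passes idx ctr cr q d c then
        some (L.exitPlace cr (idx c.other) (ctr c.other),
          turn (L.normalAt (idx c)) (L.normalAt (idx c.other)))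
      else none := by
  unfold Level.passVia Level.Passes Level.mkPortals
  by_cases h1 : idx c = 0
  · simp [h1]
  by_cases h2 : idx c.other = 0
  · simp [h1, h2]
  simp only [h1, h2, if_false, ne_eq, not_false_eq_true, true_and, exit_placed]
  by_cases h3 : L.normalAt (idx c) ⬝ᵥ d < 0 ∧
    (L.physics.body cr q ∩ L.opening (L.placed (idx c) (ctr c))).Nonempty
  · have h3' : (L.placed (idx c) (ctr c)).surface.shape.normal ⬝ᵥ d < 0 ∧
      (L.physics.body cr q ∩ L.opening (L.placed (idx c) (ctr c))).Nonempty := h3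
    rw [if_pos h3']
    simp only [h3, true_and]
    split_ifs <;> rfl
  · have h3' : ¬ ((L.placed (idx c) (ctr c)).surface.shape.normal ⬝ᵥ d < 0 ∧
      (L.physics.body cr q ∩ L.opening (L.placed (idx c) (ctr c))).Nonempty) := h3
    rw [if_neg h3', if_neg]
    tauto

theorem pass_mkPortals {L : Level} {idx : Color → ℕ} {ctr : Color → Vec} {cr : Bool} {q d : Vec} :
    L.pass (L.mkPortals idx ctr) cr q d =
      if L.Passes idx ctr cr q d .blue then
        some (L.exitPlace cr (idx .orange) (ctr .orange),
          turn (L.normalAt (idx .blue)) (L.normalAt (idx .orange)))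
      else if L.Passes idx ctr cr q d .orange then
        some (L.exitPlace cr (idx .blue) (ctr .blue),
          turn (L.normalAt (idx .orange)) (L.normalAt (idx .blue)))
      else none := by
  rw [Level.pass, passVia_mkPortals, passVia_mkPortals]
  simp only [Color.other]
  split_ifs <;> rfl

namespace Cfg

/-- The place where the avatar is due after the next substep. -/
def target (x : Cfg) : Vec := x.base + fun j => (((x.k : ℤ) + 1) * x.disp j).tdiv x.n

/-- The avatar leaves the portal whose color is not `c`. -/
def through (L : Level) (c : Color) (x : Cfg) : Cfg :=
  { x with
    base := L.exitPlace x.cr (x.idx c.other) (x.ctr c.other)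
    disp := turn (L.normalAt (x.idx c)) (L.normalAt (x.idx c.other)) x.disp
    k := 0
    pos := L.exitPlace x.cr (x.idx c.other) (x.ctr c.other)
    vel := turn (L.normalAt (x.idx c)) (L.normalAt (x.idx c.other)) x.vel }

def climbRange (L : Level) (x : Cfg) : ℕ := if x.walk then L.physics.stepHeight + 1 else 1

/-- The height of the step to climb. -/
def climbIdx (L : Level) (x : Cfg) : ℕ :=
  firstIdx (x.climbRange L) fun h => ¬ L.Obstructed x.cr (x.target + (h : ℤ) • up)

def climb (L : Level) (x : Cfg) : Cfg :=
  { x with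
    base := x.base + (x.climbIdx L : ℤ) • up
    k := x.k + 1
    pos := x.target + (x.climbIdx L : ℤ) • up }

def collide (L : Level) (x : Cfg) : Cfg :=
  { x with
    base := x.pos
    disp := fun j => if L.Stopped x.cr (x.motion L) j then 0 else x.disp j
    k := 0
    vel := fun j => if L.Stopped x.cr (x.motion L) j then 0 else x.vel j }

def advance (L : Level) (x : Cfg) : Cfg :=
  if L.Passes x.idx x.ctr x.cr x.target x.disp .blue then x.through L .blue
  else if L.Passes x.idx x.ctr x.cr x.target x.disp .orange then x.through L .orange
  else if x.climbIdx L < x.climbRange L then x.climb L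
  else x.collide L

/-- Portals vanish inside an Emancipation Grill. -/
def fizzle (L : Level) (x : Cfg) : Cfg :=
  { x with
    rem := x.rem - 1
    idx := fun c => if L.InGrill x.cr x.pos then 0 else x.idx c }

def substep (L : Level) (x : Cfg) : Cfg := (x.advance L).fizzle L

theorem motion_advance (L : Level) (x : Cfg) :
    L.advance x.cr x.walk x.n (x.motion L) = (x.advance L).motion L := by
  have hq : (x.motion L).base + (fun j => ((((x.motion L).k : ℤ) + 1) *
    (x.motion L).disp j).tdiv x.n) = x.target := rfl
  rw [Level.advance]
  simp only [hq]
  rw [show (x.motion L).portals = L.mkPortals x.idx x.ctr from rfl, pass_mkPortals, advance,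
    show (x.motion L).disp = x.disp from rfl]
  by_cases h1 : L.Passes x.idx x.ctr x.cr x.target x.disp .blue
  · simp only [h1, if_true]
    rfl
  by_cases h2 : L.Passes x.idx x.ctr x.cr x.target x.disp .orange
  · simp only [h1, h2, if_true, if_false]
    rfl
  simp only [h1, h2, if_false]
  rw [bind_pure_comp, List.map_eq_map, ← climbRange,
    find?_map_range (p := fun h : ℤ => ¬ L.Obstructed x.cr (x.target + h • up)), ← climbIdx]
  by_cases h3 : x.climbIdx L < x.climbRange L
  · simp only [h3, if_true]
    rfl
  · simp only [h3, if_false]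
    rfl

theorem advance_fields (L : Level) (x : Cfg) : (x.advance L).cr = x.cr ∧
    (x.advance L).walk = x.walk ∧ (x.advance L).n = x.n ∧ (x.advance L).rem = x.rem ∧
    (x.advance L).idx = x.idx ∧ (x.advance L).ctr = x.ctr := by
  unfold advance
  split_ifs <;> exact ⟨rfl, rfl, rfl, rfl, rfl, rfl⟩

theorem motion_substep (L : Level) (x : Cfg) :
    L.substep x.cr x.walk x.n (x.motion L) = (x.substep L).motion L := by
  obtain ⟨h1, -, -, -, h5, -⟩ := advance_fields L x
  rw [Level.substep, motion_advance, substep, fizzle]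
  change (if L.InGrill x.cr (x.advance L).pos then _ else _) = _
  rw [h1]
  by_cases h : L.InGrill x.cr (x.advance L).pos
  · simp only [h, if_true]
    rfl
  · simp only [h, if_false]
    rfl

theorem substep_fields (L : Level) (x : Cfg) : (x.substep L).cr = x.cr ∧
    (x.substep L).walk = x.walk ∧ (x.substep L).n = x.n ∧ (x.substep L).rem = x.rem - 1 ∧
    (x.substep L).ctr = x.ctr := by
  obtain ⟨h1, h2, h3, h4, -, h6⟩ := advance_fields L x
  exact ⟨h1, h2, h3, by rw [substep, fizzle, h4], h6⟩

theorem iterate_substep_fields (L : Level) (x : Cfg) (j : ℕ) :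
    ((substep L)^[j] x).cr = x.cr ∧ ((substep L)^[j] x).walk = x.walk ∧
    ((substep L)^[j] x).n = x.n ∧ ((substep L)^[j] x).rem = x.rem - j ∧
    ((substep L)^[j] x).ctr = x.ctr := by
  induction j with
  | zero => exact ⟨rfl, rfl, rfl, rfl, rfl⟩
  | succ j ih =>
    rw [Function.iterate_succ_apply']
    obtain ⟨h1, h2, h3, h4, h5⟩ := ih
    obtain ⟨g1, g2, g3, g4, g5⟩ := substep_fields L ((substep L)^[j] x)
    exact ⟨g1.trans h1, g2.trans h2, g3.trans h3, by omega, g5.trans h5⟩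

theorem motion_iterate_substep (L : Level) (x : Cfg) (j : ℕ) :
    (L.substep x.cr x.walk x.n)^[j] (x.motion L) = ((substep L)^[j] x).motion L := by
  induction j with
  | zero => rfl
  | succ j ih =>
    rw [Function.iterate_succ_apply', Function.iterate_succ_apply', ih, ← motion_substep]
    obtain ⟨h1, h2, h3, -⟩ := iterate_substep_fields L x j
    rw [h1, h2, h3]

/-! ### The beginning of a tick -/

/-- The avatar crouches, or stands up if there is room. -/
def stance (L : Level) (i : Input) (x : Cfg) : Cfg :=
  { x with cr := if i.crouch then true else if L.Obstructed false x.pos then x.cr else false }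

def fire (L : Level) (i : Input) (x : Cfg) : Cfg :=
  { x with
    idx := fun c => if i.fire = some c ∧
      L.shotIdx (L.eye x.cr x.pos) i.cursor < L.surfaces.length then
        L.shotIdx (L.eye x.cr x.pos) i.cursor + 1 else x.idx c
    ctr := fun c => if i.fire = some c ∧
      L.shotIdx (L.eye x.cr x.pos) i.cursor < L.surfaces.length then
        L.shotCenter (L.eye x.cr x.pos) i.cursor else x.ctr c }

def Grounded (L : Level) (x : Cfg) : Prop :=
  x.vel 2 ≤ 0 ∧ L.Obstructed x.cr (x.pos - up) ∧
    ¬ L.Passes x.idx x.ctr x.cr (x.pos - up) (-up) .blue ∧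
    ¬ L.Passes x.idx x.ctr x.cr (x.pos - up) (-up) .orange

def setVel (L : Level) (i : Input) (x : Cfg) : Cfg :=
  { x with
    base := x.pos
    vel := if x.Grounded L then
        i.wish L.physics.walkSpeed + (if i.jump then (L.physics.jumpSpeed : ℤ) • up else 0)
      else x.vel - (L.physics.gravity : ℤ) • up
    disp := if x.Grounded L then
        i.wish L.physics.walkSpeed + (if i.jump then (L.physics.jumpSpeed : ℤ) • up else 0)
      else x.vel - (L.physics.gravity : ℤ) • up + i.wish L.physics.airSpeed
    k := 0
    walk := decide (x.Grounded L) && !i.jump }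

def count (x : Cfg) : ℕ := (x.disp 0).natAbs + (x.disp 1).natAbs + (x.disp 2).natAbs + 2

def setCount (x : Cfg) : Cfg := { x with n := x.count, rem := x.count }

def start (L : Level) (i : Input) (x : Cfg) : Cfg :=
  (((x.stance L i).fire L i).setVel L i).setCount

theorem grounded_iff (L : Level) (x : Cfg) :
    L.Grounded (L.mkPortals x.idx x.ctr) x.cr x.pos x.vel ↔ x.Grounded L := by
  rw [Level.Grounded, Grounded, pass_mkPortals]
  refine and_congr_right fun _ => and_congr_right fun _ => ?_
  split_ifs <;> simp [*]

theorem start_rem (L : Level) (i : Input) (x : Cfg) : (x.start L i).rem = (x.start L i).n := rfl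

/-- Every intermediate value of a tick is made a variable with an equation, so that each can be
matched separately with a component of a configuration. -/
theorem tick_eq {L : Level} {s : State} {i : Input} {cr : Bool} {ports : Portals} {gr : Bool}
    (hcr : (if i.crouch then true else if L.Obstructed false s.pos then s.crouched else false) = cr)
    (hports : (match i.fire with
      | none => s.portals
      | some c => L.shoot (L.eye cr s.pos) i.cursor c s.portals) = ports)
    (hgr : decide (L.Grounded ports cr s.pos s.vel) = gr) {vel disp : Vec} {n : ℕ} {m : Motion}
    (hvel : (if gr then
        i.wish L.physics.walkSpeed + (if i.jump then (L.physics.jumpSpeed : ℤ) • up else 0)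
      else s.vel - (L.physics.gravity : ℤ) • up) = vel)
    (hdisp : (if gr then vel else vel + i.wish L.physics.airSpeed) = disp)
    (hn : (disp 0).natAbs + (disp 1).natAbs + (disp 2).natAbs + 2 = n)
    (hm : (L.substep cr (gr && !i.jump) n)^[n]
      { base := s.pos, disp := disp, k := 0, pos := s.pos, vel := vel, portals := ports } = m) :
    L.tick s i = ⟨m.pos, m.vel, i.cursor, cr, m.portals⟩ := by
  subst hcr hports hgr hvel hdisp hn hm
  rfl

/-- This links the game to single substeps. The number of substeps varies, so a tick is a path of
configurations instead of one composed function. The orientation need not be recorded: a tick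
replaces it by the cursor without reading it. -/
theorem tick_state (L : Level) (look : Vec) (i : Input) (x : Cfg) :
    L.tick (x.state L look) i =
      ((substep L)^[(x.start L i).n] (x.start L i)).state L i.cursor := by
  have hc := (iterate_substep_fields L (x.start L i) (x.start L i).n).1
  rw [tick_eq (L := L) (s := x.state L look) (i := i) (cr := (x.start L i).cr)
    (ports := L.mkPortals (x.start L i).idx (x.start L i).ctr)
    (gr := decide (((x.stance L i).fire L i).Grounded L)) (vel := (x.start L i).vel)
    (disp := (x.start L i).disp) rfl ?_ ?_ ?_ ?_ rfl
    (motion_iterate_substep L (x.start L i) (x.start L i).n), state, hc]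
  · rfl
  · change (match i.fire with
      | none => L.mkPortals x.idx x.ctr
      | some c => L.shoot (L.eye (x.stance L i).cr x.pos) i.cursor c (L.mkPortals x.idx x.ctr)) =
      L.mkPortals ((x.stance L i).fire L i).idx ((x.stance L i).fire L i).ctr
    rcases hi : i.fire with _ | c
    · simp [fire, hi, stance]
    · simp only [shoot_mkPortals, fire, hi, Option.some.injEq]
      simp only [stance, eq_comm]
  · exact decide_eq_decide.2 (grounded_iff L ((x.stance L i).fire L i))
  · simp only [decide_eq_true_eq]
    rfl
  · simp only [decide_eq_true_eq, start, setCount, setVel]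
    split_ifs <;> rfl

/-- The configuration at the beginning of the game. -/
def initial (L : Level) : Cfg where
  base := L.start
  disp := 0
  pos := L.start
  vel := 0
  k := 0
  n := 0
  rem := 0
  cr := false
  walk := false
  idx _ := 0
  ctr _ := 0

theorem initial_state (L : Level) : (initial L).state L ![1, 0, 0] = L.startState := rfl

def Fits (L : Level) (x : Cfg) : Prop :=
  L.Fits x.pos ∧ L.Fits x.vel ∧ (x.idx .blue ≠ 0 → L.Fits (x.ctr .blue)) ∧
    (x.idx .orange ≠ 0 → L.Fits (x.ctr .orange))

theorem state_fits (L : Level) (look : Vec) (x : Cfg) :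
    (x.state L look).Fits L ↔ x.Fits L ∧ L.Fits look := by
  have h : ∀ c, (∀ P, L.mkPortals x.idx x.ctr c = some P → L.Fits P.center) ↔
      (x.idx c ≠ 0 → L.Fits (x.ctr c)) := by
    intro c
    unfold Level.mkPortals
    by_cases h : x.idx c = 0
    · simp [h]
    · simp [h, Level.placed]
  unfold State.Fits Fits
  simp only [state, h]
  constructor
  · rintro ⟨h1, h2, h3, h4⟩
    exact ⟨⟨h1, h2, h4 _, h4 _⟩, h3⟩
  · rintro ⟨⟨h1, h2, h4, h5⟩, h3⟩
    exact ⟨h1, h2, h3, fun c => by cases c <;> assumption⟩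

def Won (L : Level) (x : Cfg) : Prop :=
  |L.goal 0 - x.pos 0| ≤ L.physics.radius ∧ |L.goal 1 - x.pos 1| ≤ L.physics.radius ∧
    x.pos 2 ≤ L.goal 2 ∧ L.goal 2 ≤ x.pos 2 + L.physics.bodyHeight x.cr

end Cfg

/-! ### Definability -/

section

variable {Γ : Type} [Ctx Γ]

/-- All components of the configuration are definable. -/
class DfnC (x : Γ → Cfg) : Prop where
  base : DfnV fun γ => (x γ).base
  disp : DfnV fun γ => (x γ).disp
  pos : DfnV fun γ => (x γ).pos
  vel : DfnV fun γ => (x γ).vel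
  k : Dfn fun γ => ((x γ).k : ℤ)
  n : Dfn fun γ => ((x γ).n : ℤ)
  rem : Dfn fun γ => ((x γ).rem : ℤ)
  cr : DfnP fun γ => (x γ).cr = true
  walk : DfnP fun γ => (x γ).walk = true
  idx : ∀ c, Dfn fun γ => ((x γ).idx c : ℤ)
  ctr : ∀ c, DfnV fun γ => (x γ).ctr c

/-- All components of the input are definable. -/
class DfnI (i : Γ → Input) : Prop where
  forward : Dfn fun γ => ((i γ).forward : ℤ)
  strafe : Dfn fun γ => ((i γ).strafe : ℤ)
  jump : DfnP fun γ => (i γ).jump = true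
  crouch : DfnP fun γ => (i γ).crouch = true
  fire : ∀ c, DfnP fun γ => (i γ).fire = some c
  cursor : DfnV fun γ => (i γ).cursor

attribute [instance] DfnC.base DfnC.disp DfnC.pos DfnC.vel DfnC.k DfnC.n DfnC.rem DfnC.cr
  DfnC.walk DfnC.idx DfnC.ctr DfnI.forward DfnI.strafe DfnI.jump DfnI.crouch DfnI.fire DfnI.cursor

instance DfnC.wk {x : Γ → Cfg} [h : DfnC x] {k : ℕ} : DfnC fun e : Ext k Γ => x e.c :=
  ⟨DfnV.wk (v := fun γ => (x γ).base), DfnV.wk (v := fun γ => (x γ).disp),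
    DfnV.wk (v := fun γ => (x γ).pos), DfnV.wk (v := fun γ => (x γ).vel),
    Dfn.wk (f := fun γ => ((x γ).k : ℤ)), Dfn.wk (f := fun γ => ((x γ).n : ℤ)),
    Dfn.wk (f := fun γ => ((x γ).rem : ℤ)), DfnP.wk (p := fun γ => (x γ).cr = true),
    DfnP.wk (p := fun γ => (x γ).walk = true),
    fun c => Dfn.wk (f := fun γ => ((x γ).idx c : ℤ)), fun c => DfnV.wk (v := fun γ => (x γ).ctr c)⟩

instance DfnV.exitPlace {cr : Γ → Bool} {i : Γ → ℕ} {v : Γ → Vec} [DfnP fun γ => cr γ = true]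
    [Dfn fun γ => (i γ : ℤ)] [DfnV v] : DfnV fun γ => (lv γ).exitPlace (cr γ) (i γ) (v γ) := by
  unfold Level.exitPlace
  infer_instance

instance DfnP.passes {idx : Γ → Color → ℕ} {ctr : Γ → Color → Vec} {cr : Γ → Bool}
    {q d : Γ → Vec} {c : Color} [∀ c, Dfn fun γ => (idx γ c : ℤ)] [∀ c, DfnV fun γ => ctr γ c]
    [DfnP fun γ => cr γ = true] [DfnV q] [DfnV d] :
    DfnP fun γ => (lv γ).Passes (idx γ) (ctr γ) (cr γ) (q γ) (d γ) c := by
  unfold Level.Passes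
  infer_instance

instance Dfn.tdiv {f g : Γ → ℤ} [Dfn f] [Dfn g] : Dfn fun γ => (f γ).tdiv (g γ) :=
  (show Dfn fun γ => (f γ).sign * (|f γ| / g γ) from inferInstance).congr fun γ => by
    rcases lt_trichotomy (f γ) 0 with h | h | h
    · rw [Int.sign_eq_neg_one_of_neg h, abs_of_neg h, ← Int.tdiv_eq_ediv_of_nonneg (by omega),
        Int.neg_tdiv]
      ring
    · simp [h]
    · rw [Int.sign_eq_one_of_pos h, abs_of_pos h, Int.tdiv_eq_ediv_of_nonneg h.le, one_mul]

instance DfnV.target {x : Γ → Cfg} [DfnC x] : DfnV fun γ => (x γ).target := by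
  refine ⟨fun j => ?_⟩
  change Dfn fun γ => (x γ).base j + ((((x γ).k : ℤ) + 1) * (x γ).disp j).tdiv (x γ).n
  infer_instance

theorem DfnC.through {x : Γ → Cfg} [DfnC x] (c : Color) :
    DfnC fun γ => (x γ).through (lv γ) c := by
  constructor <;> simp only [Cfg.through] <;> infer_instance

instance Dfn.climbRange {x : Γ → Cfg} [DfnC x] :
    Dfn fun γ => ((x γ).climbRange (lv γ) : ℤ) := by
  unfold Cfg.climbRange
  infer_instance

instance Dfn.climbIdx {x : Γ → Cfg} [DfnC x] : Dfn fun γ => ((x γ).climbIdx (lv γ) : ℤ) := by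
  unfold Cfg.climbIdx
  infer_instance

theorem DfnC.climb {x : Γ → Cfg} [DfnC x] : DfnC fun γ => (x γ).climb (lv γ) := by
  constructor <;> simp only [Cfg.climb, Nat.cast_add, Nat.cast_one] <;> infer_instance

instance DfnV.single {f : Γ → ℤ} {j : Fin 3} [Dfn f] :
    DfnV fun γ => (Pi.single j (f γ) : Vec) :=
  ⟨fun i => by
    by_cases h : i = j
    · subst h
      simpa using ‹Dfn f›
    · simp only [Pi.single_eq_of_ne h]
      infer_instance⟩

instance DfnP.stopped {x : Γ → Cfg} {j : Fin 3} [DfnC x] :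
    DfnP fun γ => (lv γ).Stopped (x γ).cr ((x γ).motion (lv γ)) j := by
  simp only [Level.Stopped, Cfg.motion]
  infer_instance

theorem DfnC.collide {x : Γ → Cfg} [DfnC x] : DfnC fun γ => (x γ).collide (lv γ) := by
  constructor <;> simp only [Cfg.collide] <;> first | infer_instance | exact ⟨fun j => inferInstance⟩

theorem apply_ite_cfg {α : Sort*} (F : Cfg → α) (p : Prop) [Decidable p] (x y : Cfg) :
    F (if p then x else y) = if p then F x else F y := apply_ite F p x y

theorem DfnC.ite {p : Γ → Prop} {d : ∀ γ, Decidable (p γ)} {x y : Γ → Cfg} [hp : DfnP p]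
    (hx : DfnC x) (hy : DfnC y) : DfnC fun γ => if p γ then x γ else y γ where
  base := by simp only [apply_ite_cfg Cfg.base]; infer_instance
  disp := by simp only [apply_ite_cfg Cfg.disp]; infer_instance
  pos := by simp only [apply_ite_cfg Cfg.pos]; infer_instance
  vel := by simp only [apply_ite_cfg Cfg.vel]; infer_instance
  k := by simp only [apply_ite_cfg Cfg.k]; infer_instance
  n := by simp only [apply_ite_cfg Cfg.n]; infer_instance
  rem := by simp only [apply_ite_cfg Cfg.rem]; infer_instance
  cr := by simp only [apply_ite_cfg fun z => z.cr = true]; infer_instance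
  walk := by simp only [apply_ite_cfg fun z => z.walk = true]; infer_instance
  idx c := by simp only [apply_ite_cfg fun z => z.idx c]; infer_instance
  ctr c := by simp only [apply_ite_cfg fun z => z.ctr c]; infer_instance

theorem DfnC.advance {x : Γ → Cfg} [DfnC x] : DfnC fun γ => (x γ).advance (lv γ) := by
  unfold Cfg.advance
  exact .ite (.through _) (.ite (.through _) (.ite .climb .collide))

theorem DfnC.fizzle {x : Γ → Cfg} [DfnC x] : DfnC fun γ => (x γ).fizzle (lv γ) := by
  constructor <;> simp only [Cfg.fizzle] <;> infer_instance

instance DfnC.substep {x : Γ → Cfg} [DfnC x] : DfnC fun γ => (x γ).substep (lv γ) := by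
  have : DfnC fun γ => (x γ).advance (lv γ) := .advance
  exact .fizzle

instance DfnV.eye {cr : Γ → Bool} {p : Γ → Vec} [DfnP fun γ => cr γ = true] [DfnV p] :
    DfnV fun γ => (lv γ).eye (cr γ) (p γ) := by
  unfold Level.eye
  infer_instance

instance DfnV.wish {i : Γ → Input} {s : Γ → ℕ} [DfnI i] [Dfn fun γ => (s γ : ℤ)] :
    DfnV fun γ => (i γ).wish (s γ) :=
  ⟨fun j => by unfold Input.wish; infer_instance⟩

instance DfnP.bool_const (b : Bool) : DfnP fun _ : Γ => b = true := DfnP.const _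

instance DfnP.bool_ite {p : Γ → Prop} {d : ∀ γ, Decidable (p γ)} {a b : Γ → Bool} [DfnP p]
    [DfnP fun γ => a γ = true] [DfnP fun γ => b γ = true] :
    DfnP fun γ => (if p γ then a γ else b γ) = true :=
  (show DfnP fun γ => if p γ then a γ = true else b γ = true from inferInstance).congr
    fun γ => by split_ifs <;> rfl

theorem DfnC.stance {i : Γ → Input} {x : Γ → Cfg} [DfnI i] [DfnC x] :
    DfnC fun γ => (x γ).stance (lv γ) (i γ) := by
  constructor <;> simp only [Cfg.stance] <;> infer_instance

theorem DfnC.fire {i : Γ → Input} {x : Γ → Cfg} [DfnI i] [DfnC x] :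
    DfnC fun γ => (x γ).fire (lv γ) (i γ) := by
  constructor <;> simp only [Cfg.fire] <;> infer_instance

instance DfnP.grounded {x : Γ → Cfg} [DfnC x] : DfnP fun γ => (x γ).Grounded (lv γ) := by
  unfold Cfg.Grounded
  infer_instance

theorem DfnC.setVel {i : Γ → Input} {x : Γ → Cfg} [DfnI i] [DfnC x] :
    DfnC fun γ => (x γ).setVel (lv γ) (i γ) := by
  constructor <;> simp only [Cfg.setVel, Bool.and_eq_true, Bool.not_eq_true', decide_eq_true_eq,
    ← Bool.not_eq_true] <;> infer_instance

theorem DfnC.setCount {x : Γ → Cfg} [DfnC x] : DfnC fun γ => (x γ).setCount := by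
  constructor <;> simp only [Cfg.setCount, Cfg.count] <;> infer_instance

instance DfnC.start {i : Γ → Input} {x : Γ → Cfg} [DfnI i] [DfnC x] :
    DfnC fun γ => (x γ).start (lv γ) (i γ) := by
  have h1 : DfnC fun γ => (x γ).stance (lv γ) (i γ) := .stance
  have h2 : DfnC fun γ => ((x γ).stance (lv γ) (i γ)).fire (lv γ) (i γ) := .fire
  have h3 : DfnC fun γ => (((x γ).stance (lv γ) (i γ)).fire (lv γ) (i γ)).setVel (lv γ) (i γ) :=
    .setVel
  exact .setCount

instance DfnC.initial : DfnC fun γ : Γ => Cfg.initial (lv γ) := by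
  constructor <;> simp only [Cfg.initial] <;> infer_instance

instance DfnP.vec_fits {v : Γ → Vec} [DfnV v] : DfnP fun γ => (lv γ).Fits (v γ) := by
  unfold Level.Fits
  infer_instance

instance DfnP.fits {x : Γ → Cfg} [DfnC x] : DfnP fun γ => (x γ).Fits (lv γ) := by
  unfold Cfg.Fits
  infer_instance

instance DfnP.won {x : Γ → Cfg} [DfnC x] : DfnP fun γ => (x γ).Won (lv γ) := by
  unfold Cfg.Won
  infer_instance

instance DfnP.legal {i : Γ → Input} [DfnI i] : DfnP fun γ => (i γ).Legal (lv γ) := by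
  unfold Input.Legal
  infer_instance

theorem DfnP.cfg_eq {x y : Γ → Cfg} [DfnC x] [DfnC y] : DfnP fun γ => x γ = y γ :=
  (show DfnP fun γ => (x γ).base = (y γ).base ∧ (x γ).disp = (y γ).disp ∧ (x γ).pos = (y γ).pos ∧
    (x γ).vel = (y γ).vel ∧ (x γ).k = (y γ).k ∧ (x γ).n = (y γ).n ∧ (x γ).rem = (y γ).rem ∧
    ((x γ).cr = (y γ).cr) ∧ ((x γ).walk = (y γ).walk) ∧ (x γ).idx .blue = (y γ).idx .blue ∧
    (x γ).idx .orange = (y γ).idx .orange ∧ (x γ).ctr .blue = (y γ).ctr .blue ∧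
    (x γ).ctr .orange = (y γ).ctr .orange from inferInstance).congr fun γ => by
      constructor
      · intro h
        simp [h]
      · rintro ⟨h1, h2, h3, h4, h5, h6, h7, h8, h9, h10, h11, h12, h13⟩
        ext1 <;> first | assumption | (funext c; cases c <;> assumption)

end

end PortalGame

end

/-! ## Bounds for vectors that pass through portals -/

noncomputable section

namespace PortalGame

open scoped Classical
open Ram

theorem abs_divSqrt_le (k : ℤ) (N : ℕ) : |divSqrt k N| ≤ |k| := by
  rw [divSqrt, abs_mul, Nat.abs_cast]
  have h1 : Nat.sqrt (k.natAbs ^ 2 / N) ≤ k.natAbs :=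
    (Nat.sqrt_le_sqrt (Nat.div_le_self _ _)).trans (by rw [Nat.sqrt_eq'])
  have h2 : |k.sign| ≤ 1 := by
    rcases lt_trichotomy k 0 with h | h | h
    · simp [Int.sign_eq_neg_one_of_neg h]
    · simp [h]
    · simp [Int.sign_eq_one_of_pos h]
  rw [Int.abs_eq_natAbs k]
  calc |k.sign| * (Nat.sqrt (k.natAbs ^ 2 / N) : ℤ) ≤ 1 * (k.natAbs : ℤ) :=
        mul_le_mul h2 (by exact_mod_cast h1) (by positivity) one_pos.le
    _ = _ := one_mul _

/-- The integer root `s` satisfies `s ^ 2 * N ≤ k ^ 2 < (s + 1) ^ 2 * N` in spite of the integer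
quotient under it. For `N = 0` both quantities are zero by convention. -/
theorem abs_divSqrt_sub_le (k : ℤ) (N : ℕ) : |(divSqrt k N : ℝ) - k / √N| ≤ 1 := by
  rcases Nat.eq_zero_or_pos N with rfl | hN
  · simp [divSqrt]
  set s := Nat.sqrt (k.natAbs ^ 2 / N) with hs
  have hN' : (0 : ℝ) < N := by exact_mod_cast hN
  have h1 : (s : ℝ) ≤ |(k : ℝ)| / √N := by
    rw [le_div_iff₀ (Real.sqrt_pos.2 hN')]
    apply abs_le_of_sq_le_sq' _ (abs_nonneg _) |>.2
    rw [mul_pow, Real.sq_sqrt hN'.le, sq_abs]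
    have h2 : s ^ 2 * N ≤ k.natAbs ^ 2 :=
      (Nat.mul_le_mul_right _ (Nat.sqrt_le' _)).trans (Nat.div_mul_le_self _ _)
    have h3 : ((s ^ 2 * N : ℕ) : ℤ) ≤ k ^ 2 := by
      rw [← Int.natAbs_sq k]
      exact_mod_cast h2
    exact_mod_cast h3
  have h2 : |(k : ℝ)| / √N ≤ s + 1 := by
    rw [div_le_iff₀ (Real.sqrt_pos.2 hN')]
    apply abs_le_of_sq_le_sq' _ (by positivity) |>.2
    rw [mul_pow, Real.sq_sqrt hN'.le, sq_abs]
    have h2 : k.natAbs ^ 2 < (s + 1) ^ 2 * N := by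
      rw [← Nat.div_lt_iff_lt_mul hN]
      exact Nat.lt_succ_sqrt' _
    have h3 : k ^ 2 ≤ (((s + 1) ^ 2 * N : ℕ) : ℤ) := by
      rw [← Int.natAbs_sq k]
      exact_mod_cast h2.le
    exact_mod_cast h3
  have hd : divSqrt k N = k.sign * (s : ℤ) := rfl
  rw [hd]
  rcases lt_trichotomy k 0 with h | h | h
  · rw [Int.sign_eq_neg_one_of_neg h]
    rw [abs_of_neg (by exact_mod_cast h), neg_div] at h1 h2
    push_cast
    rw [abs_le]
    constructor <;> linarith
  · simp [h]
  · rw [Int.sign_eq_one_of_pos h]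
    rw [abs_of_pos (by exact_mod_cast h)] at h1 h2
    push_cast
    rw [abs_le]
    constructor <;> linarith

/-! ### Orthogonal frames and the norm of a transported vector -/

section

variable {E : Type*} [NormedAddCommGroup E] [InnerProductSpace ℝ E]

open scoped RealInnerProductSpace

theorem norm_sq_add_three {a b c : E} (hab : ⟪a, b⟫ = 0) (hac : ⟪a, c⟫ = 0) (hbc : ⟪b, c⟫ = 0) :
    ‖a + b + c‖ ^ 2 = ‖a‖ ^ 2 + ‖b‖ ^ 2 + ‖c‖ ^ 2 := by
  rw [norm_add_sq_real, norm_add_sq_real, inner_add_left, hab, hac, hbc]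
  ring

/-- Bessel's inequality for vectors that are not normalized, from the residual having nonnegative
squared norm. A zero vector contributes nothing, as division by zero gives zero. -/
theorem sum_sq_inner_div_le (v : E) {e₁ e₂ e₃ : E} (h₁₂ : ⟪e₁, e₂⟫ = 0) (h₁₃ : ⟪e₁, e₃⟫ = 0)
    (h₂₃ : ⟪e₂, e₃⟫ = 0) :
    (⟪v, e₁⟫ / ‖e₁‖) ^ 2 + (⟪v, e₂⟫ / ‖e₂‖) ^ 2 + (⟪v, e₃⟫ / ‖e₃‖) ^ 2 ≤ ‖v‖ ^ 2 := by
  set g : E → E := fun e => (⟪v, e⟫ / ‖e‖ ^ 2) • e with hg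
  have hvg : ∀ e, ⟪v, g e⟫ = (⟪v, e⟫ / ‖e‖) ^ 2 := fun e => by
    simp only [hg, inner_smul_right]
    ring
  have hgg : ∀ e, ‖g e‖ ^ 2 = (⟪v, e⟫ / ‖e‖) ^ 2 := fun e => by
    simp only [hg, norm_smul, mul_pow, Real.norm_eq_abs, sq_abs]
    by_cases he : ‖e‖ = 0
    · simp [he]
    · field_simp
  have hort : ∀ {e f : E}, ⟪e, f⟫ = 0 → ⟪g e, g f⟫ = 0 := fun h => by
    simp [hg, inner_smul_left, inner_smul_right, h]
  have h0 : (0 : ℝ) ≤ ‖v - (g e₁ + g e₂ + g e₃)‖ ^ 2 := by positivity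
  rw [norm_sub_sq_real, norm_sq_add_three (hort h₁₂) (hort h₁₃) (hort h₂₃), inner_add_right,
    inner_add_right] at h0
  simp only [hvg, hgg] at h0
  linarith

/-- The passage through a portal before rounding: the components along one orthogonal frame are
carried to another. Pythagoras and Bessel give the estimate, and the vectors need not be nonzero. -/
theorem norm_rotate_le (v : E) {e₁ e₂ e₃ f₁ f₂ f₃ : E} (h₁₂ : ⟪e₁, e₂⟫ = 0) (h₁₃ : ⟪e₁, e₃⟫ = 0)
    (h₂₃ : ⟪e₂, e₃⟫ = 0) (k₁₂ : ⟪f₁, f₂⟫ = 0) (k₁₃ : ⟪f₁, f₃⟫ = 0) (k₂₃ : ⟪f₂, f₃⟫ = 0) :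
    ‖(-⟪v, e₁⟫ / (‖e₁‖ * ‖f₁‖)) • f₁ + (⟪v, e₂⟫ / (‖e₂‖ * ‖f₂‖)) • f₂ +
      (-⟪v, e₃⟫ / (‖e₃‖ * ‖f₃‖)) • f₃‖ ≤ ‖v‖ := by
  apply abs_le_of_sq_le_sq' _ (norm_nonneg _) |>.2
  have hort : ∀ (s t : ℝ) {e f : E}, ⟪e, f⟫ = 0 → ⟪s • e, t • f⟫ = 0 := fun s t _ _ h => by
    simp [inner_smul_left, inner_smul_right, h]
  rw [norm_sq_add_three (hort _ _ k₁₂) (hort _ _ k₁₃) (hort _ _ k₂₃)]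
  refine le_trans ?_ (sum_sq_inner_div_le v h₁₂ h₁₃ h₂₃)
  have key : ∀ (s : ℝ) (e f : E), ‖(s / (‖e‖ * ‖f‖)) • f‖ ^ 2 ≤ (s / ‖e‖) ^ 2 := fun s e f => by
    rw [norm_smul, mul_pow, Real.norm_eq_abs, sq_abs]
    by_cases hf : ‖f‖ = 0
    · simpa [hf] using sq_nonneg (s / ‖e‖)
    · by_cases he : ‖e‖ = 0
      · simp [he]
      · apply le_of_eq
        field_simp
  refine add_le_add (add_le_add ((key _ _ _).trans_eq ?_) (key _ _ _)) ((key _ _ _).trans_eq ?_) <;>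
    ring

end

/-- An integer vector as a point of Euclidean space. -/
def toEuclidean (v : Vec) : EuclideanSpace ℝ (Fin 3) := WithLp.toLp 2 fun j => (v j : ℝ)

theorem toEuclidean_apply (v : Vec) (j : Fin 3) : toEuclidean v j = v j := rfl

theorem inner_toEuclidean (v w : Vec) :
    inner ℝ (toEuclidean v) (toEuclidean w) = ((v ⬝ᵥ w : ℤ) : ℝ) := by
  simp [PiLp.inner_apply, toEuclidean_apply, dotProduct, mul_comm]

/-- The Euclidean norm of an integer vector. -/
def eucl (v : Vec) : ℝ := ‖toEuclidean v‖

theorem sqrt_dot_mul_dot (v w : Vec) :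
    √((((v ⬝ᵥ v) * (w ⬝ᵥ w)).toNat : ℕ) : ℝ) = eucl v * eucl w := by
  have h : ((((v ⬝ᵥ v) * (w ⬝ᵥ w)).toNat : ℕ) : ℝ) = (eucl v * eucl w) ^ 2 := by
    have h0 : ∀ v : Vec, 0 ≤ v ⬝ᵥ v := fun v => by
      simp only [dotProduct, Fin.sum_univ_three]
      nlinarith [mul_self_nonneg (v 0), mul_self_nonneg (v 1), mul_self_nonneg (v 2)]
    have h1 : ((((v ⬝ᵥ v) * (w ⬝ᵥ w)).toNat : ℕ) : ℝ) = (((v ⬝ᵥ v) * (w ⬝ᵥ w) : ℤ) : ℝ) := by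
      exact_mod_cast congrArg (Int.cast (R := ℝ)) (Int.toNat_of_nonneg (mul_nonneg (h0 v) (h0 w)))
    rw [h1, Int.cast_mul, ← inner_toEuclidean, ← inner_toEuclidean, real_inner_self_eq_norm_sq,
      real_inner_self_eq_norm_sq, eucl, eucl, mul_pow]
  rw [h]
  exact Real.sqrt_sq (mul_nonneg (norm_nonneg (toEuclidean v)) (norm_nonneg (toEuclidean w)))

theorem abs_le_eucl (v : Vec) (j : Fin 3) : (|v j| : ℝ) ≤ eucl v := by
  have := PiLp.norm_apply_le (toEuclidean v) j
  rwa [Real.norm_eq_abs, toEuclidean_apply] at this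

theorem norm_le_two_mul {x : EuclideanSpace ℝ (Fin 3)} {M : ℝ} (h : ∀ j, |x j| ≤ M) :
    ‖x‖ ≤ 2 * M := by
  have hM : 0 ≤ M := (abs_nonneg _).trans (h 0)
  rw [EuclideanSpace.norm_eq, Real.sqrt_le_left (by linarith), Fin.sum_univ_three]
  have : ∀ j, ‖x j‖ ^ 2 ≤ M ^ 2 := fun j => by
    rw [Real.norm_eq_abs]
    exact pow_le_pow_left₀ (abs_nonneg _) (h j) 2
  nlinarith [this 0, this 1, this 2]

theorem eucl_le_two_mul {v : Vec} {M : ℤ} (h : ∀ j, |v j| ≤ M) : eucl v ≤ 2 * M :=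
  norm_le_two_mul fun j => by
    rw [toEuclidean_apply, ← Int.cast_abs]
    exact Int.cast_le.2 (h j)

theorem eucl_erase_le (v : Vec) (p : Fin 3 → Prop) :
    eucl (fun j => if p j then 0 else v j) ≤ eucl v := by
  rw [eucl, eucl, EuclideanSpace.norm_eq, EuclideanSpace.norm_eq]
  refine Real.sqrt_le_sqrt (Finset.sum_le_sum fun j _ => ?_)
  simp only [toEuclidean_apply]
  split_ifs
  · simp only [Int.cast_zero, norm_zero, ne_eq, OfNat.ofNat_ne_zero, not_false_eq_true, zero_pow]
    positivity
  · exact le_rfl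

theorem dot_upright (n : Vec) : n ⬝ᵥ upright n = 0 := by
  simp only [upright, dotProduct_sub, dotProduct_smul, smul_eq_mul]
  ring

/-- Passing through a portal increases the norm of a vector by a bounded amount. -/
theorem eucl_turn_le (n m v : Vec) : eucl (turn n m v) ≤ eucl v + 6 := by
  set u := upright n with hu
  set u' := upright m with hu'
  set w := n ⨯₃ u with hw
  set w' := m ⨯₃ u' with hw'
  have ort : ∀ {a b : Vec}, a ⬝ᵥ b = 0 → inner ℝ (toEuclidean a) (toEuclidean b) = 0 := fun h => by
    rw [inner_toEuclidean, h, Int.cast_zero]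
  have hrot := norm_rotate_le (toEuclidean v) (ort (dot_upright n)) (ort (dot_self_cross n u))
    (ort (dot_cross_self n u)) (ort (dot_upright m)) (ort (dot_self_cross m u'))
    (ort (dot_cross_self m u'))
  set T := (-inner ℝ (toEuclidean v) (toEuclidean n) / (‖toEuclidean n‖ * ‖toEuclidean m‖)) •
      toEuclidean m + (inner ℝ (toEuclidean v) (toEuclidean u) /
        (‖toEuclidean u‖ * ‖toEuclidean u'‖)) • toEuclidean u' +
      (-inner ℝ (toEuclidean v) (toEuclidean w) / (‖toEuclidean w‖ * ‖toEuclidean w'‖)) •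
        toEuclidean w' with hT
  -- Each coordinate is a sum of three rounded numbers and so has error at most three; the factor
  -- two is a bound for `√3`.
  have herr : ‖toEuclidean (turn n m v) - T‖ ≤ 2 * 3 := by
    refine norm_le_two_mul fun j => ?_
    have h1 := abs_divSqrt_sub_le (-(v ⬝ᵥ n) * m j) ((n ⬝ᵥ n) * (m ⬝ᵥ m)).toNat
    have h2 := abs_divSqrt_sub_le ((v ⬝ᵥ u) * u' j) ((u ⬝ᵥ u) * (u' ⬝ᵥ u')).toNat
    have h3 := abs_divSqrt_sub_le (-(v ⬝ᵥ w) * w' j) ((w ⬝ᵥ w) * (w' ⬝ᵥ w')).toNat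
    rw [sqrt_dot_mul_dot] at h1 h2 h3
    have hTj : T j = ((-(v ⬝ᵥ n) * m j : ℤ) : ℝ) / (eucl n * eucl m) +
        (((v ⬝ᵥ u) * u' j : ℤ) : ℝ) / (eucl u * eucl u') +
        ((-(v ⬝ᵥ w) * w' j : ℤ) : ℝ) / (eucl w * eucl w') := by
      simp only [hT, PiLp.add_apply, PiLp.smul_apply, smul_eq_mul, inner_toEuclidean,
        toEuclidean_apply, eucl]
      push_cast
      ring
    have hj : toEuclidean (turn n m v) j =
        (divSqrt (-(v ⬝ᵥ n) * m j) ((n ⬝ᵥ n) * (m ⬝ᵥ m)).toNat : ℝ) +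
        divSqrt ((v ⬝ᵥ u) * u' j) ((u ⬝ᵥ u) * (u' ⬝ᵥ u')).toNat +
        divSqrt (-(v ⬝ᵥ w) * w' j) ((w ⬝ᵥ w) * (w' ⬝ᵥ w')).toNat := by
      rw [toEuclidean_apply, turn]
      push_cast
      rfl
    rw [PiLp.sub_apply, hTj, hj]
    rw [abs_le] at h1 h2 h3 ⊢
    constructor <;> linarith
  calc eucl (turn n m v) = ‖T + (toEuclidean (turn n m v) - T)‖ := by
        rw [add_sub_cancel]
        rfl
    _ ≤ ‖T‖ + ‖toEuclidean (turn n m v) - T‖ := norm_add_le _ _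
    _ ≤ eucl v + 6 := by
        have : ‖T‖ ≤ eucl v := hrot
        linarith

end PortalGame

end

/-! ## The graph of configurations -/

noncomputable section

namespace PortalGame

open scoped Classical
open Ram

/-- The configurations that occur in a game. -/
inductive CReach (L : Level) : Cfg → Prop
  | initial : CReach L (Cfg.initial L)
  | start {x : Cfg} {i : Input} : CReach L x → x.rem = 0 → x.Fits L → i.Legal L →
      CReach L (x.start L i)
  | substep {x : Cfg} : CReach L x → 0 < x.rem → CReach L (x.substep L)

/-- When no substep remains, a configuration inside a tick is at its end, and `hfit` makes that tick
an edge of the state graph. -/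
theorem reachable_of_origin {L : Level} {x : Cfg} (hrem : x.rem = 0) (hfit : x.Fits L)
    (h : (x.rem = 0 ∧ ∃ look, Relation.ReflTransGen L.Step L.startState (x.state L look)) ∨
      ∃ y look i j, Relation.ReflTransGen L.Step L.startState (Cfg.state L look y) ∧ i.Legal L ∧
        j ≤ (y.start L i).n ∧ x = (Cfg.substep L)^[j] (y.start L i)) :
    ∃ look, Relation.ReflTransGen L.Step L.startState (x.state L look) := by
  rcases h with ⟨-, h⟩ | ⟨y, look, i, j, h1, h2, h3, rfl⟩
  · exact h
  · have h4 := (Cfg.iterate_substep_fields L (y.start L i) j).2.2.2.1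
    rw [hrem, Cfg.start_rem] at h4
    obtain rfl : j = (y.start L i).n := by omega
    refine ⟨i.cursor, h1.tail ⟨i, h2, (Cfg.tick_state L look i y).symm, ?_⟩⟩
    exact (Cfg.state_fits L _ _).2 ⟨hfit, h2.2⟩

/-- The invariant that makes the refined graph sound: a configuration is a reachable state or lies
on the path of a tick that began in one. -/
theorem CReach.origin {L : Level} {x : Cfg} (h : CReach L x) :
    (x.rem = 0 ∧ ∃ look, Relation.ReflTransGen L.Step L.startState (x.state L look)) ∨
      ∃ y look i j, Relation.ReflTransGen L.Step L.startState (Cfg.state L look y) ∧ i.Legal L ∧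
        j ≤ (y.start L i).n ∧ x = (Cfg.substep L)^[j] (y.start L i) := by
  induction h with
  | initial => exact Or.inl ⟨rfl, _, Relation.ReflTransGen.refl⟩
  | @start x i _ hrem hfit hi ih =>
    obtain ⟨look, h⟩ := reachable_of_origin hrem hfit ih
    exact Or.inr ⟨x, look, i, 0, h, hi, Nat.zero_le _, rfl⟩
  | @substep x _ hrem ih =>
    rcases ih with ⟨h, -⟩ | ⟨y, look, i, j, h1, h2, h3, rfl⟩
    · omega
    · have h4 := (Cfg.iterate_substep_fields L (y.start L i) j).2.2.2.1
      rw [Cfg.start_rem] at h4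
      exact Or.inr ⟨y, look, i, j + 1, h1, h2, by omega, (Function.iterate_succ_apply' _ _ _).symm⟩

theorem CReach.iterate_substep {L : Level} {x : Cfg} (h : CReach L x) {j : ℕ} (hj : j ≤ x.rem) :
    CReach L ((Cfg.substep L)^[j] x) := by
  induction j with
  | zero => exact h
  | succ j ih =>
    rw [Function.iterate_succ_apply']
    refine .substep (ih (by omega)) ?_
    rw [(Cfg.iterate_substep_fields L x j).2.2.2.1]
    omega

/-- Conversely, every tick is a path of configurations, and the requirement of representability
reappears as the condition for starting the next tick. -/
theorem exists_cfg_of_reachable {L : Level} (hwf : L.WellFormed) {s : State}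
    (h : Relation.ReflTransGen L.Step L.startState s) :
    ∃ x look, s = Cfg.state L look x ∧ CReach L x ∧ x.rem = 0 ∧ x.Fits L := by
  induction h with
  | refl =>
    refine ⟨Cfg.initial L, _, (Cfg.initial_state L).symm, .initial, rfl, hwf.2.1, fun j => ?_,
      fun h => absurd rfl h, fun h => absurd rfl h⟩
    simp [Cfg.initial]
  | tail _ hs ih =>
    obtain ⟨x, look, rfl, h1, h2, h3⟩ := ih
    obtain ⟨i, hi, rfl, hfit⟩ := hs
    rw [Cfg.tick_state, Cfg.state_fits] at hfit
    refine ⟨_, _, Cfg.tick_state L look i x, (h1.start h2 h3 hi).iterate_substep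
      (Cfg.start_rem L i x).ge, ?_, hfit.1⟩
    rw [(Cfg.iterate_substep_fields L _ _).2.2.2.1, Cfg.start_rem, Nat.sub_self]

theorem traversable_iff {L : Level} (hwf : L.WellFormed) :
    L.Traversable ↔ ∃ x, CReach L x ∧ x.rem = 0 ∧ x.Fits L ∧ x.Won L := by
  constructor
  · rintro ⟨s, h, hw⟩
    obtain ⟨x, look, rfl, h1, h2, h3⟩ := exists_cfg_of_reachable hwf h
    exact ⟨x, h1, h2, h3, hw⟩
  · rintro ⟨x, h1, h2, h3, h4⟩
    obtain ⟨look, h⟩ := reachable_of_origin h2 h3 h1.origin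
    exact ⟨_, h, h4⟩

/-! ### Bounds -/

namespace Base

variable (b : Base)

/-- A crude bound for the coordinates of velocity and displacement at the beginning of a tick: `2 *
b.size ^ 2` for the velocity requested by the keys, and `2 * b.size` for a representable velocity
with gravity, or for the jump speed. -/
def maxSpeed : ℤ := 2 * (b.size : ℤ) ^ 2 + 2 * b.size

def maxCount : ℤ := 3 * b.maxSpeed + 2

/-- The Euclidean norm is at most twice the largest coordinate at the beginning of a tick, and each
substep adds at most six. -/
def maxNorm : ℤ := 2 * b.maxSpeed + 6 * b.maxCount

/-- A bound for the places where the avatar leaves a portal. -/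
def maxExit : ℤ := b.size + (3 * b.size + 4) * (8 * (b.size : ℤ) ^ 2)

/-- The largest change of position by a move in one substep: a due displacement, estimated without
its denominator, and a step that is climbed. -/
def maxMove : ℤ := b.maxCount * b.maxNorm + b.size

def maxPos : ℤ := b.maxExit + b.maxCount * b.maxMove

theorem physics_le {z : ℕ} (h : (z : ℤ) ∈ b.lvl.physics.encode) : (z : ℤ) ≤ b.size :=
  (le_abs_self _).trans (b.mem_encode_le (by simp [Level.encode, h]))

theorem surfaces_length_le : (b.lvl.surfaces.length : ℤ) ≤ b.size :=
  (le_abs_self _).trans (b.mem_encode_le (by simp [Level.encode]))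

variable {b}

theorem abs_le_of_fits {v : Vec} (h : b.lvl.Fits v) (j : Fin 3) : |v j| ≤ b.size :=
  (h j).trans b.range_le

theorem abs_normalAt_le (i : ℕ) (j : Fin 3) : |b.lvl.normalAt i j| ≤ 8 * (b.size : ℤ) ^ 2 := by
  obtain ⟨-, h⟩ := surfAt_props b (i - 1)
  set P := (b.lvl.surfAt (i - 1)).shape with hP
  have ha := h P.a (by simp [Polygon.corners])
  have hb := h P.b (by simp [Polygon.corners])
  have hc := h P.c (by simp [Polygon.corners])
  have key : ∀ k l, |(P.b - P.a) k * (P.c - P.a) l| ≤ 4 * (b.size : ℤ) ^ 2 := by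
    intro k l
    rw [abs_mul]
    have h1 : |(P.b - P.a) k| ≤ 2 * b.size := (abs_sub _ _).trans (by linarith [ha k, hb k])
    have h2 : |(P.c - P.a) l| ≤ 2 * b.size := (abs_sub _ _).trans (by linarith [ha l, hc l])
    calc _ ≤ (2 * b.size : ℤ) * (2 * b.size) := mul_le_mul h1 h2 (abs_nonneg _) (by positivity)
      _ = _ := by ring
  have hsub : ∀ k l k' l', |(P.b - P.a) k * (P.c - P.a) l - (P.b - P.a) k' * (P.c - P.a) l'| ≤
      8 * (b.size : ℤ) ^ 2 := fun k l k' l' =>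
    (abs_sub _ _).trans (by linarith [key k l, key k' l'])
  change |P.normal j| ≤ _
  rw [Polygon.normal, cross_apply]
  fin_cases j
  exacts [hsub 1 2 2 1, hsub 2 0 0 2, hsub 0 1 1 0]

theorem abs_exitPlace_le {cr : Bool} {i : ℕ} {v : Vec} (hv : ∀ j, |v j| ≤ b.size) (j : Fin 3) :
    |b.lvl.exitPlace cr i v j| ≤ b.maxExit := by
  have h1 : (b.lvl.exitIdx cr i v : ℤ) ≤ 3 * b.size + 4 := by
    have h1 : b.lvl.exitIdx cr i v ≤ b.lvl.exitRange := firstIdx_le _ _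
    have h2 := b.physics_le (z := b.lvl.physics.radius) (by simp [Physics.encode])
    have h3 := b.physics_le (z := b.lvl.physics.height) (by simp [Physics.encode])
    unfold Level.exitRange at h1
    omega
  have h2 : b.lvl.exitPlace cr i v j = v j + divSqrt ((b.lvl.exitIdx cr i v : ℤ) *
    b.lvl.normalAt i j) (b.lvl.normalAt i ⬝ᵥ b.lvl.normalAt i).toNat := rfl
  rw [h2, maxExit]
  refine (abs_add_le _ _).trans (add_le_add (hv j) ((abs_divSqrt_le _ _).trans ?_))
  rw [abs_mul, Nat.abs_cast]
  exact mul_le_mul h1 (abs_normalAt_le i j) (abs_nonneg _) (by positivity)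

theorem abs_le_of_mem_region {P : Polygon} {M : ℤ} (h : ∀ v ∈ P.corners, ∀ j, |v j| ≤ M)
    {x : Point} (hx : x ∈ P.region) (j : Fin 3) : -(M : ℝ) ≤ x j ∧ x j ≤ M := by
  have hsub : P.region ⊆ Set.pi Set.univ fun _ : Fin 3 => Set.Icc (-(M : ℝ)) M := by
    refine convexHull_min ?_ (convex_pi fun _ _ => convex_Icc _ _)
    rintro _ ⟨v, hv, rfl⟩ j -
    have := abs_le.1 (h v hv j)
    change -(M : ℝ) ≤ (v j : ℝ) ∧ (v j : ℝ) ≤ M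
    exact_mod_cast this
  exact hsub hx j trivial

/-- The point that is hit lies in the polygon, hence between integer bounds, and rounding to the
nearest integer does not cross them. -/
theorem abs_shotCenter_le {e d : Vec} (h : b.lvl.shotIdx e d < b.lvl.surfaces.length)
    (j : Fin 3) : |b.lvl.shotCenter e d j| ≤ b.size := by
  have hs : b.lvl.ShotLandsOn e d (b.lvl.surfAt (b.lvl.shotIdx e d)) := firstIdx_spec h
  have hhit := hs.2.2.1
  have hpos := hhit.den_pos
  have hmem := hhit.2.2
  rw [rayPoint_eq hpos] at hmem
  obtain ⟨h1, h2⟩ := abs_le_of_mem_region (surfAt_props b (b.lvl.shotIdx e d)).2 hmem j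
  have hpos' : (0 : ℝ) < rayDen d (b.lvl.surfAt (b.lvl.shotIdx e d)).shape := by
    exact_mod_cast hpos
  rw [le_div_iff₀ hpos'] at h1
  rw [div_le_iff₀ hpos'] at h2
  have h1 : -(b.size : ℤ) * rayDen d (b.lvl.surfAt (b.lvl.shotIdx e d)).shape ≤
    rayTip e d (b.lvl.surfAt (b.lvl.shotIdx e d)).shape j := by exact_mod_cast h1
  have h2 : rayTip e d (b.lvl.surfAt (b.lvl.shotIdx e d)).shape j ≤
    (b.size : ℤ) * rayDen d (b.lvl.surfAt (b.lvl.shotIdx e d)).shape := by exact_mod_cast h2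
  simp only [Level.shotCenter]
  rw [abs_le]
  constructor
  · rw [Int.le_ediv_iff_mul_le (by omega)]
    linarith
  · rw [← Int.lt_add_one_iff, Int.ediv_lt_iff_lt_mul (by omega)]
    linarith

theorem abs_wish_le {i : Input} (hi : i.Legal b.lvl) {s : ℕ} (hs : (s : ℤ) ≤ b.size)
    (j : Fin 3) : |i.wish s j| ≤ 2 * (b.size : ℤ) ^ 2 := by
  refine (abs_divSqrt_le _ _).trans ?_
  have hsign : ∀ t : SignType, |(t : ℤ)| ≤ 1 := by decide
  have hprod : ∀ (t : SignType) k, |(t : ℤ) * i.cursor k| ≤ b.size := fun t k => by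
    rw [abs_mul]
    calc |(t : ℤ)| * |i.cursor k| ≤ 1 * b.size :=
          mul_le_mul (hsign t) (abs_le_of_fits hi.2 k) (abs_nonneg _) one_pos.le
      _ = _ := one_mul _
  rw [abs_mul, Nat.abs_cast, show 2 * (b.size : ℤ) ^ 2 = b.size * (2 * b.size) by ring]
  refine mul_le_mul hs ?_ (abs_nonneg _) (by positivity)
  fin_cases j
  · exact (abs_add_le _ _).trans (by linarith [hprod i.forward 0, hprod i.strafe 1])
  · exact (abs_sub _ _).trans (by linarith [hprod i.forward 1, hprod i.strafe 0])
  · simp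

end Base

/-- Bounds for the components of a configuration that occurs in a game. -/
structure Bounded (b : Base) (x : Cfg) : Prop where
  n : (x.n : ℤ) ≤ b.maxCount
  k : x.k + x.rem ≤ x.n
  disp : eucl x.disp ≤ 2 * b.maxSpeed + 6 * ((x.n - x.rem : ℤ) : ℝ)
  vel : eucl x.vel ≤ 2 * b.maxSpeed + 6 * ((x.n - x.rem : ℤ) : ℝ)
  pos : ∀ j, |x.pos j| ≤ b.maxExit + (x.n - x.rem : ℤ) * b.maxMove
  base : ∀ j, |x.base j| ≤ b.maxExit + (x.n - x.rem : ℤ) * b.maxMove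
  idx : ∀ c, x.idx c ≤ b.lvl.surfaces.length
  ctr : ∀ c j, |x.ctr c j| ≤ b.size

section

variable {b : Base} {x : Cfg}

theorem Base.size_pos (b : Base) : 0 < (b.size : ℤ) := by
  have := two_le_sz b
  change 2 ≤ b.size at this
  omega

theorem Base.maxSpeed_nonneg (b : Base) : 0 ≤ b.maxSpeed := by
  unfold Base.maxSpeed
  positivity

theorem Base.maxCount_nonneg (b : Base) : 0 ≤ b.maxCount := by
  have := b.maxSpeed_nonneg
  unfold Base.maxCount
  positivity

theorem Base.maxNorm_nonneg (b : Base) : 0 ≤ b.maxNorm := by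
  have := b.maxSpeed_nonneg
  have := b.maxCount_nonneg
  unfold Base.maxNorm
  positivity

theorem Base.size_le_maxExit (b : Base) : (b.size : ℤ) ≤ b.maxExit := by
  unfold Base.maxExit
  have : 0 ≤ (3 * (b.size : ℤ) + 4) * (8 * (b.size : ℤ) ^ 2) := by positivity
  linarith

theorem Base.size_le_maxMove (b : Base) : (b.size : ℤ) ≤ b.maxMove := by
  unfold Base.maxMove
  have := mul_nonneg b.maxCount_nonneg b.maxNorm_nonneg
  linarith

theorem bounded_initial (b : Base) : Bounded b (Cfg.initial b.lvl) where
  n := b.maxCount_nonneg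
  k := le_rfl
  disp := by
    have : (0 : ℝ) ≤ b.maxSpeed := by exact_mod_cast b.maxSpeed_nonneg
    refine (eucl_le_two_mul (M := 0) fun j => by simp [Cfg.initial]).trans ?_
    simp [Cfg.initial, this]
  vel := by
    have : (0 : ℝ) ≤ b.maxSpeed := by exact_mod_cast b.maxSpeed_nonneg
    refine (eucl_le_two_mul (M := 0) fun j => by simp [Cfg.initial]).trans ?_
    simp [Cfg.initial, this]
  pos j := by
    simpa [Cfg.initial] using (Base.abs_le_of_fits b.wf.2.1 j).trans b.size_le_maxExit
  base j := by
    simpa [Cfg.initial] using (Base.abs_le_of_fits b.wf.2.1 j).trans b.size_le_maxExit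
  idx _ := Nat.zero_le _
  ctr _ j := by simp [Cfg.initial]

/-- Nothing accumulates from tick to tick: `hfit` bounds position and velocity anew by the size.
Only the bounds for the portals are inherited. -/
theorem Bounded.start (hb : Bounded b x) (hfit : x.Fits b.lvl) {i : Input}
    (hi : i.Legal b.lvl) : Bounded b (x.start b.lvl i) := by
  have hg := b.physics_le (z := b.lvl.physics.gravity) (by simp [Physics.encode])
  have hj := b.physics_le (z := b.lvl.physics.jumpSpeed) (by simp [Physics.encode])
  have hw := b.physics_le (z := b.lvl.physics.walkSpeed) (by simp [Physics.encode])
  have ha := b.physics_le (z := b.lvl.physics.airSpeed) (by simp [Physics.encode])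
  have hup : ∀ {z : ℕ}, (z : ℤ) ≤ b.size → ∀ j, |((z : ℤ) • up) j| ≤ b.size := by
    intro z hz j
    fin_cases j <;> simp [up, hz]
  have hground : ∀ j, |(i.wish b.lvl.physics.walkSpeed + (if i.jump then
      (b.lvl.physics.jumpSpeed : ℤ) • up else 0)) j| ≤ b.maxSpeed - b.size := by
    intro j
    refine (abs_add_le _ _).trans ?_
    have h1 := Base.abs_wish_le hi hw j
    have h2 : |(if i.jump then (b.lvl.physics.jumpSpeed : ℤ) • up else 0 : Vec) j| ≤ b.size := by
      split_ifs
      · exact hup hj j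
      · simp
    unfold Base.maxSpeed
    linarith
  have hair : ∀ j, |(x.vel - (b.lvl.physics.gravity : ℤ) • up) j| ≤ 2 * b.size := by
    intro j
    refine (abs_sub _ _).trans ?_
    linarith [Base.abs_le_of_fits hfit.2.1 j, hup hg j]
  have hsq : 0 ≤ (b.size : ℤ) ^ 2 := by positivity
  have hvel : ∀ j, |(x.start b.lvl i).vel j| ≤ b.maxSpeed := by
    intro j
    rw [show (x.start b.lvl i).vel = if ((x.stance b.lvl i).fire b.lvl i).Grounded b.lvl then i.wish b.lvl.physics.walkSpeed +
      (if i.jump then (b.lvl.physics.jumpSpeed : ℤ) • up else 0)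
      else x.vel - (b.lvl.physics.gravity : ℤ) • up from rfl]
    by_cases h : ((x.stance b.lvl i).fire b.lvl i).Grounded b.lvl
    · rw [if_pos h]
      linarith [hground j, b.size_pos]
    · rw [if_neg h]
      refine (hair j).trans ?_
      unfold Base.maxSpeed
      linarith
  have hdisp : ∀ j, |(x.start b.lvl i).disp j| ≤ b.maxSpeed := by
    intro j
    rw [show (x.start b.lvl i).disp = if ((x.stance b.lvl i).fire b.lvl i).Grounded b.lvl then i.wish b.lvl.physics.walkSpeed +
      (if i.jump then (b.lvl.physics.jumpSpeed : ℤ) • up else 0)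
      else x.vel - (b.lvl.physics.gravity : ℤ) • up + i.wish b.lvl.physics.airSpeed from rfl]
    by_cases h : ((x.stance b.lvl i).fire b.lvl i).Grounded b.lvl
    · rw [if_pos h]
      linarith [hground j, b.size_pos]
    · rw [if_neg h]
      refine (abs_add_le _ _).trans ((add_le_add (hair j) (Base.abs_wish_le hi ha j)).trans ?_)
      unfold Base.maxSpeed
      linarith
  have hn : ((x.start b.lvl i).n : ℤ) ≤ b.maxCount := by
    have : ((x.start b.lvl i).n : ℤ) = |(x.start b.lvl i).disp 0| + |(x.start b.lvl i).disp 1| +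
        |(x.start b.lvl i).disp 2| + 2 := by
      rw [Int.abs_eq_natAbs, Int.abs_eq_natAbs, Int.abs_eq_natAbs]
      rfl
    rw [this, Base.maxCount]
    linarith [hdisp 0, hdisp 1, hdisp 2]
  have hrem := Cfg.start_rem b.lvl i x
  have hpos : ∀ j, |x.pos j| ≤ b.maxExit := fun j =>
    (Base.abs_le_of_fits hfit.1 j).trans b.size_le_maxExit
  refine ⟨hn, ?_, ?_, ?_, ?_, ?_, ?_, ?_⟩
  · rw [hrem]
    exact (Nat.zero_add _).le
  · rw [hrem, sub_self, Int.cast_zero, mul_zero, add_zero]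
    exact eucl_le_two_mul hdisp
  · rw [hrem, sub_self, Int.cast_zero, mul_zero, add_zero]
    exact eucl_le_two_mul hvel
  · rw [hrem, sub_self, zero_mul, add_zero]
    exact hpos
  · rw [hrem, sub_self, zero_mul, add_zero]
    exact hpos
  · intro c
    rw [show (x.start b.lvl i).idx c = if i.fire = some c ∧
      b.lvl.shotIdx (b.lvl.eye (x.stance b.lvl i).cr x.pos) i.cursor < b.lvl.surfaces.length then
      b.lvl.shotIdx (b.lvl.eye (x.stance b.lvl i).cr x.pos) i.cursor + 1 else x.idx c from rfl]
    split_ifs with h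
    · exact h.2
    · exact hb.idx c
  · intro c j
    rw [show (x.start b.lvl i).ctr c = if i.fire = some c ∧
      b.lvl.shotIdx (b.lvl.eye (x.stance b.lvl i).cr x.pos) i.cursor < b.lvl.surfaces.length then
      b.lvl.shotCenter (b.lvl.eye (x.stance b.lvl i).cr x.pos) i.cursor else x.ctr c from rfl]
    split_ifs with h
    · exact Base.abs_shotCenter_le h.2 j
    · exact hb.ctr c j

/-- The difference `n - rem` counts the substeps done. One more substep adds at most six to the
norms, by a passage, and at most `b.maxMove` to the positions; an exit place is bounded on its own,
independently of what came before. -/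
theorem Bounded.substep (hb : Bounded b x) (hrem : 0 < x.rem) :
    Bounded b (x.substep b.lvl) := by
  obtain ⟨f1, f2, f3, f4, f5, f6⟩ := Cfg.advance_fields b.lvl x
  have hk := hb.k
  have hsucc : ((x.n : ℤ) - ((x.rem - 1 : ℕ) : ℤ)) = (x.n - x.rem : ℤ) + 1 := by omega
  have hnn : (0 : ℤ) ≤ x.n - x.rem := by omega
  set t : ℤ := (x.n - x.rem : ℤ) with ht
  have hdispn : ∀ j, |x.disp j| ≤ b.maxNorm := by
    intro j
    have h1 : eucl x.disp ≤ 2 * b.maxSpeed + 6 * (t : ℝ) := hb.disp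
    replace h1 := (abs_le_eucl x.disp j).trans h1
    have h2 : |x.disp j| ≤ 2 * b.maxSpeed + 6 * t := by exact_mod_cast h1
    unfold Base.maxNorm
    have := hb.n
    omega
  -- Truncated division by `n` does not increase the absolute value, and `k + 1 ≤ n ≤ b.maxCount`
  -- because a substep remains.
  have htarget : ∀ j, |x.target j| ≤ b.maxExit + t * b.maxMove + b.maxCount * b.maxNorm := by
    intro j
    refine (abs_add_le _ _).trans (add_le_add (hb.base j) ?_)
    have h1 : |((((x.k : ℤ) + 1) * x.disp j).tdiv x.n)| ≤ |((x.k : ℤ) + 1) * x.disp j| := by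
      rw [Int.abs_eq_natAbs, Int.abs_eq_natAbs, Int.natAbs_tdiv]
      exact_mod_cast Nat.div_le_self _ _
    refine h1.trans ?_
    rw [abs_mul]
    refine mul_le_mul ?_ (hdispn j) (abs_nonneg _) b.maxCount_nonneg
    rw [abs_of_nonneg (by positivity)]
    have := hb.n
    omega
  have hmove := b.size_le_maxMove
  have hmul : 0 ≤ t * b.maxMove := mul_nonneg hnn (by linarith [b.size_pos])
  have hexit : ∀ c j, |b.lvl.exitPlace x.cr (x.idx c) (x.ctr c) j| ≤
      b.maxExit + (t + 1) * b.maxMove := fun c j =>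
    (Base.abs_exitPlace_le (hb.ctr c) j).trans (by linarith [b.size_pos])
  have hreal : ((t + 1 : ℤ) : ℝ) = t + 1 := by push_cast; rfl
  -- the bounds on the components that change
  have key : ((x.advance b.lvl).k + (x.rem - 1) ≤ x.n) ∧
      (eucl (x.advance b.lvl).disp ≤ 2 * b.maxSpeed + 6 * ((t + 1 : ℤ) : ℝ)) ∧
      (eucl (x.advance b.lvl).vel ≤ 2 * b.maxSpeed + 6 * ((t + 1 : ℤ) : ℝ)) ∧
      (∀ j, |(x.advance b.lvl).pos j| ≤ b.maxExit + (t + 1) * b.maxMove) ∧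
      ∀ j, |(x.advance b.lvl).base j| ≤ b.maxExit + (t + 1) * b.maxMove := by
    have hd := hb.disp
    have hv := hb.vel
    have hthrough : ∀ c, ((x.through b.lvl c).k + (x.rem - 1) ≤ x.n) ∧
        (eucl (x.through b.lvl c).disp ≤ 2 * b.maxSpeed + 6 * ((t + 1 : ℤ) : ℝ)) ∧
        (eucl (x.through b.lvl c).vel ≤ 2 * b.maxSpeed + 6 * ((t + 1 : ℤ) : ℝ)) ∧
        (∀ j, |(x.through b.lvl c).pos j| ≤ b.maxExit + (t + 1) * b.maxMove) ∧
        ∀ j, |(x.through b.lvl c).base j| ≤ b.maxExit + (t + 1) * b.maxMove := by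
      intro c
      rw [hreal]
      refine ⟨?_, (eucl_turn_le _ _ _).trans (by linarith), (eucl_turn_le _ _ _).trans
        (by linarith), hexit _, hexit _⟩
      change 0 + _ ≤ _
      omega
    unfold Cfg.advance
    split_ifs with h1 h2 h3
    · exact hthrough _
    · exact hthrough _
    · have hclimb : ∀ j, |((x.climbIdx b.lvl : ℤ) • up) j| ≤ b.size := by
        have h4 := b.physics_le (z := b.lvl.physics.stepHeight) (by simp [Physics.encode])
        have h5 : (x.climbIdx b.lvl : ℤ) ≤ b.size := by
          unfold Cfg.climbRange at h3
          have := b.size_pos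
          split_ifs at h3 <;> omega
        intro j
        fin_cases j <;> simp [up, h5]
      rw [hreal]
      refine ⟨?_, hd.trans (by linarith), hv.trans (by linarith), fun j => ?_, fun j => ?_⟩
      · change x.k + 1 + _ ≤ _
        omega
      · refine (abs_add_le _ _).trans ((add_le_add (htarget j) (hclimb j)).trans ?_)
        rw [add_mul, one_mul]
        conv_rhs => rw [Base.maxMove]
        rw [Base.maxMove]
        linarith
      · refine (abs_add_le _ _).trans ((add_le_add (hb.base j) (hclimb j)).trans ?_)
        linarith
    · rw [hreal]
      refine ⟨?_, (eucl_erase_le _ _).trans (hd.trans (by linarith)),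
        (eucl_erase_le _ _).trans (hv.trans (by linarith)),
        fun j => (hb.pos j).trans (by linarith [b.size_pos]),
        fun j => (hb.pos j).trans (by linarith [b.size_pos])⟩
      change 0 + _ ≤ _
      omega
  obtain ⟨k1, k2, k3, k4, k5⟩ := key
  unfold Cfg.substep Cfg.fizzle
  refine ⟨?_, ?_, ?_, ?_, ?_, ?_, ?_, ?_⟩ <;> simp only [f3, f4, f5, f6, hsucc]
  · exact hb.n
  · exact k1
  · exact k2
  · exact k3
  · exact k4
  · exact k5
  · intro c
    split_ifs
    · exact Nat.zero_le _
    · exact hb.idx c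
  · exact hb.ctr

theorem CReach.bounded (h : CReach b.lvl x) : Bounded b x := by
  induction h with
  | initial => exact bounded_initial b
  | start _ _ hfit hi ih => exact ih.start hfit hi
  | substep _ hrem ih => exact ih.substep hrem

/-- All numbers in the configuration have at most the given absolute value. -/
structure Cfg.Small (M : ℤ) (x : Cfg) : Prop where
  base : ∀ j, |x.base j| ≤ M
  disp : ∀ j, |x.disp j| ≤ M
  pos : ∀ j, |x.pos j| ≤ M
  vel : ∀ j, |x.vel j| ≤ M
  k : (x.k : ℤ) ≤ M
  n : (x.n : ℤ) ≤ M
  rem : (x.rem : ℤ) ≤ M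
  idx : ∀ c, (x.idx c : ℤ) ≤ M
  ctr : ∀ c j, |x.ctr c j| ≤ M

theorem Bounded.small (hb : Bounded b x) {M : ℤ} (h1 : b.maxCount ≤ M) (h2 : b.maxNorm ≤ M)
    (h3 : b.maxPos ≤ M) (h4 : (b.size : ℤ) ≤ M) : x.Small M := by
  have hk := hb.k
  have hn := hb.n
  have hnorm : ∀ v : Vec, eucl v ≤ 2 * b.maxSpeed + 6 * ((x.n - x.rem : ℤ) : ℝ) →
      ∀ j, |v j| ≤ M := by
    intro v hv j
    have h5 := (abs_le_eucl v j).trans hv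
    have h6 : |v j| ≤ 2 * b.maxSpeed + 6 * (x.n - x.rem : ℤ) := by exact_mod_cast h5
    unfold Base.maxNorm at h2
    omega
  have hpos : b.maxExit + (x.n - x.rem : ℤ) * b.maxMove ≤ M := by
    refine le_trans ?_ h3
    unfold Base.maxPos
    have := mul_le_mul_of_nonneg_right (show (x.n - x.rem : ℤ) ≤ b.maxCount by omega)
      (b.size_pos.le.trans b.size_le_maxMove)
    linarith
  exact ⟨fun j => (hb.base j).trans hpos, hnorm _ hb.disp, fun j => (hb.pos j).trans hpos,
    hnorm _ hb.vel, by omega, by omega, by omega,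
    fun c => le_trans (by exact_mod_cast hb.idx c) (b.surfaces_length_le.trans h4),
    fun c j => (hb.ctr c j).trans h4⟩

end

/-- The bounds are polynomials in the size, hence definable, and `Dfn` supplies one exponent for all
levels. The condition `1 ≤ c` lets representable cursors fit into the same range. -/
theorem exists_small : ∃ c : ℕ, 1 ≤ c ∧ ∀ (b : Base) (x : Cfg), CReach b.lvl x →
    x.Small ((b.size : ℤ) ^ c) := by
  have h0 : Dfn fun b : Base => b.maxSpeed := by
    change Dfn fun b : Base => 2 * ((sz b : ℕ) : ℤ) ^ 2 + 2 * ((sz b : ℕ) : ℤ)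
    infer_instance
  have h1 : Dfn fun b : Base => b.maxCount := by
    unfold Base.maxCount
    infer_instance
  have h2 : Dfn fun b : Base => b.maxNorm := by
    unfold Base.maxNorm
    infer_instance
  have h3 : Dfn fun b : Base => b.maxPos := by
    have h4 : Dfn fun b : Base => b.maxExit := by
      change Dfn fun b : Base => ((sz b : ℕ) : ℤ) +
        (3 * ((sz b : ℕ) : ℤ) + 4) * (8 * ((sz b : ℕ) : ℤ) ^ 2)
      infer_instance
    have h5 : Dfn fun b : Base => b.maxMove := by
      change Dfn fun b : Base => b.maxCount * b.maxNorm + ((sz b : ℕ) : ℤ)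
      infer_instance
    unfold Base.maxPos
    infer_instance
  obtain ⟨c₁, h₁⟩ := h1.exists_bound
  obtain ⟨c₂, h₂⟩ := h2.exists_bound
  obtain ⟨c₃, h₃⟩ := h3.exists_bound
  refine ⟨c₁ + c₂ + c₃ + 1, by omega, fun b x hx => hx.bounded.small
    ((le_abs_self _).trans (h₁ b _ (by omega))) ((le_abs_self _).trans (h₂ b _ (by omega)))
    ((le_abs_self _).trans (h₃ b _ (by omega))) ?_⟩
  have := sz_pow_mono b (show 1 ≤ c₁ + c₂ + c₃ + 1 by omega)
  rwa [pow_one] at this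

end PortalGame

end

/-! ## Codes of configurations -/

noncomputable section

namespace PortalGame

open scoped Classical
open Ram

theorem exists_digits {S : ℕ} (T : ℕ) : ∀ f : ℕ → ℕ, (∀ t < T, f t < S) →
    ∃ a < S ^ T, ∀ t < T, a / S ^ t % S = f t := by
  induction T with
  | zero => exact fun f _ => ⟨0, by simp, fun t ht => absurd ht (by omega)⟩
  | succ T ih =>
    intro f hf
    obtain ⟨a, ha, h⟩ := ih (fun t => f (t + 1)) fun t ht => hf (t + 1) (by omega)
    have h0 := hf 0 (by omega)
    have hS : 0 < S := by omega
    refine ⟨f 0 + S * a, ?_, fun t ht => ?_⟩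
    · calc f 0 + S * a < S + S * a := by omega
        _ = S * (a + 1) := by ring
        _ ≤ S * S ^ T := Nat.mul_le_mul_left _ ha
        _ = S ^ (T + 1) := (pow_succ' _ _).symm
    · cases t with
      | zero => simp [Nat.mod_eq_of_lt h0]
      | succ t =>
        rw [pow_succ', ← Nat.div_div_eq_div_mul, Nat.add_mul_div_left _ _ hS,
          Nat.div_eq_of_lt h0, Nat.zero_add]
        exact h t (by omega)

/-- The integer with number `t` in the code `a`. -/
def entry (c R a t : ℕ) : ℤ := ((a / (R ^ (c + 2)) ^ t % R ^ (c + 2) : ℕ) : ℤ) - (R : ℤ) ^ c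

/-- A shift by `R ^ c` makes the entries nonnegative, and the base `R ^ (c + 2) ≥ 4 * R ^ c` leaves
room for them as digits. -/
theorem exists_entries {c R T : ℕ} (hR : 2 ≤ R) (z : ℕ → ℤ) (hz : ∀ t < T, |z t| ≤ (R : ℤ) ^ c) :
    ∃ a < (R ^ (c + 2)) ^ T, ∀ t < T, entry c R a t = z t := by
  have hpos : (0 : ℤ) < (R : ℤ) ^ c := pow_pos (by omega) c
  have h4 : 4 * (R : ℤ) ^ c ≤ (R : ℤ) ^ (c + 2) := by
    rw [pow_add, mul_comm]
    exact mul_le_mul_of_nonneg_left (by nlinarith) hpos.le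
  obtain ⟨a, ha, h⟩ := exists_digits (S := R ^ (c + 2)) T (fun t => (z t + (R : ℤ) ^ c).toNat)
    fun t ht => by
      have := abs_le.1 (hz t ht)
      zify
      rw [Int.toNat_of_nonneg (by linarith)]
      linarith
  refine ⟨a, ha, fun t ht => ?_⟩
  have := abs_le.1 (hz t ht)
  rw [entry, h t ht, Int.toNat_of_nonneg (by linarith)]
  ring

def entryVec (c R a t : ℕ) : Vec := ![entry c R a t, entry c R a (t + 1), entry c R a (t + 2)]

/-- The configuration with the given code. -/
def decode (c R a : ℕ) : Cfg where
  base := entryVec c R a 0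
  disp := entryVec c R a 3
  pos := entryVec c R a 6
  vel := entryVec c R a 9
  k := (entry c R a 12).toNat
  n := (entry c R a 13).toNat
  rem := (entry c R a 14).toNat
  cr := decide (0 < entry c R a 15)
  walk := decide (0 < entry c R a 16)
  idx d := if d = .blue then (entry c R a 17).toNat else (entry c R a 18).toNat
  ctr d := if d = .blue then entryVec c R a 19 else entryVec c R a 22

/-- The input that is recorded in a code. -/
def decodeInput (c R a : ℕ) : Input where
  forward := SignType.sign (entry c R a 25)
  strafe := SignType.sign (entry c R a 26)
  jump := decide (0 < entry c R a 27)
  crouch := decide (0 < entry c R a 28)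
  fire := if entry c R a 29 = 1 then some .blue else if entry c R a 29 = 0 then some .orange
    else none
  cursor := entryVec c R a 30

/-- The entries of the code of a configuration and an input. -/
def entries (x : Cfg) (i : Input) : List ℤ :=
  [x.base 0, x.base 1, x.base 2, x.disp 0, x.disp 1, x.disp 2, x.pos 0, x.pos 1, x.pos 2,
    x.vel 0, x.vel 1, x.vel 2, (x.k : ℤ), (x.n : ℤ), (x.rem : ℤ), if x.cr then 1 else 0,
    if x.walk then 1 else 0, (x.idx .blue : ℤ), (x.idx .orange : ℤ), x.ctr .blue 0, x.ctr .blue 1, x.ctr .blue 2,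
    x.ctr .orange 0, x.ctr .orange 1, x.ctr .orange 2, (i.forward : ℤ), (i.strafe : ℤ),
    if i.jump then 1 else 0, if i.crouch then 1 else 0,
    if i.fire = some .blue then 1 else if i.fire = some .orange then 0 else -1,
    i.cursor 0, i.cursor 1, i.cursor 2]

theorem abs_entries_le {x : Cfg} {i : Input} {M : ℤ} (hM : 1 ≤ M) (hx : x.Small M)
    (hi : ∀ j, |i.cursor j| ≤ M) : ∀ z ∈ entries x i, |z| ≤ M := by
  have hsign : ∀ t : SignType, |(t : ℤ)| ≤ 1 := by decide
  have hite : ∀ p : Prop, ∀ _ : Decidable p, |(if p then 1 else 0 : ℤ)| ≤ M := by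
    intro p _
    split_ifs <;> simp <;> omega
  simp only [entries, List.forall_mem_cons, hx.base, hx.disp, hx.pos, hx.vel, Nat.abs_cast, hx.k,
    hx.n, hx.rem, hx.idx, hx.ctr, hi, hite, true_and, List.not_mem_nil, false_implies, implies_true,
    and_true]
  refine ⟨(hsign _).trans hM, (hsign _).trans hM, ?_⟩
  split_ifs <;> simp <;> omega

/-- A code also records an input, so that a search over codes is a search over inputs as well. Codes
need not be unique; only the existence of a code in the searched range matters. A code has `33`
entries. -/
theorem exists_code {c R : ℕ} (hR : 2 ≤ R) {x : Cfg} {i : Input} (hx : x.Small ((R : ℤ) ^ c))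
    (hi : ∀ j, |i.cursor j| ≤ (R : ℤ) ^ c) :
    ∃ a < (R ^ (c + 2)) ^ 33, decode c R a = x ∧ decodeInput c R a = i := by
  have hz := abs_entries_le (one_le_pow₀ (by omega)) hx hi
  obtain ⟨a, ha, h⟩ := exists_entries (T := 33) hR (fun t => (entries x i).getD t 0)
    fun t ht => by
      have ht' : t < (entries x i).length := ht
      simp only [List.getD_eq_getElem _ _ ht']
      exact hz _ (List.getElem_mem ht')
  have vec_ext : ∀ {v w : Vec}, v 0 = w 0 → v 1 = w 1 → v 2 = w 2 → v = w := fun h0 h1 h2 => by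
    ext j
    fin_cases j <;> assumption
  have hsign : ∀ t : SignType, SignType.sign (t : ℤ) = t := by decide
  refine ⟨a, ha, ?_, ?_⟩
  · ext1
    · exact vec_ext (h 0 (by omega)) (h 1 (by omega)) (h 2 (by omega))
    · exact vec_ext (h 3 (by omega)) (h 4 (by omega)) (h 5 (by omega))
    · exact vec_ext (h 6 (by omega)) (h 7 (by omega)) (h 8 (by omega))
    · exact vec_ext (h 9 (by omega)) (h 10 (by omega)) (h 11 (by omega))
    · exact congrArg Int.toNat (h 12 (by omega))
    · exact congrArg Int.toNat (h 13 (by omega))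
    · exact congrArg Int.toNat (h 14 (by omega))
    · have := h 15 (by omega)
      simp only [decode, this, entries]
      cases x.cr <;> simp
    · have := h 16 (by omega)
      simp only [decode, this, entries]
      cases x.walk <;> simp
    · funext d
      cases d
      · exact congrArg Int.toNat (h 17 (by omega))
      · exact congrArg Int.toNat (h 18 (by omega))
    · funext d
      cases d
      · exact vec_ext (h 19 (by omega)) (h 20 (by omega)) (h 21 (by omega))
      · exact vec_ext (h 22 (by omega)) (h 23 (by omega)) (h 24 (by omega))
  · have h25 : entry c R a 25 = (i.forward : ℤ) := h 25 (by omega)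
    have h26 : entry c R a 26 = (i.strafe : ℤ) := h 26 (by omega)
    have h27 : entry c R a 27 = if i.jump then 1 else 0 := h 27 (by omega)
    have h28 : entry c R a 28 = if i.crouch then 1 else 0 := h 28 (by omega)
    have h29 : entry c R a 29 = if i.fire = some .blue then 1 else
      if i.fire = some .orange then 0 else -1 := h 29 (by omega)
    have hc : entryVec c R a 30 = i.cursor :=
      vec_ext (h 30 (by omega)) (h 31 (by omega)) (h 32 (by omega))
    obtain ⟨f, s, ju, cr, fi, cu⟩ := i
    rw [decodeInput, h25, h26, h27, h28, h29, hc, Input.mk.injEq]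
    refine ⟨hsign f, hsign s, by cases ju <;> simp, by cases cr <;> simp, ?_, rfl⟩
    rcases fi with _ | ⟨_ | _⟩ <;> simp

section

variable {Γ : Type} [Ctx Γ]

instance Dfn.nat_mod {f g : Γ → ℕ} [Dfn fun γ => (f γ : ℤ)] [Dfn fun γ => (g γ : ℤ)] :
    Dfn fun γ => ((f γ % g γ : ℕ) : ℤ) :=
  (show Dfn fun γ => (f γ : ℤ) - (g γ : ℤ) * ((f γ / g γ : ℕ) : ℤ) from inferInstance).congr
    fun γ => by
      have := Nat.div_add_mod (f γ) (g γ)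
      zify at this ⊢
      linarith

instance Dfn.entry {c t : ℕ} {a : Γ → ℕ} [Dfn fun γ => (a γ : ℤ)] :
    Dfn fun γ => entry c (sz γ) (a γ) t := by
  unfold PortalGame.entry
  infer_instance

instance DfnV.entryVec {c t : ℕ} {a : Γ → ℕ} [Dfn fun γ => (a γ : ℤ)] :
    DfnV fun γ => entryVec c (sz γ) (a γ) t := by
  unfold PortalGame.entryVec
  infer_instance

instance DfnC.decode {c : ℕ} {a : Γ → ℕ} [Dfn fun γ => (a γ : ℤ)] :
    DfnC fun γ => decode c (sz γ) (a γ) := by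
  constructor <;> simp only [PortalGame.decode] <;> infer_instance

instance DfnI.decodeInput {c : ℕ} {a : Γ → ℕ} [Dfn fun γ => (a γ : ℤ)] :
    DfnI fun γ => decodeInput c (sz γ) (a γ) where
  forward := (show Dfn fun γ => (entry c (sz γ) (a γ) 25).sign from inferInstance).congr
    fun γ => (Int.sign_eq_sign _).symm
  strafe := (show Dfn fun γ => (entry c (sz γ) (a γ) 26).sign from inferInstance).congr
    fun γ => (Int.sign_eq_sign _).symm
  jump := by simp only [PortalGame.decodeInput]; infer_instance
  crouch := by simp only [PortalGame.decodeInput]; infer_instance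
  cursor := by simp only [PortalGame.decodeInput]; infer_instance
  fire d := by
    cases d
    · exact (show DfnP fun γ => entry c (sz γ) (a γ) 29 = 1 from inferInstance).congr fun γ => by
        simp only [PortalGame.decodeInput]
        split_ifs <;> simp [*]
    · exact (show DfnP fun γ => entry c (sz γ) (a γ) 29 = 0 from inferInstance).congr fun γ => by
        simp only [PortalGame.decodeInput]
        split_ifs <;> simp [*]

end

/-! ### Steps between codes -/

/-- The code `y` follows the code `a`; the input is the one that `y` records. -/
def Follows (L : Level) (c R a y : ℕ) : Prop :=
  ((decode c R a).rem = 0 ∧ (decode c R a).Fits L ∧ (decodeInput c R y).Legal L ∧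
    decode c R y = (decode c R a).start L (decodeInput c R y)) ∨
  0 < (decode c R a).rem ∧ decode c R y = (decode c R a).substep L

/-- The code `y` is initial or follows a code in `A`. -/
def Grows (L : Level) (c R : ℕ) (A : ℕ → Prop) (y : ℕ) : Prop :=
  decode c R y = Cfg.initial L ∨ ∃ a, a < R ^ ((c + 2) * 33) ∧ (A a ∧ Follows L c R a y)

/-- The code is marked in the memory. -/
def Marked (mem : ℤ → ℤ) (a : ℕ) : Prop := 0 < mem (-1 - (a : ℤ))

section

variable {Γ : Type} [Ctx Γ]

instance DfnP.marked {a : Γ → ℕ} [ha : Dfn fun γ => (a γ : ℤ)] :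
    DfnP fun γ => Marked (Ctx.base γ).mem (a γ) := by
  obtain ⟨⟨t, ht⟩, -⟩ := (show Dfn fun γ => (-1 : ℤ) - (a γ : ℤ) from inferInstance)
  exact ⟨.mem t, fun γ E h => by simp only [Tm.value, ht γ E h, h.mem, Marked]⟩

instance DfnP.follows {c : ℕ} {a y : Γ → ℕ} [Dfn fun γ => (a γ : ℤ)] [Dfn fun γ => (y γ : ℤ)] :
    DfnP fun γ => Follows (lv γ) c (sz γ) (a γ) (y γ) := by
  have h1 : DfnP fun γ => PortalGame.decode c (sz γ) (y γ) =
    (PortalGame.decode c (sz γ) (a γ)).start (lv γ) (PortalGame.decodeInput c (sz γ) (y γ)) :=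
      .cfg_eq
  have h2 : DfnP fun γ => PortalGame.decode c (sz γ) (y γ) =
    (PortalGame.decode c (sz γ) (a γ)).substep (lv γ) := .cfg_eq
  unfold Follows
  infer_instance

instance DfnP.grows {c : ℕ} {y : Γ → ℕ} [Dfn fun γ => (y γ : ℤ)] :
    DfnP fun γ => Grows (lv γ) c (sz γ) (Marked (Ctx.base γ).mem) (y γ) := by
  have h1 : DfnP fun γ => PortalGame.decode c (sz γ) (y γ) = Cfg.initial (lv γ) := .cfg_eq
  unfold Grows
  infer_instance

end

theorem CReach.of_grows {L : Level} {c R : ℕ} {A : ℕ → Prop}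
    (hA : ∀ a, A a → CReach L (decode c R a)) {y : ℕ} (h : Grows L c R A y) :
    CReach L (decode c R y) := by
  rcases h with h | ⟨a, -, ha, ⟨h1, h2, h3, h4⟩ | ⟨h1, h2⟩⟩
  · rw [h]
    exact .initial
  · rw [h4]
    exact (hA a ha).start h1 h2 h3
  · rw [h2]
    exact (hA a ha).substep h1

/-- Completeness: a set of codes closed under `Grows` contains a code of every configuration that
occurs, by induction along the game. -/
theorem CReach.exists_code {b : Base} {c : ℕ} (hc : 1 ≤ c)
    (hsmall : ∀ x, CReach b.lvl x → x.Small ((b.size : ℤ) ^ c)) {A : ℕ → Prop}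
    (hA : ∀ y, y < b.size ^ ((c + 2) * 33) → Grows b.lvl c b.size A y → A y) {x : Cfg}
    (h : CReach b.lvl x) :
    ∃ a, a < b.size ^ ((c + 2) * 33) ∧ (A a ∧ decode c b.size a = x) := by
  have hsz : 2 ≤ b.size := two_le_sz b
  have code : ∀ {x : Cfg}, CReach b.lvl x → ∀ i : Input, (∀ j, |i.cursor j| ≤ (b.size : ℤ)) →
      ∃ a < b.size ^ ((c + 2) * 33), decode c b.size a = x ∧ decodeInput c b.size a = i := by
    intro x hx i hi
    rw [pow_mul]
    refine PortalGame.exists_code hsz (hsmall x hx) fun j => (hi j).trans ?_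
    calc (b.size : ℤ) = (b.size : ℤ) ^ 1 := (pow_one _).symm
      _ ≤ _ := pow_le_pow_right₀ (by omega) hc
  induction h with
  | initial =>
    obtain ⟨a, h1, h2, -⟩ := code .initial ⟨0, 0, false, false, none, 0⟩ fun j => by simp
    exact ⟨a, h1, hA a h1 (Or.inl h2), h2⟩
  | @start x i hx hrem hfit hi ih =>
    obtain ⟨a, h1, h2, rfl⟩ := ih
    -- The code of the successor is chosen so as to record the input `i`, from which `Follows`
    -- recomputes the tick. In the other two cases any input would do.
    obtain ⟨y, h3, h4, h5⟩ := code (hx.start hrem hfit hi) i fun j => Base.abs_le_of_fits hi.2 j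
    refine ⟨y, h3, hA y h3 (Or.inr ⟨a, h1, h2, Or.inl ⟨hrem, hfit, ?_, ?_⟩⟩), h4⟩
    · rwa [h5]
    · rw [h4, h5]
  | @substep x hx hrem ih =>
    obtain ⟨a, h1, h2, rfl⟩ := ih
    obtain ⟨y, h3, h4, -⟩ := code (hx.substep hrem) ⟨0, 0, false, false, none, 0⟩ fun j => by simp
    exact ⟨y, h3, hA y h3 (Or.inr ⟨a, h1, h2, Or.inr ⟨hrem, h4⟩⟩), h4⟩

/-! ### Saturation -/

/-- A set of numbers below `X` to which elements are added in turn is closed after `X` rounds. -/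
theorem exists_closed {X : ℕ} (F : (ℕ → Prop) → ℕ → Prop) (A : ℕ → ℕ → Prop)
    (hstep : ∀ i < (X + 1) * X, ∀ y < X,
      A (i + 1) y ↔ A i y ∨ y = i % X ∧ F (A i) y)
    (hF : ∀ {B C : ℕ → Prop}, (∀ y < X, B y ↔ C y) → ∀ y, F B y → F C y) :
    ∃ i ≤ X * X, (∀ y < X, F (A i) y → A i y) ∧ ∀ y < X, A i y → A ((X + 1) * X) y := by
  have hmono : ∀ i j, i ≤ j → j ≤ (X + 1) * X → ∀ y < X, A i y → A j y := by
    intro i j hij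
    induction j, hij using Nat.le_induction with
    | base => exact fun _ _ _ h => h
    | succ j hij ih => exact fun hj y hy h =>
        (hstep j (by omega) y hy).2 (Or.inl (ih (by omega) y hy h))
  by_contra hcon
  push Not at hcon
  have hopen : ∀ s ≤ X, ∃ y < X, F (A (s * X)) y ∧ ¬ A (s * X) y := by
    intro s hs
    by_contra hclosed
    push Not at hclosed
    obtain ⟨y, hy, h1, h2⟩ := hcon (s * X) (Nat.mul_le_mul_right _ hs) hclosed
    exact h2 (hmono _ _ (Nat.mul_le_mul_right _ (by omega)) le_rfl y hy h1)
  -- If no stage were as desired, every sweep of `X` rounds would add a number, and `X + 1` sweeps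
  -- would add more than there are.
  have hcard : ∀ s ≤ X + 1, s ≤ ((Finset.range X).filter fun y => A (s * X) y).card := by
    intro s
    induction s with
    | zero => exact fun _ => Nat.zero_le _
    | succ s ih =>
      intro hs
      refine (Nat.succ_le_succ (ih (by omega))).trans (Finset.card_lt_card ?_)
      have hle : (s + 1) * X ≤ (X + 1) * X := Nat.mul_le_mul_right _ hs
      have hsX : (s + 1) * X = s * X + X := by ring
      have hsub : ∀ y < X, A (s * X) y → A ((s + 1) * X) y :=
        hmono _ _ (by omega) hle
      rw [Finset.ssubset_iff_of_subset]
      · obtain ⟨y, hy, h1, h2⟩ := hopen s (by omega)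
        by_contra hno
        push Not at hno
        have hback : ∀ z < X, A ((s + 1) * X) z → A (s * X) z := fun z hz h =>
          (Finset.mem_filter.1 (hno z (Finset.mem_filter.2 ⟨Finset.mem_range.2 hz, h⟩))).2
        -- If the sweep added nothing, the set would still be the same when the turn of `y` comes,
        -- and `y` would be added after all.
        have hsame : ∀ z < X, A (s * X) z ↔ A (s * X + y) z := fun z hz =>
          ⟨hmono _ _ (by omega) (by omega) z hz, fun h =>
            hback z hz (hmono _ _ (by omega) hle z hz h)⟩
        have hadd : A (s * X + y + 1) y := by
          refine (hstep _ (by omega) y hy).2 (Or.inr ⟨?_, hF hsame y h1⟩)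
          rw [Nat.add_comm, Nat.add_mul_mod_self_right, Nat.mod_eq_of_lt hy]
        exact h2 (hback y hy (hmono _ _ (by omega) hle y hy hadd))
      · intro y hy
        rw [Finset.mem_filter, Finset.mem_range] at hy ⊢
        exact ⟨hy.1, hsub y hy.1 hy.2⟩
  have h1 := hcard (X + 1) le_rfl
  have h2 := Finset.card_filter_le (Finset.range X) fun y => A ((X + 1) * X) y
  rw [Finset.card_range] at h2
  omega

theorem grows_congr {L : Level} {c R : ℕ} {B C : ℕ → Prop}
    (h : ∀ y < R ^ ((c + 2) * 33), B y ↔ C y) (y : ℕ) (hy : Grows L c R B y) :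
    Grows L c R C y := by
  rcases hy with hy | ⟨a, h1, h2, h3⟩
  · exact Or.inl hy
  · exact Or.inr ⟨a, h1, (h a h1).1 h2, h3⟩

/-! ### The program -/

/-- The level with another memory that starts with its encoding. -/
def Base.withMem (b : Base) (m : ℤ → ℤ) (h : ∀ z : ℕ, m z = b.mem z) : Base :=
  ⟨b.lvl, b.wf, m, fun i hi => (h i).trans (b.mem_eq i hi)⟩

theorem Base.size_withMem (b : Base) (m : ℤ → ℤ) (h : ∀ z : ℕ, m z = b.mem z) :
    (b.withMem m h).size = b.size := by
  rw [Base.size_eq, Base.size_eq]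
  rfl

theorem rep_withMem {k : ℕ} (b : Base) {m : ℤ → ℤ} (hm : ∀ z : ℕ, m z = b.mem z) {i : ℕ} (hi : i < b.size ^ k) :
    Rep (⟨b.withMem m hm, i, by rwa [sz, Ctx.base, ← b.size_withMem m hm] at *⟩ : Ext k Base)
      ⟨b.size, m, fun _ => i⟩ :=
  ⟨(b.size_withMem m hm).symm, rfl, fun x hx => by
    obtain rfl : x = 0 := by
      change x < 0 + 1 at hx
      omega
    rfl⟩

/-- The marks are at negative addresses, so the encoding of the level stays intact. -/
theorem tableMem_natCast {c k : ℕ} {a v : Tm} (ha : ∀ (γ : Ext k Base) E, Rep γ E →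
      a.value E = -1 - ((γ.i % sz γ ^ ((c + 2) * 33) : ℕ) : ℤ)) (b : Base) {i : ℕ} (hi : i ≤ b.size ^ k) (z : ℕ) :
    tableMem b.size a v b.mem i z = b.mem z := by
  induction i generalizing z with
  | zero => rfl
  | succ i ih =>
    have h1 := ha _ _ (rep_withMem (k := k) b (ih (by omega)) (i := i) (by omega))
    rw [tableMem, Function.update_of_ne, ih (by omega)]
    rw [h1]
    generalize (_ % _ : ℕ) = q
    omega

/-- Round `i` treats the code `i` modulo the number of codes. The value written is positive also
when the code was marked before, so marks are never lost. -/
theorem marked_tableMem_succ {c k : ℕ} {a v : Tm} (ha : ∀ (γ : Ext k Base) E, Rep γ E →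
      a.value E = -1 - ((γ.i % sz γ ^ ((c + 2) * 33) : ℕ) : ℤ))
    (hv : ∀ (γ : Ext k Base) E, Rep γ E → (0 < v.value E ↔
      Marked (Ctx.base γ).mem (γ.i % sz γ ^ ((c + 2) * 33)) ∨ Grows (lv γ) c (sz γ)
        (Marked (Ctx.base γ).mem) (γ.i % sz γ ^ ((c + 2) * 33)))) (b : Base) {i : ℕ} (hi : i < b.size ^ k) {y : ℕ} :
    Marked (tableMem b.size a v b.mem (i + 1)) y ↔ Marked (tableMem b.size a v b.mem i) y ∨
      y = i % b.size ^ ((c + 2) * 33) ∧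
        Grows b.lvl c b.size (Marked (tableMem b.size a v b.mem i)) y := by
  have hrep := rep_withMem (k := k) b (tableMem_natCast (v := v) ha b hi.le) hi
  have h1 := ha _ _ hrep
  have h2 := hv _ _ hrep
  simp only [sz, Ctx.base, lv, b.size_withMem] at h1 h2
  rw [Marked, tableMem, Function.update_apply, h1]
  by_cases h : y = i % b.size ^ ((c + 2) * 33)
  · rw [if_pos (by rw [h]), h2, h]
    simp only [true_and]
    rfl
  · rw [if_neg (by omega)]
    simp only [h, false_and, or_false]
    rfl

/-- By induction on the rounds only codes of configurations that occur are marked. Saturation and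
completeness show that in the end each such configuration has a marked code. The final term looks
for a marked code between ticks that is representable and at the end location. -/
theorem solvable : SolvableInPseudopolynomialTime (fun L : Level => L.WellFormed)
    Level.encode Level.Traversable := by
  obtain ⟨c, hc, hsmall⟩ := exists_small
  set K := (c + 2) * 33 with hK
  obtain ⟨⟨a, ha⟩, -⟩ : Dfn fun γ : Ext (K * 2 + 1) Base =>
    -1 - ((γ.i % sz γ ^ K : ℕ) : ℤ) := inferInstance
  obtain ⟨v, hv⟩ : DfnP fun γ : Ext (K * 2 + 1) Base => Marked (Ctx.base γ).mem (γ.i % sz γ ^ K) ∨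
    Grows (lv γ) c (sz γ) (Marked (Ctx.base γ).mem) (γ.i % sz γ ^ K) := inferInstance
  obtain ⟨w, hw⟩ : DfnP fun b : Base => ∃ y, y < sz b ^ K ∧ (Marked (Ctx.base b).mem y ∧
    (decode c (sz b) y).rem = 0 ∧ (decode c (sz b) y).Fits (lv b) ∧
      (decode c (sz b) y).Won (lv b)) := inferInstance
  refine solvable_of_table (K * 2 + 1) a (.ite v (.lit 1) (.lit 0)) w (fun E => ?_)
    (fun L _ => two_le_unarySize_encode L) fun L hL => ?_
  · simp only [Tm.value]
    split_ifs <;> simp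
  have hv' : ∀ (γ : Ext (K * 2 + 1) Base) E, Rep γ E →
      (0 < (Tm.ite v (.lit 1) (.lit 0)).value E ↔ Marked (Ctx.base γ).mem (γ.i % sz γ ^ K) ∨
        Grows (lv γ) c (sz γ) (Marked (Ctx.base γ).mem) (γ.i % sz γ ^ K)) := by
    intro γ E h
    rw [← hv γ E h]
    simp only [Tm.value]
    split_ifs <;> simp [*]
  set v' := Tm.ite v (.lit 1) (.lit 0)
  let b : Base := ⟨L, hL, (initial L.encode).mem, fun i hi => initial_mem_natCast _ hi⟩
  have hb : unarySize L.encode = b.size := (Base.size_eq b).symm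
  rw [hb]
  set N := b.size ^ (K * 2 + 1) with hN
  set X := b.size ^ K with hX
  set A : ℕ → ℕ → Prop := fun i => Marked (tableMem b.size a v' b.mem i) with hA
  -- Saturation needs `X + 1` sweeps of `X` rounds; the number of rounds must be a power of the
  -- size, whence the exponent `K * 2 + 1`.
  have hXN : (X + 1) * X ≤ N := by
    have h1 : 1 ≤ X := Nat.one_le_pow _ _ (by have := two_le_sz b; change 2 ≤ b.size at this; omega)
    have h2 : 2 ≤ b.size := two_le_sz b
    calc (X + 1) * X ≤ (2 * X) * X := Nat.mul_le_mul_right _ (by omega)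
      _ ≤ b.size * X * X := Nat.mul_le_mul_right _ (Nat.mul_le_mul_right _ h2)
      _ = N := by rw [hN, hX, pow_succ, pow_mul]; ring
  have hstep : ∀ i < N, ∀ y, A (i + 1) y ↔ A i y ∨ y = i % X ∧ Grows L c b.size (A i) y :=
    fun i hi y => marked_tableMem_succ ha hv' b hi
  -- marked codes are those of configurations that occur
  have hsound : ∀ i ≤ N, ∀ y, A i y → CReach L (decode c b.size y) := by
    intro i
    induction i with
    | zero =>
      intro _ y hy
      have hneg : ¬ (0 ≤ -1 - (y : ℤ)) := by omega
      have : ¬ (0 : ℤ) < (initial L.encode).mem (-1 - (y : ℤ)) := by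
        simp only [initial, if_neg hneg]
        exact lt_irrefl 0
      exact absurd hy this
    | succ i ih =>
      intro hi y hy
      rcases (hstep i (by omega) y).1 hy with h | ⟨-, h⟩
      · exact ih (by omega) y h
      · exact CReach.of_grows (ih (by omega)) h
  -- The surplus rounds can only add marks, and these are sound too.
  have hmono : ∀ i, (X + 1) * X ≤ i → i ≤ N → ∀ y, A ((X + 1) * X) y → A i y := by
    intro i hi
    induction i, hi using Nat.le_induction with
    | base => exact fun _ _ h => h
    | succ i _ ih => exact fun hi y h => (hstep i (by omega) y).2 (Or.inl (ih (by omega) y h))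
  obtain ⟨i, hi, hclosed, hlast⟩ := exists_closed (X := X) (Grows L c b.size) A
    (fun i hi y _ => hstep i (by omega) y) grows_congr
  have hcomplete : ∀ x, CReach L x → ∃ y, y < X ∧ (A N y ∧ decode c b.size y = x) := by
    intro x hx
    obtain ⟨y, h1, h2, h3⟩ := CReach.exists_code (b := b) hc (hsmall b) (A := A i) hclosed hx
    exact ⟨y, h1, hmono N hXN le_rfl y (hlast y h1 h2), h3⟩
  have hmem := tableMem_natCast (v := v') ha b (le_refl N)
  have hfinal := hw (b.withMem _ hmem) ⟨b.size, tableMem b.size a v' b.mem N, fun _ => (N : ℤ)⟩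
    ⟨(b.size_withMem _ hmem).symm, rfl, fun x hx => absurd hx (Nat.not_lt_zero x)⟩
  simp only [sz, Ctx.base, lv, b.size_withMem] at hfinal
  have hcast : ((N : ℕ) : ℤ) = (b.size : ℤ) ^ (K * 2 + 1) := by rw [hN]; push_cast; rfl
  rw [hcast] at hfinal
  refine hfinal.trans ?_
  rw [traversable_iff hL]
  constructor
  · rintro ⟨y, h1, h2, h3⟩
    exact ⟨_, hsound N le_rfl y h2, h3⟩
  · rintro ⟨x, h1, h2⟩
    obtain ⟨y, h3, h4, rfl⟩ := hcomplete x h1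
    exact ⟨y, h3, h4, h2⟩

end PortalGame

end

/-- Levels without grills form a subset of the instances with the same encoding and the same
question, so the same program and bound serve. -/
theorem mainTheorem12 :
    Ram.SolvableInPseudopolynomialTime
      (fun L : PortalGame.Level => L.WellFormed)
      PortalGame.Level.encode PortalGame.Level.Traversable ∧
    Ram.SolvableInPseudopolynomialTime
      (fun L : PortalGame.Level => L.WellFormed ∧ L.grills = [])
      PortalGame.Level.encode PortalGame.Level.Traversable := by
  obtain ⟨prog, bound, h⟩ := PortalGame.solvable
  exact ⟨⟨prog, bound, h⟩, prog, bound, fun L hL => h L hL.1⟩
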